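/- Let $n\ge 1$ and let $q\in\mathbb C$ be non-zero and not a root of unity. **The module $V$.** Put $\epsilon_0=0$, $\epsilon_{-i}=-\epsilon_i$, $(\epsilon_i,\epsilon_j)=\delta_{ij}$ for $1\le i,j\le n$, and let $\alpha_i=\epsilon_i-\epsilon_{i+1}$ ($i<n$), $\alpha_n=\epsilon_n$ be the simple roots of $osp(1|2n)$, with $2\rho=\sum_{i}(2n-2i+1)\epsilon_i$. Let $V$ be the fundamental $(2n+1)$-dimensional $U_q(osp(1|2n))$-module, with basis $v_k$, $-n\le k\le n$, where $v_0$ is even and all other $v_k$ are odd, and with non-zero actions $f_iv_i=v_{i+1}$, $f_iv_{-i-1}=v_{-i}$, $e_iv_{i+1}=v_i$, $e_iv_{-i}=v_{-i-1}$ ($i<n$), $f_nv_n=v_0$, $f_nv_0=v_{-n}$, $e_nv_0=v_n$, $e_nv_{-n}=-v_0$, $K_\beta v_k=q^{(\beta,\epsilon_k)}v_k$. **The operators $\check R_i$.** Let $\phi=\{\epsilon_i\pm\epsilon_j,\ \epsilon_k : i<j\}$, where the $\epsilon_k$ are odd and the other roots even. Fix any normal ordering $\prec$ of $\phi$ (a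 total order such that $\alpha\prec\beta$ and $\alpha+\beta\in\phi$ imply $\alpha\prec\alpha+\beta\prec\beta$), and any root vectors $E_\gamma,F_\gamma$ ($\gamma\in\phi$) constructed from it: $E_{\alpha_i}=e_i$, $F_{\alpha_i}=f_i$, and for non-simple $\gamma$, $E_\gamma=[E_\alpha,E_\beta]_q$, $F_\gamma=[F_\beta,F_\alpha]_{q^{-1}}$ for some $\alpha\prec\beta$ in $\phi$ with $\alpha+\beta=\gamma$ such that there are no other $\alpha',\beta'\in\phi$ with $\alpha'+\beta'=\gamma$ and both strictly between $\alpha$ and $\beta$; here $[X_\alpha,X_\beta]_q=X_\alpha X_\beta-(-1)^{[\alpha][\beta]}q^{(\alpha,\beta)}X_\beta X_\alpha$. Let $a_\gamma$ be the scalar with $E_\gamma F_\gamma-(-1)^{[\gamma]}F_\gamma E_\gamma=a_\gamma(K_\gamma-K_\gamma^{-1})/(q-q^{-1})$ on $V$. On $V\otimes V$ let $\widetilde R=\prod_{\gamma\in\phi}\exp_{q_\gamma}\!\big((-1)^{[\gamma]}a_\gamma^{-1}(q-q^{-1})E_\gamma\otimes F_\gamma\big)$, where the product is taken in increasing order, the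 tensor product of operators is graded, $q_\gamma=(-1)^{[\gamma]}q^{-(\gamma,\gamma)}$, $\exp_p(x)=\sum_k x^k/[k]_p!$ and $[k]_p=(1-p^k)/(1-p)$. Let $\mathcal E(v_a\otimes v_b)=q^{(\epsilon_a,\epsilon_b)}v_a\otimes v_b$, let $P(v\otimes w)=(-1)^{[v][w]}w\otimes v$, and put $\check{\mathcal R}=P\,\mathcal E\,\widetilde R$. For $1\le i\le t-1$ let $\check R_i$ be $\check{\mathcal R}$ acting on the $i$-th and $(i+1)$-st factors of $V^{\otimes t}$, and let $\mathcal C_t$ be the algebra of operators on $V^{\otimes t}$ generated by the $\check R_i^{\pm1}$. Let $\mathrm{str}_q(f)=\mathrm{str}(K_{2\rho}f)$ on $\mathrm{End}(V^{\otimes t})$ ($K_{2\rho}$ acting diagonally as $K_{2\rho}^{\otimes t}$), and $sdim_q V=\mathrm{str}_q(\mathrm{id}_V)$. **The algebra $BW_t(r,q)$.** It is generated over $\mathbb C$ by invertible $g_1,\dots,g_{t-1}$, subject to $g_ig_j=g_jg_i$ ($|i-j|>1$), $g_ig_{i+1}g_i=g_{i+1}g_ig_{i+1}$, $e_ig_i=r^{-1}e_i$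 and $e_ig_{i-1}^{\pm1}e_i=r^{\pm1}e_i$, where $(q-q^{-1})(1-e_i)=g_i-g_i^{-1}$ (for $t\le 1$ there are no generators and $BW_t(r,q)=\mathbb C$). Put $x=1+(r-r^{-1})/(q-q^{-1})$. A *Markov trace* on the tower $BW_0(r,q)\to BW_1(r,q)\to BW_2(r,q)\to\cdots$ (with canonical maps $g_i\mapsto g_i$) is a family of linear functionals $\mathrm{tr}$ on the $BW_t(r,q)$, compatible with these maps, with $\mathrm{tr}(1)=1$, $\mathrm{tr}(ab)=\mathrm{tr}(ba)$, $\mathrm{tr}(g_i)=r/x$, $\mathrm{tr}(e_i)=1/x$ and $$\mathrm{tr}(a\chi b)=\mathrm{tr}(\chi)\,\mathrm{tr}(ab)\qquad (a,b\in BW_{t-1}(r,q),\ \chi\in\{g_{t-1},e_{t-1}\},\ t\ge 2).$$ **Claim.** $sdim_qV\ne0$. There is exactly one Markov trace $\mathrm{tr}$ on the tower $BW_t(-q^{2n},q)$ (Wenzl's Markov trace), and for every $t\ge 0$ there is an algebra homomorphism $\Upsilon:BW_t(-q^{2n},q)\to\mathcal C_t$ with $\Upsilon(g_i)=-\check R_i$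 for all $i$. With $\psi(X)=\mathrm{str}_q(X)/(sdim_qV)^t$ for $X\in\mathcal C_t$, it satisfies $$\psi(\Upsilon(a))=\mathrm{tr}(a)\qquad\text{for all }a\in BW_t(-q^{2n},q),$$ and $\Upsilon(J_t)=\mathcal J_t$, where $J_t=\{b\in BW_t(-q^{2n},q): \mathrm{tr}(ab)=0\ \forall a\in BW_t(-q^{2n},q)\}$ and $\mathcal J_t=\{b\in\mathcal C_t:\mathrm{str}_q(ab)=0\ \forall a\in\mathcal C_t\}$. -/

import Mathlib

open Finset

namespace OspBMW

noncomputable section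

/-! ### The root system of `osp(1|2n)`

Elements of the weight lattice `⨁ ℤ ε_i` are written in coordinates as functions `Fin n → ℤ`; the
bilinear form with `(ε_i, ε_j) = δ_{ij}` is then `dotProduct`. -/

/-- `eps n k = ε_k` for `1 ≤ k ≤ n`, with `ε_{-k} = -ε_k` and `ε_0 = 0`. -/
def eps (n : ℕ) (k : ℤ) : Fin n → ℤ := fun j =>
  if k = (j : ℤ) + 1 then 1 else if k = -((j : ℤ) + 1) then -1 else 0

/-- The simple roots: `α_i = ε_i - ε_{i+1}` for `i < n` and `α_n = ε_n`
(the index `i : Fin n` stands for `i + 1`). -/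
def simpleRoot (n : ℕ) (i : Fin n) : Fin n → ℤ :=
  if (i : ℕ) + 1 < n then eps n ((i : ℤ) + 1) - eps n ((i : ℤ) + 2) else eps n n

/-- `2ρ = ∑_i (2n - 2i + 1) ε_i`, the graded sum of the positive roots. -/
def twoRho (n : ℕ) : Fin n → ℤ := fun i => 2 * (n : ℤ) - 2 * ((i : ℤ) + 1) + 1

/-- The reduced system of positive roots `{ε_i ± ε_j, ε_k : i < j}`. -/
def reducedRoots (n : ℕ) : Set (Fin n → ℤ) :=
  {γ | (∃ i j : ℤ, 1 ≤ i ∧ i < j ∧ j ≤ n ∧ (γ = eps n i - eps n j ∨ γ = eps n i + eps n j)) ∨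
    ∃ k : ℤ, 1 ≤ k ∧ k ≤ n ∧ γ = eps n k}

open Classical in
/-- The parity `[γ]` of a reduced positive root: the roots `ε_k` are odd, the others even. -/
def rootParity (n : ℕ) (γ : Fin n → ℤ) : ℕ :=
  if ∃ k : ℤ, 1 ≤ k ∧ k ≤ n ∧ γ = eps n k then 1 else 0

/-- `α ≺ β` in the total order given by a list. -/
def Precedes {n : ℕ} (L : List (Fin n → ℤ)) (α β : Fin n → ℤ) : Prop :=
  L.idxOf α < L.idxOf β

/-- `L` enumerates the reduced positive roots, without repetition, in a normal (convex) order: if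
`α ≺ β` and `α + β` is a root, then `α ≺ α + β ≺ β`. -/
structure IsNormalOrdering (n : ℕ) (L : List (Fin n → ℤ)) : Prop where
  nodup : L.Nodup
  mem_iff : ∀ γ, γ ∈ L ↔ γ ∈ reducedRoots n
  convex : ∀ α ∈ reducedRoots n, ∀ β ∈ reducedRoots n, α + β ∈ reducedRoots n →
    Precedes L α β → Precedes L α (α + β) ∧ Precedes L (α + β) β

/-- `(α, β)` is a minimal pair for `γ = α + β`: `α ≺ β`, and no other pair of roots with sum `γ`
lies strictly between `α` and `β`. -/
structure IsMinimalPair {n : ℕ} (L : List (Fin n → ℤ)) (α β γ : Fin n → ℤ) : Prop where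
  left_mem : α ∈ reducedRoots n
  right_mem : β ∈ reducedRoots n
  add_eq : α + β = γ
  precedes : Precedes L α β
  minimal : ¬ ∃ α' ∈ reducedRoots n, ∃ β' ∈ reducedRoots n, α' + β' = γ ∧
    (Precedes L α α' ∧ Precedes L α' β) ∧ (Precedes L α β' ∧ Precedes L β' β)

/-! ### The fundamental module `V`

`V` has basis `v_k`, `-n ≤ k ≤ n`. An endomorphism is written as its matrix in this basis:
the entry `(a, b)` is the coefficient of `v_a` in the image of `v_b`. -/

/-- The labels `-n, …, n` of the basis of `V`. -/
abbrev VIdx (n : ℕ) : Type := {k : ℤ // k ∈ Finset.Icc (-(n : ℤ)) n}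

/-- Endomorphisms of `V`. -/
abbrev EndV (n : ℕ) : Type := Matrix (VIdx n) (VIdx n) ℂ

/-- Endomorphisms of `V ⊗ V`, in the basis `v_a ⊗ v_b`. -/
abbrev EndVV (n : ℕ) : Type := Matrix (VIdx n × VIdx n) (VIdx n × VIdx n) ℂ

/-- Endomorphisms of `V^{⊗t}`, in the basis `v_{a_1} ⊗ ⋯ ⊗ v_{a_t}`. -/
abbrev EndVt (n t : ℕ) : Type := Matrix (Fin t → VIdx n) (Fin t → VIdx n) ℂ

/-- The parity `[v_k]`: the vector `v_0` is even, all others are odd. -/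
def parity {n : ℕ} (k : VIdx n) : ℕ := if (k : ℤ) = 0 then 0 else 1

/-- The matrix unit sending `v_l` to `v_k` and the other basis vectors to `0`. -/
def unitV (n : ℕ) (k l : ℤ) : EndV n := fun a b =>
  if (a : ℤ) = k ∧ (b : ℤ) = l then 1 else 0

/-- The action of `e_i` on `V`: `e_i v_{i+1} = v_i` and `e_i v_{-i} = v_{-i-1}` for `i < n`;
`e_n v_0 = v_n` and `e_n v_{-n} = -v_0`. -/
def eV (n : ℕ) (i : Fin n) : EndV n :=
  if (i : ℕ) + 1 < n then
    unitV n ((i : ℤ) + 1) ((i : ℤ) + 2) + unitV n (-((i : ℤ) + 2)) (-((i : ℤ) + 1))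
  else unitV n n 0 - unitV n 0 (-(n : ℤ))

/-- The action of `f_i` on `V`: `f_i v_i = v_{i+1}` and `f_i v_{-i-1} = v_{-i}` for `i < n`;
`f_n v_n = v_0` and `f_n v_0 = v_{-n}`. -/
def fV (n : ℕ) (i : Fin n) : EndV n :=
  if (i : ℕ) + 1 < n then
    unitV n ((i : ℤ) + 2) ((i : ℤ) + 1) + unitV n (-((i : ℤ) + 1)) (-((i : ℤ) + 2))
  else unitV n 0 n + unitV n (-(n : ℤ)) 0

/-- The action of `K_β` on `V`, for `β` in the root lattice: `K_β v_k = q^{(β, ε_k)} v_k`. -/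
def kV (n : ℕ) (q : ℂ) (β : Fin n → ℤ) : EndV n :=
  Matrix.diagonal fun k => q ^ (β ⬝ᵥ eps n k)

/-- The graded `q`-bracket
`[X_α, X_β]_q = X_α X_β - (-1)^{[X_α][X_β]} q^{(α, β)} X_β X_α` on `V`. -/
def qBracket (n : ℕ) (q : ℂ) (α β : Fin n → ℤ) (X Y : EndV n) : EndV n :=
  X * Y - ((-1 : ℂ) ^ (rootParity n α * rootParity n β) * q ^ (α ⬝ᵥ β)) • (Y * X)

/-- `E γ` and `F γ` are (the actions on `V` of) root vectors `E_γ`, `F_γ` constructed along the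
normal ordering `L`: they are `e_i`, `f_i` for a simple root `α_i`, and for each other root `γ`
one has `E_γ = [E_α, E_β]_q`, `F_γ = [F_β, F_α]_{q⁻¹}` for some minimal pair `(α, β)` of `γ`. -/
structure IsRootVectors (n : ℕ) (q : ℂ) (L : List (Fin n → ℤ))
    (E F : (Fin n → ℤ) → EndV n) : Prop where
  simple : ∀ i : Fin n, E (simpleRoot n i) = eV n i ∧ F (simpleRoot n i) = fV n i
  step : ∀ γ ∈ reducedRoots n, (∀ i : Fin n, γ ≠ simpleRoot n i) →
    ∃ α β, IsMinimalPair L α β γ ∧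
      E γ = qBracket n q α β (E α) (E β) ∧ F γ = qBracket n q⁻¹ β α (F β) (F α)

/-- The scalar `a_γ` determined by
`E_γ F_γ - (-1)^{[γ]} F_γ E_γ = a_γ (K_γ - K_γ⁻¹) / (q - q⁻¹)`. -/
def rootConst (n : ℕ) (q : ℂ) (E F : (Fin n → ℤ) → EndV n) (γ : Fin n → ℤ) : ℂ :=
  Classical.epsilon fun a : ℂ =>
    E γ * F γ - (-1 : ℂ) ^ rootParity n γ • (F γ * E γ)
      = (a / (q - q⁻¹)) • (kV n q γ - kV n q (-γ))

/-! ### The `R`-matrix -/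

/-- The graded tensor product `A ⊗ B` of operators on `V`, with `B` homogeneous of parity `p`:
`(A ⊗ B)(v ⊗ w) = (-1)^{p [v]} A v ⊗ B w`. -/
def gradedTensor {n : ℕ} (p : ℕ) (A B : EndV n) : EndVV n := fun x y =>
  (-1 : ℂ) ^ (p * parity y.1) * A x.1 y.1 * B x.2 y.2

/-- `[k]_q = (1 - q^k) / (1 - q)`. -/
def qNum (q : ℂ) (k : ℕ) : ℂ := (1 - q ^ k) / (1 - q)

/-- `[k]_q! = [k]_q ⋯ [1]_q`. -/
def qFact (q : ℂ) (k : ℕ) : ℂ := ∏ j ∈ Finset.range k, qNum q (j + 1)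

/-- `exp_q(X) = ∑_k X^k / [k]_q!`; the sum is finite for the nilpotent operators used here. -/
def qExp {n : ℕ} (q : ℂ) (X : EndVV n) : EndVV n := ∑ᶠ k : ℕ, (qFact q k)⁻¹ • X ^ k

/-- The action on `V ⊗ V` of
`R̃_γ = exp_{q_γ}((-1)^{[γ]} a_γ⁻¹ (q - q⁻¹) E_γ ⊗ F_γ)`, with `q_γ = (-1)^{[γ]} q^{-(γ, γ)}`. -/
def rTildeRoot (n : ℕ) (q : ℂ) (E F : (Fin n → ℤ) → EndV n) (γ : Fin n → ℤ) : EndVV n :=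
  qExp ((-1 : ℂ) ^ rootParity n γ * q ^ (-(γ ⬝ᵥ γ)))
    (((-1 : ℂ) ^ rootParity n γ * (rootConst n q E F γ)⁻¹ * (q - q⁻¹)) •
      gradedTensor (rootParity n γ) (E γ) (F γ))

/-- `R̃ = R̃_{γ_1} R̃_{γ_2} ⋯`, the product in the normal order `γ_1 ≺ γ_2 ≺ ⋯`. -/
def rTilde (n : ℕ) (q : ℂ) (L : List (Fin n → ℤ)) (E F : (Fin n → ℤ) → EndV n) : EndVV n :=
  (L.map (rTildeRoot n q E F)).prod

/-- The Cartan part of the `R`-matrix: `v_a ⊗ v_b ↦ q^{(ε_a, ε_b)} v_a ⊗ v_b`. -/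
def cartanPart (n : ℕ) (q : ℂ) : EndVV n :=
  Matrix.diagonal fun x => q ^ (eps n x.1 ⬝ᵥ eps n x.2)

/-- The graded permutation `v_a ⊗ v_b ↦ (-1)^{[v_a][v_b]} v_b ⊗ v_a`. -/
def gradedPerm (n : ℕ) : EndVV n := fun x y =>
  if x = (y.2, y.1) then (-1 : ℂ) ^ (parity y.1 * parity y.2) else 0

/-- The permuted `R`-matrix `Ř_{V,V} = P ∘ R_V` on `V ⊗ V`. -/
def rCheck (n : ℕ) (q : ℂ) (L : List (Fin n → ℤ)) (E F : (Fin n → ℤ) → EndV n) : EndVV n :=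
  gradedPerm n * (cartanPart n q * rTilde n q L E F)

/-- An even operator on `V ⊗ V` acting on the tensor factors `i` and `i + 1` (counted from `0`)
of `V^{⊗t}`: `id^{⊗ i} ⊗ M ⊗ id^{⊗ (t - i - 2)}`. -/
def onFactors {n : ℕ} (M : EndVV n) (t i : ℕ) (h : i + 1 < t) : EndVt n t := fun a b =>
  if ∀ j : Fin t, (j : ℕ) ≠ i → (j : ℕ) ≠ i + 1 → a j = b j then
    M (a ⟨i, by omega⟩, a ⟨i + 1, h⟩) (b ⟨i, by omega⟩, b ⟨i + 1, h⟩)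
  else 0

/-- `Ř_{i+1}` on `V^{⊗t}`. -/
def rCheckAt (n : ℕ) (q : ℂ) (L : List (Fin n → ℤ)) (E F : (Fin n → ℤ) → EndV n)
    (t i : ℕ) (h : i + 1 < t) : EndVt n t :=
  onFactors (rCheck n q L E F) t i h

/-- The algebra `C_t` generated by the operators `Ř_i` and their inverses. -/
def algC (n : ℕ) (q : ℂ) (L : List (Fin n → ℤ)) (E F : (Fin n → ℤ) → EndV n) (t : ℕ) :
    Subalgebra ℂ (EndVt n t) :=
  Algebra.adjoin ℂ {X | ∃ (i : ℕ) (h : i + 1 < t),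
    X = rCheckAt n q L E F t i h ∨
      (X * rCheckAt n q L E F t i h = 1 ∧ rCheckAt n q L E F t i h * X = 1)}

/-! ### The quantum supertrace -/

/-- The supertrace on `End (V^{⊗t})`. -/
def supertrace (n t : ℕ) : EndVt n t →ₗ[ℂ] ℂ :=
  (Matrix.traceLinearMap (Fin t → VIdx n) ℂ ℂ) ∘ₗ
    LinearMap.mulLeft ℂ (Matrix.diagonal fun a => (-1 : ℂ) ^ (∑ j, parity (a j)))

/-- The action of the group-like element `K_β` on `V^{⊗t}`. -/
def kVt (n : ℕ) (q : ℂ) (t : ℕ) (β : Fin n → ℤ) : EndVt n t :=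
  Matrix.diagonal fun a => ∏ j, kV n q β (a j) (a j)

/-- The quantum supertrace `str_q(f) = str(K_{2ρ} f)` on `End (V^{⊗t})`. -/
def qSupertrace (n : ℕ) (q : ℂ) (t : ℕ) : EndVt n t →ₗ[ℂ] ℂ :=
  supertrace n t ∘ₗ LinearMap.mulLeft ℂ (kVt n q t (twoRho n))

/-- The quantum superdimension `sdim_q V = str_q(id_V)`. -/
def qSdim (n : ℕ) (q : ℂ) : ℂ := qSupertrace n q 1 1

/-- The quantum supertrace restricted to `C_t`. -/
def strC (n : ℕ) (q : ℂ) (L : List (Fin n → ℤ)) (E F : (Fin n → ℤ) → EndV n) (t : ℕ) :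
    algC n q L E F t →ₗ[ℂ] ℂ :=
  qSupertrace n q t ∘ₗ (algC n q L E F t).val.toLinearMap

/-- `ψ(X) = str_q(X) / (sdim_q V)^t` on `C_t`. -/
def psi (n : ℕ) (q : ℂ) (L : List (Fin n → ℤ)) (E F : (Fin n → ℤ) → EndV n) (t : ℕ)
    (X : algC n q L E F t) : ℂ :=
  strC n q L E F t X / qSdim n q ^ t

/-- The annihilator ideal `{b | f (a b) = 0 for all a}` of a linear functional `f` on an algebra
(for a general functional, a left ideal). -/
def annihilatorIdeal {A : Type*} [Ring A] [Algebra ℂ A] (f : A →ₗ[ℂ] ℂ) : Ideal A where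
  carrier := {b | ∀ a, f (a * b) = 0}
  zero_mem' := by intro a; simp
  add_mem' := by
    intro x y hx hy a
    rw [mul_add, map_add, hx a, hy a, add_zero]
  smul_mem' := by
    intro c x hx a
    rw [smul_eq_mul, ← mul_assoc]
    exact hx (a * c)

/-! ### The Birman-Wenzl-Murakami algebra -/

/-- Generators `g_{i+1}` and `g_{i+1}⁻¹`, for `0 ≤ i < t - 1`. -/
inductive BWGen (t : ℕ) : Type
  | g (i : ℕ) (h : i + 1 < t) : BWGen t
  | ginv (i : ℕ) (h : i + 1 < t) : BWGen t

/-- The generator `g_{i+1}` in the free algebra. -/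
def freeG (t i : ℕ) (h : i + 1 < t) : FreeAlgebra ℂ (BWGen t) := FreeAlgebra.ι ℂ (BWGen.g i h)

/-- The generator `g_{i+1}⁻¹` in the free algebra. -/
def freeGinv (t i : ℕ) (h : i + 1 < t) : FreeAlgebra ℂ (BWGen t) :=
  FreeAlgebra.ι ℂ (BWGen.ginv i h)

/-- The element `e_{i+1}`, defined by `(q - q⁻¹)(1 - e_i) = g_i - g_i⁻¹`. -/
def freeE (q : ℂ) (t i : ℕ) (h : i + 1 < t) : FreeAlgebra ℂ (BWGen t) :=
  1 - (q - q⁻¹)⁻¹ • (freeG t i h - freeGinv t i h)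

/-- The defining relations of `BW_t(r, q)`. -/
inductive BWRel (t : ℕ) (r q : ℂ) : FreeAlgebra ℂ (BWGen t) → FreeAlgebra ℂ (BWGen t) → Prop
  | mul_inv (i : ℕ) (h : i + 1 < t) : BWRel t r q (freeG t i h * freeGinv t i h) 1
  | inv_mul (i : ℕ) (h : i + 1 < t) : BWRel t r q (freeGinv t i h * freeG t i h) 1
  | comm (i j : ℕ) (hi : i + 1 < t) (hj : j + 1 < t) (hij : i + 1 < j ∨ j + 1 < i) :
      BWRel t r q (freeG t i hi * freeG t j hj) (freeG t j hj * freeG t i hi)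
  | braid (i : ℕ) (hi : i + 1 < t) (hi' : i + 1 + 1 < t) :
      BWRel t r q (freeG t i hi * freeG t (i + 1) hi' * freeG t i hi)
        (freeG t (i + 1) hi' * freeG t i hi * freeG t (i + 1) hi')
  | e_mul_g (i : ℕ) (h : i + 1 < t) :
      BWRel t r q (freeE q t i h * freeG t i h) (r⁻¹ • freeE q t i h)
  | e_g_e (i : ℕ) (hi : i + 1 < t) (hi' : i + 1 + 1 < t) :
      BWRel t r q (freeE q t (i + 1) hi' * freeG t i hi * freeE q t (i + 1) hi')
        (r • freeE q t (i + 1) hi')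
  | e_ginv_e (i : ℕ) (hi : i + 1 < t) (hi' : i + 1 + 1 < t) :
      BWRel t r q (freeE q t (i + 1) hi' * freeGinv t i hi * freeE q t (i + 1) hi')
        (r⁻¹ • freeE q t (i + 1) hi')

/-- The Birman-Wenzl-Murakami algebra `BW_t(r, q)` over `ℂ`. -/
abbrev BW (t : ℕ) (r q : ℂ) : Type := RingQuot (BWRel t r q)

/-- The generator `g_{i+1}` of `BW_t(r, q)`. -/
def bwG (t : ℕ) (r q : ℂ) (i : ℕ) (h : i + 1 < t) : BW t r q :=
  RingQuot.mkAlgHom ℂ (BWRel t r q) (freeG t i h)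

/-- The element `e_{i+1}` of `BW_t(r, q)`. -/
def bwE (t : ℕ) (r q : ℂ) (i : ℕ) (h : i + 1 < t) : BW t r q :=
  RingQuot.mkAlgHom ℂ (BWRel t r q) (freeE q t i h)

/-- `g_i ↦ g_i` on free algebras. -/
def freeIncl (t : ℕ) : FreeAlgebra ℂ (BWGen t) →ₐ[ℂ] FreeAlgebra ℂ (BWGen (t + 1)) :=
  FreeAlgebra.lift ℂ fun x => match x with
    | BWGen.g i h => freeG (t + 1) i (Nat.lt_succ_of_lt h)
    | BWGen.ginv i h => freeGinv (t + 1) i (Nat.lt_succ_of_lt h)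

theorem freeIncl_g (t i : ℕ) (h : i + 1 < t) :
    freeIncl t (freeG t i h) = freeG (t + 1) i (Nat.lt_succ_of_lt h) := by
  simp [freeIncl, freeG]

theorem freeIncl_ginv (t i : ℕ) (h : i + 1 < t) :
    freeIncl t (freeGinv t i h) = freeGinv (t + 1) i (Nat.lt_succ_of_lt h) := by
  simp [freeIncl, freeGinv]

theorem freeIncl_e (q : ℂ) (t i : ℕ) (h : i + 1 < t) :
    freeIncl t (freeE q t i h) = freeE q (t + 1) i (Nat.lt_succ_of_lt h) := by
  simp [freeE, freeIncl_g, freeIncl_ginv]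

theorem freeIncl_rel (t : ℕ) (r q : ℂ) {x y : FreeAlgebra ℂ (BWGen t)} (h : BWRel t r q x y) :
    BWRel (t + 1) r q (freeIncl t x) (freeIncl t y) := by
  cases h <;>
    simp only [map_mul, map_one, map_smul, freeIncl_g, freeIncl_ginv, freeIncl_e]
  · exact BWRel.mul_inv _ _
  · exact BWRel.inv_mul _ _
  · exact BWRel.comm _ _ _ _ (by assumption)
  · exact BWRel.braid _ _ _
  · exact BWRel.e_mul_g _ _
  · exact BWRel.e_g_e _ _ _
  · exact BWRel.e_ginv_e _ _ _

/-- The canonical map `BW_t(r, q) → BW_{t+1}(r, q)`, `g_i ↦ g_i`. -/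
def bwIncl (t : ℕ) (r q : ℂ) : BW t r q →ₐ[ℂ] BW (t + 1) r q :=
  RingQuot.liftAlgHom ℂ ⟨(RingQuot.mkAlgHom ℂ (BWRel (t + 1) r q)).comp (freeIncl t),
    fun _ _ h => RingQuot.mkAlgHom_rel ℂ (freeIncl_rel t r q h)⟩

/-- `x = 1 + (r - r⁻¹) / (q - q⁻¹)`, for which `e_i² = x e_i`. -/
def bwX (r q : ℂ) : ℂ := 1 + (r - r⁻¹) / (q - q⁻¹)

/-- Wenzl's Markov trace on the tower `BW_0(r, q) → BW_1(r, q) → BW_2(r, q) → ⋯`: normalised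
traces, compatible with the canonical maps, with `tr(g_i) = r / x`, `tr(e_i) = 1 / x`, and
`tr(a χ b) = tr(χ) tr(a b)` for `a, b ∈ BW_{t-1}(r, q)` and `χ ∈ {g_{t-1}, e_{t-1}}`. -/
structure IsMarkovTrace (r q : ℂ) (tr : ∀ t : ℕ, BW t r q →ₗ[ℂ] ℂ) : Prop where
  map_one : ∀ t, tr t 1 = 1
  map_mul_comm : ∀ (t : ℕ) (a b : BW t r q), tr t (a * b) = tr t (b * a)
  map_incl : ∀ (t : ℕ) (a : BW t r q), tr (t + 1) (bwIncl t r q a) = tr t a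
  map_g : ∀ (t i : ℕ) (h : i + 1 < t), tr t (bwG t r q i h) = r / bwX r q
  map_e : ∀ (t i : ℕ) (h : i + 1 < t), tr t (bwE t r q i h) = 1 / bwX r q
  markov : ∀ (t : ℕ) (a b : BW (t + 1) r q),
    ∀ χ ∈ ({bwG (t + 2) r q t (by omega), bwE (t + 2) r q t (by omega)} : Set (BW (t + 2) r q)),
      tr (t + 2) (bwIncl (t + 1) r q a * χ * bwIncl (t + 1) r q b)
        = tr (t + 2) χ * tr (t + 1) (a * b)

end

end OspBMW

open OspBMW

/-!
The theorem is proved by computing `Ř` on `V ⊗ V` in closed form and by verifying the defining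
relations of the Birman-Wenzl-Murakami algebra and the Markov property on the result.

*Closed form of `Ř`.* Every reduced positive root is `ε_a - ε_b` for labels `a`, `b`, and its root vector
`E_γ` has just two matrix coefficients on `V`. Their ratio is determined by the normal ordering alone
(`hasRatio_tau`), so that the factors of `R̃` do not depend on the choice of the root vectors
(`rTildeRoot_eq_block`). The product of the factors from a given position of the ordering to the end has
a closed form, found by descending induction on the position (`tail_prod`); for the whole product the
ordering drops out, and `-Ř` becomes the explicit operator `gMat` (`neg_rCheck_eq_gMat`).

*The representation of `BW_t`.* The operator `gMat`, and the operator `cupCap` of rank one built from the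
invariant vector of `V ⊗ V`, commute with the action of the simple root vectors `e_i`. An operator on
`W ⊗ V` that commutes with these is determined by its values on `W ⊗ v`, with `v` the lowest weight vector
(`eq_zero_of_commute_coprod`), and on such vectors `gMat` is a weighted permutation. This gives the braid
relation `gMat_braid`, the skein relation in the form `gInv_mul_gMat`, and `cupCap_mul_gMat`. The
remaining relations express partial quantum supertraces of `gMat`, its inverse and `cupCap`
(`cupCap_leg12_cupCap`, `ptrace_gMat`, `ptrace_gInv`). The resulting representation `bwRep` has image `C_t`.

*The Markov trace.* Taking the quantum supertrace of `V^{⊗(t+1)}` first over the last factor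
(`qSupertrace_succ`) shows that the normalised quantum supertrace, pulled back to `BW_t`, is a Markov trace
(`isMarkovTrace_markovTrace`). It is the only one, as `BW_{t+2}` is spanned by `BW_{t+1}` and the products
`a χ b` with `a, b ∈ BW_{t+1}` and `χ` the last `g` or `e` (`bwSpan_eq_top`). Finally, since `Υ` is
surjective and carries `ψ` to the Markov trace, it maps annihilator ideal onto annihilator ideal
(`image_annihilatorIdeal`).
-/

namespace OspBMW

/-! ### The labels `-n, …, n` and the weights `ε_k` -/

theorem VIdx.bounds {n : ℕ} (a : VIdx n) : -(n : ℤ) ≤ a ∧ (a : ℤ) ≤ n := Finset.mem_Icc.1 a.2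

/-- The label of the dual basis vector. -/
instance {n : ℕ} : InvolutiveNeg (VIdx n) where
  neg a := ⟨-a, Finset.mem_Icc.2 (by have := a.bounds; omega)⟩
  neg_neg a := Subtype.ext (neg_neg _)

instance {n : ℕ} : Zero (VIdx n) := ⟨⟨0, Finset.mem_Icc.2 (by omega)⟩⟩

@[simp] theorem VIdx.coe_neg {n : ℕ} (a : VIdx n) : ((-a : VIdx n) : ℤ) = -(a : ℤ) := rfl

@[simp] theorem VIdx.coe_zero {n : ℕ} : ((0 : VIdx n) : ℤ) = 0 := rfl

@[simp] theorem VIdx.neg_zero {n : ℕ} : (-(0 : VIdx n)) = 0 := rfl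

theorem VIdx.ext_iff' {n : ℕ} {a b : VIdx n} : a = b ↔ (a : ℤ) = b := Subtype.ext_iff

/-- The height of a label: `1, …, n, 0, -n, …, -1` have heights `n, …, 1, 0, -1, …, -n`.
Raising operators move basis vectors to greater heights. -/
def ht {n : ℕ} (a : VIdx n) : ℤ :=
  if 0 < (a : ℤ) then n + 1 - a else if (a : ℤ) = 0 then 0 else -(n + 1 + a)

@[simp] theorem ht_zero {n : ℕ} : ht (0 : VIdx n) = 0 := by simp [ht]

@[simp] theorem ht_neg {n : ℕ} (a : VIdx n) : ht (-a) = -ht a := by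
  have := a.bounds
  simp only [ht, VIdx.coe_neg]
  split_ifs <;> omega

theorem ht_inj {n : ℕ} {a b : VIdx n} : ht a = ht b ↔ a = b := by
  have := a.bounds
  have := b.bounds
  rw [VIdx.ext_iff']
  simp only [ht]
  split_ifs <;> omega

theorem ht_eq_zero {n : ℕ} {a : VIdx n} : ht a = 0 ↔ a = 0 := by
  rw [← ht_zero (n := n), ht_inj]

theorem ht_pos {n : ℕ} {a : VIdx n} : 0 < ht a ↔ 0 < (a : ℤ) := by
  have := a.bounds
  simp only [ht]
  split_ifs <;> omega

theorem ht_bounds {n : ℕ} (a : VIdx n) : -(n : ℤ) ≤ ht a ∧ ht a ≤ n := by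
  have := a.bounds
  simp only [ht]
  split_ifs <;> omega

theorem eq_neg_iff_ht {n : ℕ} {a b : VIdx n} : a = -b ↔ ht a = -ht b := by
  rw [← ht_neg, ht_inj]

theorem exists_ht_eq {n : ℕ} (h : ℤ) (h1 : -(n : ℤ) ≤ h) (h2 : h ≤ n) :
    ∃ a : VIdx n, ht a = h := by
  rcases lt_trichotomy h 0 with h0 | h0 | h0
  · refine ⟨⟨-(n + 1 + h), Finset.mem_Icc.2 (by omega)⟩, ?_⟩
    simp only [ht]
    split_ifs <;> omega
  · exact ⟨0, by simp [h0]⟩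
  · refine ⟨⟨n + 1 - h, Finset.mem_Icc.2 (by omega)⟩, ?_⟩
    simp only [ht]
    split_ifs <;> omega

theorem eps_neg (n : ℕ) (k : ℤ) : eps n (-k) = -eps n k := by
  funext j
  simp only [eps, Pi.neg_apply]
  split_ifs <;> omega

@[simp] theorem eps_zero (n : ℕ) : eps n 0 = 0 := by
  funext j
  simp only [eps, Pi.zero_apply]
  split_ifs <;> omega

theorem eps_dot {n : ℕ} (v : Fin n → ℤ) (k : ℤ) (j : Fin n) (hk : k = (j : ℤ) + 1) :
    eps n k ⬝ᵥ v = v j := by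
  subst hk
  rw [dotProduct, Finset.sum_eq_single j]
  · simp [eps]
  · intro b _ hb
    have : (b : ℕ) ≠ j := fun h => hb (Fin.ext h)
    simp only [eps]
    split_ifs <;> omega
  · simp

theorem eps_dot_eps {n : ℕ} (a b : VIdx n) :
    eps n a ⬝ᵥ eps n b = if a = 0 then 0 else if a = b then 1 else if a = -b then -1 else 0 := by
  have h1 := a.bounds
  have h2 := b.bounds
  simp only [VIdx.ext_iff', VIdx.coe_zero, VIdx.coe_neg]
  rcases lt_trichotomy (a : ℤ) 0 with h | h | h
  · obtain ⟨j, hj⟩ : ∃ j : Fin n, -(a : ℤ) = (j : ℤ) + 1 :=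
      ⟨⟨(-(a : ℤ) - 1).toNat, by omega⟩, by simp; omega⟩
    have : eps n a = -eps n (-a) := by rw [eps_neg, neg_neg]
    rw [this, neg_dotProduct, eps_dot _ _ j hj]
    simp only [eps]
    split_ifs <;> omega
  · rw [h]
    simp
  · obtain ⟨j, hj⟩ : ∃ j : Fin n, (a : ℤ) = (j : ℤ) + 1 :=
      ⟨⟨((a : ℤ) - 1).toNat, by omega⟩, by simp; omega⟩
    rw [eps_dot _ _ j hj]
    simp only [eps]
    split_ifs <;> omega

theorem eps_inj {n : ℕ} {a b : VIdx n} (h : eps n a = eps n b) : a = b := by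
  have h1 := eps_dot_eps a b
  have h2 := eps_dot_eps a a
  have h3 := eps_dot_eps b b
  rw [h] at h1 h2
  rw [h3] at h1 h2
  by_contra hne
  by_cases ha : a = 0
  · by_cases hb : b = 0
    · exact hne (ha.trans hb.symm)
    · simp [ha, hb] at h2
  · by_cases hb : b = 0
    · simp [ha, hb] at h2
    · simp only [ha, hb, hne, if_true, if_false] at h1
      split_ifs at h1
      omega

/-- The weight difference `ε_a - ε_b`. -/
def wt {n : ℕ} (a b : VIdx n) : Fin n → ℤ := eps n a - eps n b

theorem wt_neg_neg {n : ℕ} (a b : VIdx n) : wt (-b) (-a) = wt a b := by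
  simp only [wt, VIdx.coe_neg, eps_neg]
  abel

theorem wt_add {n : ℕ} (a b c : VIdx n) : wt a b + wt b c = wt a c := by
  simp [wt]

theorem wt_zero_right {n : ℕ} (a : VIdx n) : wt a 0 = eps n a := by
  simp [wt]

/-- A weight difference `ε_a - ε_b` with `b ≠ ±a` determines the pair `(a, b)` up to duality. -/
theorem wt_eq_wt {n : ℕ} {a b c d : VIdx n} (h : wt a b = wt c d) (hab : a ≠ b) (hab' : b ≠ -a) :
    (c = a ∧ d = b) ∨ (c = -b ∧ d = -a) := by
  have key : ∀ k : VIdx n, k ≠ 0 →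
      (eps n a ⬝ᵥ eps n k - eps n b ⬝ᵥ eps n k = 1 → c = k ∨ d = -k) ∧
      (eps n a ⬝ᵥ eps n k - eps n b ⬝ᵥ eps n k = -1 → c = -k ∨ d = k) := by
    intro k hk
    have e1 : eps n a ⬝ᵥ eps n k - eps n b ⬝ᵥ eps n k
        = eps n c ⬝ᵥ eps n k - eps n d ⬝ᵥ eps n k := by
      rw [← sub_dotProduct, ← sub_dotProduct]
      exact congrArg (· ⬝ᵥ eps n k) h
    rw [e1, eps_dot_eps c k, eps_dot_eps d k]
    constructor
    · intro h1
      by_contra! h2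
      rw [if_neg h2.1, if_neg h2.2] at h1
      split_ifs at h1 <;> omega
    · intro h1
      by_contra! h2
      rw [if_neg h2.1, if_neg h2.2] at h1
      split_ifs at h1 <;> omega
  have hca : c = a → (c = a ∧ d = b) ∨ (c = -b ∧ d = -a) := by
    rintro rfl
    exact Or.inl ⟨rfl, (eps_inj (sub_right_injective h)).symm⟩
  have hdb : d = b → (c = a ∧ d = b) ∨ (c = -b ∧ d = -a) := by
    rintro rfl
    exact Or.inl ⟨(eps_inj (sub_left_injective h)).symm, rfl⟩
  have hdual : wt (-b) (-a) = wt c d := (wt_neg_neg a b).trans h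
  have hcb : c = -b → (c = a ∧ d = b) ∨ (c = -b ∧ d = -a) := by
    rintro rfl
    exact Or.inr ⟨rfl, (eps_inj (sub_right_injective hdual)).symm⟩
  have hda : d = -a → (c = a ∧ d = b) ∨ (c = -b ∧ d = -a) := by
    rintro rfl
    exact Or.inr ⟨(eps_inj (sub_left_injective hdual)).symm, rfl⟩
  by_cases ha : a = 0
  · have hb : b ≠ 0 := fun hb => hab (ha.trans hb.symm)
    rcases (key b hb).2 (by simp [eps_dot_eps, ha, hb]) with h1 | h1
    · exact hcb h1
    · exact hdb h1
  · rcases (key a ha).1 (by simp [eps_dot_eps, ha, hab.symm, hab']) with h1 | h1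
    · exact hca h1
    · exact hda h1

/-- The height of a weight. -/
def wtHt {n : ℕ} (v : Fin n → ℤ) : ℤ := ∑ j, v j * ((n : ℤ) - j)

theorem wtHt_eps {n : ℕ} (a : VIdx n) : wtHt (eps n a) = ht a := by
  have h1 := a.bounds
  have key : wtHt (eps n a) = eps n a ⬝ᵥ fun j : Fin n => (n : ℤ) - j := rfl
  rw [key]
  rcases lt_trichotomy (a : ℤ) 0 with h | h | h
  · obtain ⟨j, hj⟩ : ∃ j : Fin n, -(a : ℤ) = (j : ℤ) + 1 :=
      ⟨⟨(-(a : ℤ) - 1).toNat, by omega⟩, by simp; omega⟩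
    have : eps n a = -eps n (-a) := by rw [eps_neg, neg_neg]
    rw [this, neg_dotProduct, eps_dot _ _ j hj]
    simp only [ht]
    split_ifs <;> omega
  · simp [h, ht]
  · obtain ⟨j, hj⟩ : ∃ j : Fin n, (a : ℤ) = (j : ℤ) + 1 :=
      ⟨⟨((a : ℤ) - 1).toNat, by omega⟩, by simp; omega⟩
    rw [eps_dot _ _ j hj]
    simp only [ht]
    split_ifs <;> omega

theorem wtHt_add {n : ℕ} (v w : Fin n → ℤ) : wtHt (v + w) = wtHt v + wtHt w := by
  simp [wtHt, add_mul, Finset.sum_add_distrib]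

theorem wtHt_wt {n : ℕ} (a b : VIdx n) : wtHt (wt a b) = ht a - ht b := by
  have := wtHt_add (wt a b) (eps n b)
  rw [wtHt_eps, wt, sub_add_cancel, wtHt_eps] at this
  rw [wt]; omega

/-- The reduced positive roots are the `ε_a - ε_b` with `a` of greater height than `b`, except the
`2 ε_a`, which occur for `b = -a`. -/
theorem mem_reducedRoots_iff {n : ℕ} {γ : Fin n → ℤ} :
    γ ∈ reducedRoots n ↔ ∃ a b : VIdx n, ht b < ht a ∧ b ≠ -a ∧ γ = wt a b := by
  constructor
  · rintro (⟨i, j, h1, h2, h3, h | h⟩ | ⟨k, h1, h2, h⟩)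
    · refine ⟨⟨i, Finset.mem_Icc.2 (by omega)⟩, ⟨j, Finset.mem_Icc.2 (by omega)⟩, ?_, ?_, h⟩
      · simp only [ht]; split_ifs <;> omega
      · simp only [Ne, VIdx.ext_iff', VIdx.coe_neg]; omega
    · refine ⟨⟨i, Finset.mem_Icc.2 (by omega)⟩, ⟨-j, Finset.mem_Icc.2 (by omega)⟩, ?_, ?_, ?_⟩
      · simp only [ht]; split_ifs <;> omega
      · simp only [Ne, VIdx.ext_iff', VIdx.coe_neg]; omega
      · rw [h]; simp [wt, eps_neg]
    · refine ⟨⟨k, Finset.mem_Icc.2 (by omega)⟩, 0, ?_, ?_, ?_⟩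
      · simp only [ht, VIdx.coe_zero]; split_ifs <;> omega
      · simp only [Ne, VIdx.ext_iff', VIdx.coe_neg, VIdx.coe_zero]; omega
      · rw [h]; simp [wt]
  · rintro ⟨a, b, h, hne, rfl⟩
    have h1 := a.bounds
    have h2 := b.bounds
    simp only [Ne, VIdx.ext_iff', VIdx.coe_neg] at hne
    have hb : eps n b = -eps n (-b) := by rw [eps_neg, neg_neg]
    have ha : eps n a = -eps n (-a) := by rw [eps_neg, neg_neg]
    rcases lt_trichotomy (a : ℤ) 0 with h0 | h0 | h0
    · left
      refine ⟨-b, -a, ?_, ?_, ?_, Or.inl ?_⟩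
      all_goals try (simp only [ht] at h; split_ifs at h <;> omega)
      rw [wt, ha, hb]; abel
    · right
      refine ⟨-b, ?_, ?_, ?_⟩
      all_goals try (simp only [ht] at h; split_ifs at h <;> omega)
      rw [wt, h0, hb]; simp
    · rcases lt_trichotomy (b : ℤ) 0 with h0' | h0' | h0'
      · left
        rcases lt_or_gt_of_ne (show (a : ℤ) ≠ -b by omega) with h3 | h3
        · refine ⟨a, -b, by omega, h3, by omega, Or.inr ?_⟩
          rw [wt, hb]; abel
        · refine ⟨-b, a, by omega, h3, by omega, Or.inr ?_⟩
          rw [wt, hb]; abel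
      · right
        exact ⟨a, by omega, by omega, by rw [wt, h0']; simp⟩
      · left
        refine ⟨a, b, ?_, ?_, ?_, Or.inl rfl⟩
        all_goals (simp only [ht] at h; split_ifs at h <;> omega)

theorem wt_mem {n : ℕ} {a b : VIdx n} (h : ht b < ht a) (hne : b ≠ -a) :
    wt a b ∈ reducedRoots n := mem_reducedRoots_iff.2 ⟨a, b, h, hne, rfl⟩

theorem eps_mem {n : ℕ} {a : VIdx n} (h : 0 < ht a) : eps n a ∈ reducedRoots n := by
  rw [← wt_zero_right]
  refine wt_mem (by simpa using h) ?_
  rw [Ne, eq_neg_iff_ht]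
  simp; omega

theorem rootParity_wt {n : ℕ} {a b : VIdx n} (h : ht b < ht a) (hne : b ≠ -a) :
    rootParity n (wt a b) = if a = 0 ∨ b = 0 then 1 else 0 := by
  have hab : a ≠ b := fun e => by rw [e] at h; omega
  have key : (∃ k : ℤ, 1 ≤ k ∧ k ≤ n ∧ wt a b = eps n k) ↔ a = 0 ∨ b = 0 := ?_
  · simp only [rootParity, key]
  refine ⟨?_, ?_⟩
  · rintro ⟨k, h1, h2, hk⟩
    have := wt_eq_wt (c := ⟨k, Finset.mem_Icc.2 (by omega)⟩) (d := 0)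
      (by rw [hk, wt_zero_right]) hab hne
    rcases this with h3 | h3
    · exact Or.inr h3.2.symm
    · left
      rw [← neg_neg a, ← h3.2]; rfl
  · rintro (h0 | h0)
    · subst h0
      have hb := ht_pos (a := -b)
      have := b.bounds
      simp only [ht_neg, ht_zero, VIdx.coe_neg] at *
      refine ⟨-b, by omega, by omega, ?_⟩
      rw [eps_neg]; simp [wt]
    · subst h0
      have hb := ht_pos (a := a)
      have := a.bounds
      simp only [ht_zero] at *
      exact ⟨a, by omega, by omega, by simp [wt]⟩

/-! ### Positions of pairs of labels in a normal ordering -/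

/-- The position in the order `L` of the root on the ray of `ε_a - ε_b`: this is `ε_a - ε_b`
itself, except that `2 ε_a` is replaced by `ε_a` when `b = -a`. -/
def pos {n : ℕ} (L : List (Fin n → ℤ)) (a b : VIdx n) : ℕ :=
  L.idxOf (if b = -a then eps n a else wt a b)

section Position
variable {n : ℕ} {L : List (Fin n → ℤ)}

theorem pos_of_ne {a b : VIdx n} (h : b ≠ -a) : pos L a b = L.idxOf (wt a b) := by
  simp [pos, h]

theorem pos_neg_right (a : VIdx n) : pos L a (-a) = L.idxOf (eps n a) := by simp [pos]

theorem pos_zero_right (a : VIdx n) : pos L a 0 = L.idxOf (eps n a) := by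
  by_cases h : a = 0
  · subst h
    exact pos_neg_right 0
  · rw [pos_of_ne, wt_zero_right]
    intro h2
    apply h
    rw [← neg_neg a, ← h2, VIdx.neg_zero]

theorem pos_dual (a b : VIdx n) : pos L (-b) (-a) = pos L a b := by
  by_cases h : b = -a
  · subst h
    simp [pos]
  · rw [pos_of_ne h, pos_of_ne, wt_neg_neg]
    rw [neg_neg]
    exact fun h2 => h h2.symm

theorem idxOf_inj_of_mem (hL : IsNormalOrdering n L) {α β : Fin n → ℤ}
    (hα : α ∈ reducedRoots n) (h : L.idxOf α = L.idxOf β) : α = β :=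
  (List.idxOf_inj ((hL.mem_iff α).2 hα)).1 h

/-- Convexity of a normal ordering, in the form that does not refer to which of the two roots
comes first. -/
theorem IsNormalOrdering.between (hL : IsNormalOrdering n L) {α β γ : Fin n → ℤ}
    (hα : α ∈ reducedRoots n) (hβ : β ∈ reducedRoots n) (hγ : γ ∈ reducedRoots n)
    (h : α + β = γ) :
    (L.idxOf α < L.idxOf γ ∧ L.idxOf γ < L.idxOf β) ∨
      (L.idxOf β < L.idxOf γ ∧ L.idxOf γ < L.idxOf α) := by
  subst h
  rcases lt_trichotomy (L.idxOf α) (L.idxOf β) with h1 | h1 | h1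
  · exact Or.inl (hL.convex α hα β hβ hγ h1)
  · exfalso
    have := idxOf_inj_of_mem hL hα h1
    subst this
    obtain ⟨a, b, hab, hne, h2⟩ := mem_reducedRoots_iff.1 hγ
    have hab' : a ≠ b := fun e => by rw [e] at hab; omega
    have h3 : ∀ k : VIdx n, 2 * (α ⬝ᵥ eps n k) = eps n a ⬝ᵥ eps n k - eps n b ⬝ᵥ eps n k := by
      intro k
      rw [← sub_dotProduct]
      change _ = wt a b ⬝ᵥ _
      rw [← h2, add_dotProduct]
      ring
    by_cases ha : a = 0
    · have hb : b ≠ 0 := fun hb => hab' (ha.trans hb.symm)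
      have := h3 b
      simp [eps_dot_eps, ha, hb] at this
      omega
    · have := h3 a
      simp [eps_dot_eps, ha, hab'.symm, hne] at this
      omega
  · have hγ' := hγ
    rw [add_comm] at hγ'
    have := hL.convex β hβ α hα hγ' h1
    rw [add_comm] at this
    exact Or.inr this

/-- The four roots of a subsystem of type `B₂` occur in one of its two convex orders. -/
theorem IsNormalOrdering.rank_two (hL : IsNormalOrdering n L) {a b : VIdx n}
    (hb : 0 < ht b) (hab : ht b < ht a) :
    (pos L a b < pos L a 0 ∧ pos L a 0 < pos L a (-b) ∧ pos L a (-b) < pos L b 0) ∨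
      (pos L b 0 < pos L a (-b) ∧ pos L a (-b) < pos L a 0 ∧ pos L a 0 < pos L a b) := by
  have h1 : b ≠ -a := by rw [Ne, eq_neg_iff_ht]; omega
  have h2 : -b ≠ -a := by rw [Ne, eq_neg_iff_ht, ht_neg, neg_inj]; omega
  have m1 : wt a b ∈ reducedRoots n := wt_mem hab h1
  have m2 : wt a (-b) ∈ reducedRoots n := wt_mem (by rw [ht_neg]; omega) h2
  have m3 : eps n a ∈ reducedRoots n := eps_mem (by omega)
  have m4 : eps n b ∈ reducedRoots n := eps_mem hb
  rw [pos_of_ne h1, pos_of_ne h2, pos_zero_right, pos_zero_right]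
  have r1 := hL.between m1 m4 m3 (by simp [wt])
  have r2 := hL.between m3 m4 m2 (by simp [wt, eps_neg])
  omega

/-- Convexity of a normal ordering in terms of labels. The only triples of labels in which the
middle position need not be strictly between the others are `(a, 0, -a)`. -/
theorem IsNormalOrdering.conv (hL : IsNormalOrdering n L) {a b c : VIdx n}
    (hab : ht b < ht a) (hbc : ht c < ht b) (h : b = 0 → c ≠ -a) :
    (pos L a b < pos L a c ∧ pos L a c < pos L b c) ∨
      (pos L b c < pos L a c ∧ pos L a c < pos L a b) := by
  by_cases hca : c = -a
  · subst hca
    have hb0 : b ≠ 0 := fun hb => h hb rfl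
    rw [pos_neg_right, ← pos_zero_right]
    have hd : pos L b (-a) = pos L a (-b) := by
      rw [← pos_dual, neg_neg]
    rw [hd]
    rw [ht_neg] at hbc
    rcases lt_or_gt_of_ne (fun h0 => hb0 (ht_eq_zero.1 h0)) with hb | hb
    · have := hL.rank_two (a := a) (b := -b) (by rw [ht_neg]; omega) (by rw [ht_neg]; omega)
      rw [neg_neg] at this
      omega
    · have := hL.rank_two hb hab
      omega
  by_cases hba : b = -a
  · subst hba
    rw [pos_neg_right, ← pos_zero_right]
    have := hL.rank_two (a := -c) (b := a) (by rw [ht_neg] at hab; omega)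
      (by rw [ht_neg] at *; omega)
    rw [pos_dual] at this
    have h2 : pos L (-c) a = pos L (-a) c := by rw [← pos_dual, neg_neg]
    rw [h2] at this
    omega
  by_cases hcb : c = -b
  · subst hcb
    have := hL.rank_two (a := a) (b := b) (by rw [ht_neg] at hbc; omega) hab
    rw [pos_neg_right b, ← pos_zero_right]
    omega
  · rw [pos_of_ne hca, pos_of_ne hba, pos_of_ne hcb]
    exact hL.between (wt_mem hab hba) (wt_mem hbc hcb) (wt_mem (hbc.trans hab) hca) (wt_add a b c)

/-- A position of a root determines the pair of labels up to duality. -/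
theorem pos_eq_pos (hL : IsNormalOrdering n L) {a b c d : VIdx n}
    (hab : ht b < ht a) (hab' : b ≠ -a) (hcd' : d ≠ -c) (h : pos L a b = pos L c d) :
    (c = a ∧ d = b) ∨ (c = -b ∧ d = -a) := by
  rw [pos_of_ne hab', pos_of_ne hcd'] at h
  refine wt_eq_wt (idxOf_inj_of_mem hL (wt_mem hab hab') h) ?_ hab'
  rintro rfl
  omega

end Position

/-- A function on pairs of labels that satisfies the convexity conditions of the positions in a
normal ordering. The notion is invariant under `P ↦ -P`. -/
structure IsConvexPos {n : ℕ} (P : VIdx n → VIdx n → ℤ) : Prop where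
  conv : ∀ a b c : VIdx n, ht b < ht a → ht c < ht b → (ht b = 0 → ht c ≠ -ht a) →
    (P a b < P a c ∧ P a c < P b c) ∨ (P b c < P a c ∧ P a c < P a b)
  dual : ∀ a b : VIdx n, P (-b) (-a) = P a b
  tie : ∀ a : VIdx n, P a (-a) = P a 0

theorem IsConvexPos.neg {n : ℕ} {P : VIdx n → VIdx n → ℤ} (h : IsConvexPos P) :
    IsConvexPos fun a b => -P a b where
  conv a b c h1 h2 h3 := by have := h.conv a b c h1 h2 h3; omega
  dual a b := by rw [h.dual]
  tie a := by rw [h.tie]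

theorem isConvexPos_pos {n : ℕ} {L : List (Fin n → ℤ)} (hL : IsNormalOrdering n L) :
    IsConvexPos fun a b : VIdx n => (pos L a b : ℤ) where
  conv a b c h1 h2 h3 := by
    have := hL.conv h1 h2 (fun hb hc => h3 (ht_eq_zero.2 hb) (by rw [hc, ht_neg]))
    omega
  dual a b := by rw [pos_dual]
  tie a := by rw [pos_neg_right, pos_zero_right]

section Minimal
variable {n : ℕ} {P : VIdx n → VIdx n → ℤ}

/-- If `ε_a - ε_k ≺ ε_k - ε_j` form a minimal pair and `l` lies between `a` and `k`, then `ε_a - ε_l`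
precedes `ε_a - ε_k` if and only if it precedes `ε_a - ε_j`: otherwise it would be part of a
decomposition of `ε_a - ε_j` inside the pair. For `l = -a` and `l = -j` the root `ε_a` or `ε_j`
takes the place of the missing root `2 ε_a` or `2 ε_j`. -/
theorem IsConvexPos.left_iff (hP : IsConvexPos P) {a k j l : VIdx n} (hak : ht k < ht a)
    (hkj : ht j < ht k) (hja : ht j ≠ -ht a) (hka : ht k ≠ -ht a) (hjk : ht j ≠ -ht k)
    (hlt : P a k < P k j)
    (hN : ∀ l, ht l < ht a → ht j < ht l → ht l ≠ -ht a → ht l ≠ -ht j →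
      ¬ (P a k < P a l ∧ P a l < P k j ∧ P a k < P l j ∧ P l j < P k j))
    (hl1 : ht l < ht a) (hl2 : ht k < ht l) (hl0 : ht l ≠ 0) :
    P a l < P a k ↔ P a l < P a j := by
  have c0 := hP.conv a k j hak hkj (by omega)
  have h0 : ht (0 : VIdx n) = 0 := ht_zero
  by_cases h1 : ht l = -ht a
  · obtain rfl : l = -a := eq_neg_iff_ht.2 h1
    rw [hP.tie]
    have c1 := hP.conv a 0 j (by omega) (by omega) (by omega)
    have c2 := hP.conv a 0 k (by omega) (by omega) (by omega)
    have c3 := hP.conv 0 k j (by omega) (by omega) (by omega)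
    have := hN 0 (by omega) (by omega) (by omega) (by omega)
    omega
  by_cases h2 : ht l = -ht j
  · obtain rfl : l = -j := eq_neg_iff_ht.2 h2
    have t1 := hP.tie (-j)
    have t2 := hP.dual 0 j
    rw [neg_neg] at t1
    rw [VIdx.neg_zero] at t2
    rw [ht_neg] at *
    have c1 := hP.conv a (-j) j (by simp; omega) (by simp; omega) (by simp; omega)
    have c2 := hP.conv a (-j) 0 (by simp; omega) (by simp; omega) (by simp; omega)
    have c3 := hP.conv a 0 j (by omega) (by omega) (by omega)
    have c4 := hP.conv a (-j) k (by simp; omega) (by simp; omega) (by simp; omega)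
    have := hN 0 (by omega) (by omega) (by omega) (by omega)
    rcases lt_trichotomy (ht k) 0 with hk | hk | hk
    · have c5 := hP.conv a 0 k (by omega) (by omega) (by omega)
      have c6 := hP.conv 0 k j (by omega) (by omega) (by omega)
      omega
    · obtain rfl : k = 0 := ht_eq_zero.1 hk
      omega
    · have c5 := hP.conv (-j) k j (by simp; omega) (by omega) (by simp; omega)
      omega
  · have c1 := hP.conv a l j (by omega) (by omega) (by omega)
    have c2 := hP.conv a l k (by omega) (by omega) (by omega)
    have c3 := hP.conv l k j (by omega) (by omega) (by omega)
    have := hN l hl1 (by omega) h1 h2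
    omega

/-- The counterpart of `IsConvexPos.left_iff` for `l` between `k` and `j`: the root `ε_k - ε_l`
precedes `ε_k - ε_j` if and only if `ε_a - ε_l` precedes `ε_a - ε_j`. -/
theorem IsConvexPos.right_iff (hP : IsConvexPos P) {a k j l : VIdx n} (hak : ht k < ht a)
    (hkj : ht j < ht k) (hja : ht j ≠ -ht a) (hka : ht k ≠ -ht a) (hjk : ht j ≠ -ht k)
    (hlt : P a k < P k j)
    (hN : ∀ l, ht l < ht a → ht j < ht l → ht l ≠ -ht a → ht l ≠ -ht j →
      ¬ (P a k < P a l ∧ P a l < P k j ∧ P a k < P l j ∧ P l j < P k j))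
    (hl1 : ht l < ht k) (hl2 : ht j < ht l) (hl0 : ht l ≠ 0) :
    P k l < P k j ↔ P a l < P a j := by
  have c0 := hP.conv a k j hak hkj (by omega)
  have h0 : ht (0 : VIdx n) = 0 := ht_zero
  have c1 := hP.conv k l j (by omega) (by omega) (by omega)
  have c2 := hP.conv a l j (by omega) (by omega) (by omega)
  by_cases h1 : ht l = -ht a
  · obtain rfl : l = -a := eq_neg_iff_ht.2 h1
    have t1 := hP.tie a
    have t2 := hP.dual a 0
    rw [VIdx.neg_zero] at t2
    rw [ht_neg] at *
    have c3 := hP.conv a 0 j (by omega) (by omega) (by omega)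
    have c4 := hP.conv 0 (-a) j (by simp; omega) (by simp; omega) (by simp; omega)
    have := hN 0 (by omega) (by omega) (by omega) (by omega)
    by_cases hk : ht k = 0
    · obtain rfl : k = 0 := ht_eq_zero.1 hk
      omega
    · have c5 := hP.conv a k (-a) (by omega) (by simp; omega) (by omega)
      omega
  by_cases h2 : ht l = -ht j
  · obtain rfl : l = -j := eq_neg_iff_ht.2 h2
    have t1 := hP.tie (-j)
    have t2 := hP.dual 0 j
    rw [neg_neg] at t1
    rw [VIdx.neg_zero] at t2
    rw [ht_neg] at *
    have c3 := hP.conv a (-j) 0 (by simp; omega) (by simp; omega) (by simp; omega)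
    have c4 := hP.conv a 0 j (by omega) (by omega) (by omega)
    have c5 := hP.conv a k (-j) (by omega) (by simp; omega) (by simp; omega)
    have := hN 0 (by omega) (by omega) (by omega) (by omega)
    omega
  · have c3 := hP.conv a k l (by omega) (by omega) (by omega)
    have := hN l (by omega) hl2 h1 h2
    omega

end Minimal

noncomputable section

/-- The sign `-1` for the label `0`, and `1` for the others. -/
def sg {n : ℕ} (a : VIdx n) : ℂ := if a = 0 then -1 else 1

/-- The non-zero labels strictly between `a` and `b`. -/
def mid {n : ℕ} (a b : VIdx n) : Finset (VIdx n) :=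
  Finset.univ.filter fun k => ht k < ht a ∧ ht b < ht k ∧ k ≠ 0

/-- The ratio of the two matrix coefficients of the root vector `E_γ`, `γ = ε_a - ε_b`, on `V`.
Each intermediate non-zero label `k` contributes a factor that depends only on whether `ε_a - ε_k` precedes
`ε_a - ε_b`. -/
def tau {n : ℕ} (L : List (Fin n → ℤ)) (q : ℂ) (a b : VIdx n) : ℂ :=
  sg a * sg b * ∏ k ∈ mid a b, if pos L a k < pos L a b then -q else -q⁻¹

/-- The factor by which `tau` fails to be multiplicative along `a`, `k`, `b`. -/
def tauFactor {n : ℕ} (q : ℂ) (k : VIdx n) : ℂ := if k = 0 then 1 else -q⁻¹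

theorem mem_mid {n : ℕ} {a b k : VIdx n} : k ∈ mid a b ↔ ht k < ht a ∧ ht b < ht k ∧ k ≠ 0 := by
  simp [mid]

theorem sg_mul_self {n : ℕ} (a : VIdx n) : sg a * sg a = 1 := by
  simp only [sg]; split_ifs <;> norm_num

theorem sg_ne_zero {n : ℕ} (a : VIdx n) : sg a ≠ 0 := by
  simp only [sg]; split_ifs <;> norm_num

@[simp] theorem sg_neg {n : ℕ} (a : VIdx n) : sg (-a) = sg a := by
  simp [sg, VIdx.ext_iff']

theorem prod_mid_split {n : ℕ} {a k b : VIdx n} (hak : ht k < ht a) (hkb : ht b < ht k)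
    (f : VIdx n → ℂ) :
    ∏ l ∈ mid a b, f l
      = (∏ l ∈ mid a k, f l) * (if k = 0 then 1 else f k) * ∏ l ∈ mid k b, f l := by
  have h1 : mid a b = (mid a k ∪ (if k = 0 then ∅ else {k})) ∪ mid k b := by
    ext l
    have hl : l = k ↔ ht l = ht k := ht_inj.symm
    by_cases hk : k = 0
    · have hl0 : l = 0 ↔ ht l = ht k := by rw [← hl, hk]
      rw [if_pos hk]
      simp only [mem_mid, mem_union, notMem_empty, Ne, hl0, or_false]
      omega
    · simp only [mem_mid, mem_union, hk, if_false, mem_singleton, Ne, hl, ← ht_eq_zero]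
      rw [← ht_eq_zero] at hk
      omega
  have h2 : Disjoint (mid a k ∪ (if k = 0 then ∅ else {k})) (mid k b) := by
    rw [Finset.disjoint_left]
    intro l hl hl'
    rw [mem_mid] at hl'
    rw [mem_union, mem_mid] at hl
    rcases hl with hl | hl
    · omega
    · split_ifs at hl
      · simp at hl
      · rw [mem_singleton.1 hl] at hl'; omega
  have h3 : Disjoint (mid a k) (if k = 0 then ∅ else {k}) := by
    split_ifs
    · simp
    · rw [Finset.disjoint_singleton_right, mem_mid]; omega
  rw [h1, Finset.prod_union h2, Finset.prod_union h3]
  split_ifs <;> simp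

theorem tau_ne_zero {n : ℕ} (L : List (Fin n → ℤ)) {q : ℂ} (hq : q ≠ 0) (a b : VIdx n) :
    tau L q a b ≠ 0 := by
  refine mul_ne_zero (mul_ne_zero (sg_ne_zero _) (sg_ne_zero _)) (Finset.prod_ne_zero_iff.2 ?_)
  intro k _
  split_ifs <;> simp [hq]

/-- No other decomposition of `ε_a - ε_b` lies strictly between `ε_a - ε_k` and `ε_k - ε_b`,
whichever of these comes first. -/
def IsMinimalLabel {n : ℕ} (L : List (Fin n → ℤ)) (a k b : VIdx n) : Prop :=
  ∀ l, ht l < ht a → ht b < ht l → ht l ≠ -ht a → ht l ≠ -ht b →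
    ¬ (pos L a k < pos L a l ∧ pos L a l < pos L k b ∧
        pos L a k < pos L l b ∧ pos L l b < pos L k b) ∧
    ¬ (pos L k b < pos L a l ∧ pos L a l < pos L a k ∧
        pos L k b < pos L l b ∧ pos L l b < pos L a k)

/-- The recursion that `tau` satisfies along a minimal pair, in agreement with that of the root
vectors. When `ε_k - ε_b` is the first root of the pair, it is obtained from the other case by
reversing the order. -/
theorem tau_step {n : ℕ} {L : List (Fin n → ℤ)} (hL : IsNormalOrdering n L) {q : ℂ} (hq : q ≠ 0)
    {a k b : VIdx n} (hak : ht k < ht a) (hkb : ht b < ht k) (hba : ht b ≠ -ht a)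
    (hka : ht k ≠ -ht a) (hbk : ht b ≠ -ht k) (hN : IsMinimalLabel L a k b) :
    (pos L a k < pos L k b → tau L q a b = tau L q a k * tau L q k b / tauFactor q k) ∧
    (pos L k b < pos L a k → tau L q a b = tau L q a k * tau L q k b * tauFactor q k) := by
  have hP := isConvexPos_pos hL
  have c0 := hL.conv hak hkb (by rintro rfl; rw [Ne, eq_neg_iff_ht]; exact hba)
  have hs : sg a * sg b = (sg a * sg k) * (sg k * sg b) := by
    linear_combination -(sg a * sg b) * sg_mul_self k
  constructor
  · intro hlt
    rw [tau, prod_mid_split hak hkb, hs, tau, tau]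
    have e1 : ∏ l ∈ mid a k, (if pos L a l < pos L a b then -q else -q⁻¹)
        = ∏ l ∈ mid a k, (if pos L a l < pos L a k then -q else -q⁻¹) := by
      refine Finset.prod_congr rfl fun l hl => if_congr ?_ rfl rfl
      rw [mem_mid, Ne, ← ht_eq_zero] at hl
      have := hP.left_iff hak hkb hba hka hbk (by simpa using hlt)
        (fun l h1 h2 h3 h4 => by have := (hN l h1 h2 h3 h4).1; omega) hl.1 hl.2.1 hl.2.2
      omega
    have e2 : ∏ l ∈ mid k b, (if pos L a l < pos L a b then -q else -q⁻¹)
        = ∏ l ∈ mid k b, (if pos L k l < pos L k b then -q else -q⁻¹) := by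
      refine Finset.prod_congr rfl fun l hl => if_congr ?_ rfl rfl
      rw [mem_mid, Ne, ← ht_eq_zero] at hl
      have := hP.right_iff hak hkb hba hka hbk (by simpa using hlt)
        (fun l h1 h2 h3 h4 => by have := (hN l h1 h2 h3 h4).1; omega) hl.1 hl.2.1 hl.2.2
      omega
    rw [e1, e2, if_pos (show pos L a k < pos L a b by omega), tauFactor]
    split_ifs
    · ring
    · field_simp
  · intro hlt
    rw [tau, prod_mid_split hak hkb, hs, tau, tau]
    have e1 : ∏ l ∈ mid a k, (if pos L a l < pos L a b then -q else -q⁻¹)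
        = ∏ l ∈ mid a k, (if pos L a l < pos L a k then -q else -q⁻¹) := by
      refine Finset.prod_congr rfl fun l hl => if_congr ?_ rfl rfl
      rw [mem_mid, Ne, ← ht_eq_zero] at hl
      have := hP.neg.left_iff hak hkb hba hka hbk (by simpa using hlt)
        (fun l h1 h2 h3 h4 => by have := (hN l h1 h2 h3 h4).2; omega) hl.1 hl.2.1 hl.2.2
      have c1 := hP.conv a l k hl.1 hl.2.1 (by omega)
      have c2 := hP.conv a l b hl.1 (by omega) (by omega)
      omega
    have e2 : ∏ l ∈ mid k b, (if pos L a l < pos L a b then -q else -q⁻¹)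
        = ∏ l ∈ mid k b, (if pos L k l < pos L k b then -q else -q⁻¹) := by
      refine Finset.prod_congr rfl fun l hl => if_congr ?_ rfl rfl
      rw [mem_mid, Ne, ← ht_eq_zero] at hl
      have := hP.neg.right_iff hak hkb hba hka hbk (by simpa using hlt)
        (fun l h1 h2 h3 h4 => by have := (hN l h1 h2 h3 h4).2; omega) hl.1 hl.2.1 hl.2.2
      have c1 := hP.conv k l b hl.1 hl.2.1 (by omega)
      have c2 := hP.conv a l b (by omega) hl.2.1 (by omega)
      omega
    rw [e1, e2, if_neg (show ¬ pos L a k < pos L a b by omega), tauFactor]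
    split_ifs
    · ring
    · ring

/-! ### The root vectors on `V` -/

theorem sub_inv_ne_zero_of_sq {q : ℂ} (hq : q ≠ 0) (hq2 : q ^ 2 ≠ 1) : q - q⁻¹ ≠ 0 := by
  intro h
  apply hq2
  field_simp at h
  linear_combination h

theorem unitV_eq_single {n : ℕ} (a b : VIdx n) : unitV n a b = Matrix.single a b 1 := by
  ext x y
  simp only [unitV, Matrix.single, Matrix.of_apply, VIdx.ext_iff']
  refine if_congr ?_ rfl rfl
  constructor <;> rintro ⟨h1, h2⟩ <;> exact ⟨h1.symm, h2.symm⟩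

/-- The root vectors of weight `γ = ±(ε_a - ε_b)` have the expected two matrix coefficients on `V`,
the coefficients of `E_γ` being in the ratio `t`. -/
def HasRatio {n : ℕ} (E F : (Fin n → ℤ) → EndV n) (a b : VIdx n) (t : ℂ) : Prop :=
  ∃ x x' y y' : ℂ, x' ≠ 0 ∧ y ≠ 0 ∧ y' ≠ 0 ∧
    E (wt a b) = Matrix.single a b x + Matrix.single (-b) (-a) x' ∧
    F (wt a b) = Matrix.single b a y + Matrix.single (-a) (-b) y' ∧
    x * y = sg a * sg b * (x' * y') ∧ x = t * x'

section
variable {n : ℕ} {q : ℂ} {E F : (Fin n → ℤ) → EndV n}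

/-- The pair of labels `(-b, -a)` has the same weight difference, with the two coefficients exchanged. -/
theorem HasRatio.dual {a b : VIdx n} {t : ℂ} (ht0 : t ≠ 0) (h : HasRatio E F a b t) :
    HasRatio E F (-b) (-a) t⁻¹ := by
  obtain ⟨x, x', y, y', hx', hy, hy', hE, hF, hxy, hx⟩ := h
  refine ⟨x', x, y', y, ?_, hy', hy, ?_, ?_, ?_, ?_⟩
  · rw [hx]; exact mul_ne_zero ht0 hx'
  · rw [wt_neg_neg, hE, neg_neg, neg_neg, add_comm]
  · rw [wt_neg_neg, hF, neg_neg, neg_neg, add_comm]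
  · rw [sg_neg, sg_neg, hxy, ← mul_assoc]
    linear_combination -(x' * y') * (sg b * sg b * sg_mul_self a + sg_mul_self b)
  · rw [hx]; field_simp

theorem wt_dot_wt {a k b : VIdx n} (hak : ht k < ht a) (hkb : ht b < ht k) (hba : ht b ≠ -ht a)
    (hka : ht k ≠ -ht a) (hbk : ht b ≠ -ht k) :
    wt a k ⬝ᵥ wt k b = if k = 0 then 0 else -1 := by
  have h1 : a ≠ k := fun h => by rw [h] at hak; omega
  have h2 : a ≠ b := fun h => by rw [h] at hak; omega
  have h3 : k ≠ b := fun h => by rw [h] at hkb; omega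
  have h4 : a ≠ -k := by rw [Ne, eq_neg_iff_ht]; omega
  have h5 : a ≠ -b := by rw [Ne, eq_neg_iff_ht]; omega
  have h6 : k ≠ -b := by rw [Ne, eq_neg_iff_ht]; omega
  simp only [wt, sub_dotProduct, dotProduct_sub, eps_dot_eps, h1, h2, h3, h4, h5, h6, if_false,
    if_true, ite_self]
  split_ifs <;> simp

/-- The braiding factor `(-1)^{[α][β]} q^{(α, β)}` of `α = ε_a - ε_k` and `β = ε_k - ε_b`. -/
theorem bracket_factor (q : ℂ) {a k b : VIdx n} (hak : ht k < ht a) (hkb : ht b < ht k)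
    (hba : ht b ≠ -ht a) (hka : ht k ≠ -ht a) (hbk : ht b ≠ -ht k) :
    (-1 : ℂ) ^ (rootParity n (wt a k) * rootParity n (wt k b)) * q ^ (wt a k ⬝ᵥ wt k b)
      = -tauFactor q k := by
  rw [wt_dot_wt hak hkb hba hka hbk, rootParity_wt hak (by rwa [Ne, eq_neg_iff_ht]),
    rootParity_wt hkb (by rwa [Ne, eq_neg_iff_ht]), tauFactor]
  by_cases hk : k = 0
  · simp [hk]
  · have : ¬ (a = 0 ∧ b = 0) := by rintro ⟨rfl, rfl⟩; omega
    by_cases ha : a = 0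
    · have hb : b ≠ 0 := fun hb => this ⟨ha, hb⟩
      simp [hk, hb]
    · simp [hk, ha]

theorem tauFactor_ne_zero (hq : q ≠ 0) (k : VIdx n) : tauFactor q k ≠ 0 := by
  rw [tauFactor]; split_ifs <;> simp [hq]

theorem tauFactor_mul_inv (hq : q ≠ 0) (k : VIdx n) : tauFactor q k * tauFactor q⁻¹ k = 1 := by
  rw [tauFactor, tauFactor]; split_ifs <;> simp [hq]

/-- The inductive step for the matrix coefficients of the root vectors: the two products in the
`q`-bracket contribute one matrix unit each. -/
theorem HasRatio.bracket (hq : q ≠ 0) {a k b : VIdx n} (hak : ht k < ht a) (hkb : ht b < ht k)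
    (hba : ht b ≠ -ht a) (hka : ht k ≠ -ht a) (hbk : ht b ≠ -ht k) {t u : ℂ}
    (h1 : HasRatio E F a k t) (h2 : HasRatio E F k b u)
    (hE : E (wt a b) = qBracket n q (wt a k) (wt k b) (E (wt a k)) (E (wt k b)))
    (hF : F (wt a b) = qBracket n q⁻¹ (wt k b) (wt a k) (F (wt k b)) (F (wt a k))) :
    HasRatio E F a b (t * u / tauFactor q k) := by
  obtain ⟨x, x', y, y', hx', hy, hy', hE1, hF1, hxy, hx⟩ := h1
  obtain ⟨v, v', w, w', hv', hw, hw', hE2, hF2, hvw, hv⟩ := h2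
  have n1 : a ≠ b := fun h => by rw [h] at hak; omega
  have n2 : -b ≠ -a := fun h => n1 (neg_injective h).symm
  have n3 : k ≠ -b := by rw [Ne, eq_neg_iff_ht]; omega
  have n4 : -b ≠ k := n3.symm
  have n5 : k ≠ -a := by rw [Ne, eq_neg_iff_ht]; omega
  have n6 : -a ≠ k := n5.symm
  have n7 : a ≠ -k := by rw [Ne, eq_neg_iff_ht]; omega
  have n8 : -k ≠ a := n7.symm
  have n9 : b ≠ -k := by rw [Ne, eq_neg_iff_ht]; omega
  have n10 : -k ≠ b := n9.symm
  have c := tauFactor_ne_zero hq k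
  refine ⟨x * v, tauFactor q k * (x' * v'), w * y, tauFactor q⁻¹ k * (w' * y'), ?_, ?_, ?_, ?_, ?_,
    ?_, ?_⟩
  · exact mul_ne_zero c (mul_ne_zero hx' hv')
  · exact mul_ne_zero hw hy
  · exact mul_ne_zero (tauFactor_ne_zero (inv_ne_zero hq) k) (mul_ne_zero hw' hy')
  · rw [hE, qBracket, bracket_factor q hak hkb hba hka hbk, hE1, hE2]
    simp only [add_mul, mul_add]
    simp [Matrix.single_mul_single_of_ne, n3, n6, n2.symm, n1.symm, n9, n8]
    rw [mul_comm v' x']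
  · rw [hF, qBracket, mul_comm (rootParity n (wt k b)), dotProduct_comm (wt k b),
      bracket_factor q⁻¹ hak hkb hba hka hbk, hF1, hF2]
    simp only [add_mul, mul_add]
    simp [Matrix.single_mul_single_of_ne, n5, n4, n2, n1, n7, n10]
    rw [mul_comm y' w']
  · linear_combination (v * w) * hxy + sg a * sg k * x' * y' * hvw
      + sg a * sg b * x' * y' * v' * w' * sg_mul_self k
      - sg a * sg b * x' * y' * v' * w' * tauFactor_mul_inv hq k
  · rw [hx, hv]; field_simp

/-- Every decomposition of `ε_a - ε_b` into two roots comes from an intermediate label. -/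
theorem exists_label_of_add_eq {α β : Fin n → ℤ} (hα : α ∈ reducedRoots n)
    (hβ : β ∈ reducedRoots n) {a b : VIdx n} (hab : ht b < ht a) (hba : ht b ≠ -ht a)
    (h : α + β = wt a b) :
    ∃ k : VIdx n, ht k < ht a ∧ ht b < ht k ∧ ht k ≠ -ht a ∧ ht b ≠ -ht k ∧
      ((α = wt a k ∧ β = wt k b) ∨ (α = wt k b ∧ β = wt a k)) := by
  -- It suffices to find one of the four labels occurring in `α`, `β` that equals `a` or `-b`.
  have main : ∀ {α β : Fin n → ℤ} {a b k : VIdx n}, α ∈ reducedRoots n → β ∈ reducedRoots n →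
      α + β = wt a b → α = wt a k →
      ht k < ht a ∧ ht b < ht k ∧ ht k ≠ -ht a ∧ ht b ≠ -ht k ∧ β = wt k b := by
    intro α β a b k hα hβ h hk
    have hβ' : β = wt k b := by
      have : wt a k + β = wt a k + wt k b := by rw [wt_add, ← h, hk]
      exact add_left_cancel this
    have aux : ∀ {c d : VIdx n}, wt c d ∈ reducedRoots n → ht d < ht c ∧ ht d ≠ -ht c := by
      intro c d hcd
      obtain ⟨e, f, h1, h2, h3⟩ := mem_reducedRoots_iff.1 hcd
      have h4 : e ≠ f := fun e => by rw [e] at h1; omega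
      rw [Ne, eq_neg_iff_ht] at h2
      rcases wt_eq_wt h3.symm h4 (by rwa [Ne, eq_neg_iff_ht]) with ⟨rfl, rfl⟩ | ⟨rfl, rfl⟩
      · exact ⟨h1, h2⟩
      · rw [ht_neg, ht_neg]; omega
    have h1 := aux (hk ▸ hα)
    have h2 := aux (hβ' ▸ hβ)
    exact ⟨h1.1, h2.1, h1.2, h2.2, hβ'⟩
  have main' : ∀ {a b : VIdx n}, ht b ≠ -ht a → ht b < ht a → α + β = wt a b → a ≠ 0 →
      ∃ k : VIdx n, ht k < ht a ∧ ht b < ht k ∧ ht k ≠ -ht a ∧ ht b ≠ -ht k ∧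
      ((α = wt a k ∧ β = wt k b) ∨ (α = wt k b ∧ β = wt a k)) := by
    intro a b hba hab h ha
    obtain ⟨c, d, -, -, hcd⟩ := mem_reducedRoots_iff.1 hα
    obtain ⟨e, f, -, -, hef⟩ := mem_reducedRoots_iff.1 hβ
    have h' : β + α = wt a b := by rw [add_comm, h]
    have fromα : ∀ k, α = wt a k → ∃ k : VIdx n, ht k < ht a ∧ ht b < ht k ∧ ht k ≠ -ht a ∧
        ht b ≠ -ht k ∧ ((α = wt a k ∧ β = wt k b) ∨ (α = wt k b ∧ β = wt a k)) := by
      intro k hk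
      obtain ⟨h1, h2, h3, h4, h5⟩ := main hα hβ h hk
      exact ⟨k, h1, h2, h3, h4, Or.inl ⟨hk, h5⟩⟩
    have fromβ : ∀ k, β = wt a k → ∃ k : VIdx n, ht k < ht a ∧ ht b < ht k ∧ ht k ≠ -ht a ∧
        ht b ≠ -ht k ∧ ((α = wt a k ∧ β = wt k b) ∨ (α = wt k b ∧ β = wt a k)) := by
      intro k hk
      obtain ⟨h1, h2, h3, h4, h5⟩ := main hβ hα h' hk
      exact ⟨k, h1, h2, h3, h4, Or.inr ⟨h5, hk⟩⟩
    have hne : b ≠ a := fun e => by rw [e] at hab; omega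
    have hne' : b ≠ -a := by rwa [Ne, eq_neg_iff_ht]
    have e1 : eps n c ⬝ᵥ eps n a - eps n d ⬝ᵥ eps n a + (eps n e ⬝ᵥ eps n a - eps n f ⬝ᵥ eps n a)
        = 1 := by
      rw [← sub_dotProduct, ← sub_dotProduct, ← add_dotProduct]
      change (wt c d + wt e f) ⬝ᵥ _ = 1
      rw [← hcd, ← hef, h, wt, sub_dotProduct]
      simp [eps_dot_eps, ha, hne, hne']
    by_cases h1 : c = a
    · exact fromα d (by rw [hcd, h1])
    by_cases h2 : d = -a
    · exact fromα (-c) (by rw [hcd, h2, ← wt_neg_neg, neg_neg])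
    by_cases h3 : e = a
    · exact fromβ f (by rw [hef, h3])
    by_cases h4 : f = -a
    · exact fromβ (-e) (by rw [hef, h4, ← wt_neg_neg, neg_neg])
    exfalso
    simp only [eps_dot_eps, h1, h2, h3, h4, if_false] at e1
    split_ifs at e1 <;> omega
  by_cases ha : a = 0
  · subst ha
    rw [ht_zero] at *
    obtain ⟨k, h1, h2, h3, h4, h5⟩ := main' (a := -b) (b := 0) (by simp; omega) (by simp; omega)
      (by rw [h, ← wt_neg_neg]; rfl) (by rw [Ne, ← ht_eq_zero, ht_neg]; omega)
    rw [ht_neg] at h1 h3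
    rw [ht_zero] at h2 h4
    refine ⟨-k, by simp; omega, by simp; omega, by simp; omega, by simp; omega, ?_⟩
    rw [← wt_neg_neg k 0, ← wt_neg_neg (-b) k, VIdx.neg_zero, neg_neg] at h5
    tauto
  · exact main' hba hab h ha

/-- The simple roots and the action of the Chevalley generators, in terms of labels. -/
theorem simpleRoot_spec (i : Fin n) : ∃ a b : VIdx n, ht a = ht b + 1 ∧ b ≠ -a ∧
    simpleRoot n i = wt a b ∧
    eV n i = Matrix.single a b 1 + Matrix.single (-b) (-a) (sg a * sg b) ∧
    fV n i = Matrix.single b a 1 + Matrix.single (-a) (-b) 1 := by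
  have hi := i.2
  by_cases h : (i : ℕ) + 1 < n
  · refine ⟨⟨i + 1, Finset.mem_Icc.2 (by omega)⟩, ⟨i + 2, Finset.mem_Icc.2 (by omega)⟩, ?_, ?_, ?_,
      ?_, ?_⟩
    · simp only [ht]
      split_ifs <;> omega
    · rw [Ne, VIdx.ext_iff', VIdx.coe_neg]
      simp only
      omega
    · rw [simpleRoot, if_pos h]; rfl
    · rw [eV, if_pos h, ← unitV_eq_single]
      have e1 : sg (⟨i + 1, Finset.mem_Icc.2 (by omega)⟩ : VIdx n) = 1 := by
        rw [sg, if_neg]; rw [VIdx.ext_iff', VIdx.coe_zero]; simp only; omega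
      have e2 : sg (⟨i + 2, Finset.mem_Icc.2 (by omega)⟩ : VIdx n) = 1 := by
        rw [sg, if_neg]; rw [VIdx.ext_iff', VIdx.coe_zero]; simp only; omega
      rw [e1, e2, mul_one, ← unitV_eq_single]
      rfl
    · rw [fV, if_pos h, ← unitV_eq_single, ← unitV_eq_single]
      rfl
  · have hn : (i : ℕ) + 1 = n := by omega
    refine ⟨⟨n, Finset.mem_Icc.2 (by omega)⟩, 0, ?_, ?_, ?_, ?_, ?_⟩
    · simp only [ht, VIdx.coe_zero]
      split_ifs <;> omega
    · rw [Ne, VIdx.ext_iff', VIdx.coe_neg, VIdx.coe_zero]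
      simp only
      omega
    · rw [simpleRoot, if_neg h]; simp [wt]
    · rw [eV, if_neg h, ← unitV_eq_single]
      have e1 : sg (⟨n, Finset.mem_Icc.2 (by omega)⟩ : VIdx n) = 1 := by
        rw [sg, if_neg]; rw [VIdx.ext_iff', VIdx.coe_zero]; simp only; omega
      have e2 : sg (0 : VIdx n) = -1 := by simp [sg]
      have e3 : unitV n (-(0 : VIdx n) : VIdx n) (-(⟨n, Finset.mem_Icc.2 (by omega)⟩ : VIdx n) : VIdx n)
        = unitV n 0 (-(n : ℤ)) := rfl
      have e4 : Matrix.single (-(0 : VIdx n)) (-(⟨n, Finset.mem_Icc.2 (by omega)⟩ : VIdx n)) (-1 : ℂ)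
          = -Matrix.single (-(0 : VIdx n)) (-(⟨n, Finset.mem_Icc.2 (by omega)⟩ : VIdx n)) 1 := by
        rw [← Matrix.single_neg]
      rw [e1, e2, one_mul, e4, ← unitV_eq_single, e3, ← sub_eq_add_neg]
      rfl
    · rw [fV, if_neg h, ← unitV_eq_single, ← unitV_eq_single]
      rfl

end
section
variable {n : ℕ} {q : ℂ} {E F : (Fin n → ℤ) → EndV n} {L : List (Fin n → ℤ)}

/-- The ratio of the matrix coefficients of `E_γ` on `V`, for all root vectors constructed along a
normal ordering. -/
theorem hasRatio_tau (hq : q ≠ 0) (hL : IsNormalOrdering n L) (hEF : IsRootVectors n q L E F) :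
    ∀ a b : VIdx n, ht b < ht a → ht b ≠ -ht a → HasRatio E F a b (tau L q a b) := by
  have main : ∀ (N : ℕ) (a b : VIdx n), ht a - ht b ≤ N → ht b < ht a → ht b ≠ -ht a →
      HasRatio E F a b (tau L q a b) := by
    intro N
    induction N with
    | zero => intro a b h1 h2; omega
    | succ N ih =>
      intro a b hN hab hba
      have hba' : b ≠ -a := by rwa [Ne, eq_neg_iff_ht]
      by_cases hs : ∃ i : Fin n, wt a b = simpleRoot n i
      · -- for a simple root there are no intermediate labels
        obtain ⟨i, hi⟩ := hs
        obtain ⟨c, d, hcd, hdc, h1, h2, h3⟩ := simpleRoot_spec i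
        obtain ⟨h4, h5⟩ := hEF.simple i
        have hne : c ≠ d := fun e => by rw [e] at hcd; omega
        have key : HasRatio E F c d (sg c * sg d) := by
          refine ⟨1, sg c * sg d, 1, 1, mul_ne_zero (sg_ne_zero _) (sg_ne_zero _), one_ne_zero,
            one_ne_zero, ?_, ?_, ?_, ?_⟩
          · rw [← h1, h4, h2]
          · rw [← h1, h5, h3]
          · linear_combination -(sg d * sg d * sg_mul_self c) - sg_mul_self d
          · linear_combination -(sg d * sg d * sg_mul_self c) - sg_mul_self d
        have hmid : ∀ a b : VIdx n, ht a = ht b + 1 → tau L q a b = sg a * sg b := by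
          intro a b hab
          rw [tau, Finset.prod_eq_one, mul_one]
          intro k hk
          rw [mem_mid] at hk
          omega
        rcases wt_eq_wt (hi.trans h1).symm hne hdc with ⟨rfl, rfl⟩ | ⟨rfl, rfl⟩
        · rw [hmid _ _ hcd]
          exact key
        · rw [hmid _ _ (by rw [ht_neg, ht_neg]; omega), sg_neg, sg_neg]
          have := key.dual (mul_ne_zero (sg_ne_zero _) (sg_ne_zero _))
          rwa [mul_inv, inv_eq_of_mul_eq_one_left (sg_mul_self c),
            inv_eq_of_mul_eq_one_left (sg_mul_self d), mul_comm] at this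
      · push Not at hs
        obtain ⟨α, β, hmin, hE, hF⟩ := hEF.step (wt a b) (wt_mem hab hba') hs
        obtain ⟨k, hak, hkb, hka, hbk, hk⟩ := exists_label_of_add_eq hmin.left_mem hmin.right_mem
          hab hba hmin.add_eq
        have hka' : k ≠ -a := by rwa [Ne, eq_neg_iff_ht]
        have hbk' : b ≠ -k := by rwa [Ne, eq_neg_iff_ht]
        have ih1 := ih a k (by omega) hak hka
        have ih2 := ih k b (by omega) hkb hbk
        have hN : IsMinimalLabel L a k b := by
          intro l h1 h2 h3 h4
          have h3' : l ≠ -a := by rwa [Ne, eq_neg_iff_ht]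
          have h4' : b ≠ -l := by rw [Ne, eq_neg_iff_ht]; omega
          have hm := hmin.minimal
          have hp := hmin.precedes
          have m1 := wt_mem h1 h3'
          have m2 := wt_mem h2 h4'
          rw [pos_of_ne hka', pos_of_ne hbk', pos_of_ne h3', pos_of_ne h4']
          constructor
          · rintro ⟨h5, h6, h7, h8⟩
            rcases hk with ⟨rfl, rfl⟩ | ⟨rfl, rfl⟩
            · exact hm ⟨_, m1, _, m2, wt_add _ _ _, ⟨h5, h6⟩, h7, h8⟩
            · simp only [Precedes] at hp
              omega
          · rintro ⟨h5, h6, h7, h8⟩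
            rcases hk with ⟨rfl, rfl⟩ | ⟨rfl, rfl⟩
            · simp only [Precedes] at hp
              omega
            · exact hm ⟨_, m1, _, m2, wt_add _ _ _, ⟨h5, h6⟩, h7, h8⟩
        have hstep := tau_step hL hq hak hkb hba hka hbk hN
        have hp := hmin.precedes
        rcases hk with ⟨rfl, rfl⟩ | ⟨rfl, rfl⟩
        · rw [hstep.1 (by rw [pos_of_ne hka', pos_of_ne hbk']; exact hp)]
          exact ih1.bracket hq hak hkb hba hka hbk ih2 hE hF
        · -- here `ε_k - ε_b` comes first; passing to the dual labels exchanges the two roots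
          rw [hstep.2 (by rw [pos_of_ne hka', pos_of_ne hbk']; exact hp)]
          have i1 := ih1.dual (tau_ne_zero L hq a k)
          have i2 := ih2.dual (tau_ne_zero L hq k b)
          rw [← wt_neg_neg a b, ← wt_neg_neg a k, ← wt_neg_neg k b] at hE hF
          have := (i2.bracket hq (by simpa using hkb) (by simpa using hak) (by simp; omega)
            (by simp; omega) (by simp; omega) i1 hE hF).dual (div_ne_zero (mul_ne_zero
              (inv_ne_zero (tau_ne_zero L hq _ _)) (inv_ne_zero (tau_ne_zero L hq _ _)))
              (tauFactor_ne_zero hq _))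
          rw [neg_neg, neg_neg] at this
          have hf : tauFactor q (-k) = tauFactor q k := by
            simp [tauFactor, VIdx.ext_iff']
          rw [hf] at this
          have e : ((tau L q k b)⁻¹ * (tau L q a k)⁻¹ / tauFactor q k)⁻¹
              = tau L q a k * tau L q k b * tauFactor q k := by
            rw [inv_div, div_eq_mul_inv, mul_inv, inv_inv, inv_inv]
            ring
          rwa [e] at this
  intro a b h1 h2
  exact main (ht a - ht b).toNat a b (by omega) h1 h2

/-- The common value `a_γ = x y` read off from the matrix coefficients. -/
theorem rootConst_eq (hq : q ≠ 0) (hq2 : q ^ 2 ≠ 1) {a b : VIdx n} (hab : ht b < ht a)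
    (hba : ht b ≠ -ht a) {x x' y y' : ℂ}
    (hE : E (wt a b) = Matrix.single a b x + Matrix.single (-b) (-a) x')
    (hF : F (wt a b) = Matrix.single b a y + Matrix.single (-a) (-b) y')
    (hxy : x * y = sg a * sg b * (x' * y')) (hb : a ≠ 0) :
    rootConst n q E F (wt a b) = x * y := by
  have hz := sub_inv_ne_zero_of_sq hq hq2
  have n1 : a ≠ b := fun h => by rw [h] at hab; omega
  have n2 : a ≠ -b := by rw [Ne, eq_neg_iff_ht]; omega
  have n3 : b ≠ -a := by rwa [Ne, eq_neg_iff_ht]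
  have n4 : -b ≠ -a := fun h => n1 (neg_injective h).symm
  have hbr : E (wt a b) * F (wt a b) - (-1 : ℂ) ^ rootParity n (wt a b) • (F (wt a b) * E (wt a b))
      = ((x * y) / (q - q⁻¹)) • (kV n q (wt a b) - kV n q (-wt a b)) := by
    have hsg : (-1 : ℂ) ^ rootParity n (wt a b) = sg b := by
      rw [rootParity_wt hab n3, sg]
      by_cases h : b = 0 <;> simp [h, hb]
    have hsa : sg a = 1 := by simp [sg, hb]
    have hx'y' : x' * y' = sg b * (x * y) := by
      linear_combination (-sg b) * hxy - sg b * sg b * (x' * y') * hsa - (x' * y') * sg_mul_self b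
    have hEF : E (wt a b) * F (wt a b)
        = Matrix.single a a (x * y) + Matrix.single (-b) (-b) (x' * y') := by
      rw [hE, hF, add_mul, mul_add, mul_add, Matrix.single_mul_single_same,
        Matrix.single_mul_single_same, Matrix.single_mul_single_of_ne (h := n3),
        Matrix.single_mul_single_of_ne (h := n3.symm), add_zero, zero_add]
    have hFE : F (wt a b) * E (wt a b)
        = Matrix.single b b (x * y) + Matrix.single (-a) (-a) (x' * y') := by
      rw [hE, hF, add_mul, mul_add, mul_add, Matrix.single_mul_single_same,
        Matrix.single_mul_single_same, Matrix.single_mul_single_of_ne (h := n2),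
        Matrix.single_mul_single_of_ne (h := n2.symm), add_zero, zero_add, mul_comm y x,
        mul_comm y' x']
    rw [hEF, hFE, hsg, hx'y']
    ext k l
    by_cases hkl : k = l
    · subst hkl
      have hd : wt a b ⬝ᵥ eps n k = (if a = k then 1 else if a = -k then -1 else 0)
          - if b = 0 then 0 else if b = k then 1 else if b = -k then -1 else 0 := by
        rw [wt, sub_dotProduct, eps_dot_eps, eps_dot_eps, if_neg hb]
      have e1 : -b = k ↔ b = -k := by rw [neg_eq_iff_eq_neg]
      have e2 : -a = k ↔ a = -k := by rw [neg_eq_iff_eq_neg]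
      have hk0 : b = 0 → (b = k ↔ b = -k) := by
        rintro rfl
        rw [← neg_eq_iff_eq_neg]
        rfl
      simp only [Matrix.add_apply, Matrix.sub_apply, Matrix.smul_apply, kV,
        Matrix.diagonal_apply_eq, neg_dotProduct, hd, Matrix.single, Matrix.of_apply, and_self, e1,
        e2, smul_eq_mul]
      have e3 : a = k → a ≠ -k := by
        rintro rfl h
        exact hb (ht_eq_zero.1 (by have := eq_neg_iff_ht.1 h; omega))
      have e4 : b ≠ 0 → b = k → b ≠ -k := by
        rintro h0 rfl h
        exact h0 (ht_eq_zero.1 (by have := eq_neg_iff_ht.1 h; omega))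
      have e5 : a = k → b ≠ k := by rintro rfl; exact n1.symm
      have e6 : a = k → b ≠ -k := by rintro rfl; exact n3
      have e7 : a = -k → b ≠ -k := by rintro rfl; exact n1.symm
      have e8 : a = -k → b ≠ k := by
        rintro h rfl
        exact n2 h
      by_cases hb0 : b = 0
      · have hs : sg b = -1 := by simp [sg, hb0]
        rw [hs, if_pos hb0]
        rw [if_congr (hk0 hb0) rfl rfl]
        by_cases c1 : a = k
        · simp only [if_pos c1, if_neg (e3 c1), if_neg (e6 c1)]
          simp
          rw [div_mul_cancel₀ _ hz]
        · by_cases c2 : a = -k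
          · simp only [if_neg c1, if_pos c2, if_neg (e7 c2)]
            simp
            field_simp
            ring
          · simp [c1, c2]
      · have hs : sg b = 1 := by simp [sg, hb0]
        rw [hs, if_neg hb0]
        by_cases c1 : a = k
        · simp only [if_pos c1, if_neg (e3 c1), if_neg (e6 c1), if_neg (e5 c1)]
          simp
          rw [div_mul_cancel₀ _ hz]
        · by_cases c2 : a = -k
          · simp only [if_neg c1, if_pos c2, if_neg (e7 c2), if_neg (e8 c2)]
            simp
            field_simp
            ring
          · by_cases c3 : b = k
            · simp only [if_neg c1, if_neg c2, if_pos c3, if_neg (e4 hb0 c3)]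
              simp
              field_simp
              ring
            · by_cases c4 : b = -k
              · simp only [if_neg c1, if_neg c2, if_neg c3, if_pos c4]
                simp
                rw [div_mul_cancel₀ _ hz]
              · simp [c1, c2, c3, c4]
    · have o : ∀ (c : VIdx n) (v : ℂ), Matrix.single c c v k l = 0 := by
        intro c v
        rw [Matrix.single, Matrix.of_apply, if_neg]
        rintro ⟨rfl, h⟩
        exact hkl h
      simp [o, kV, Matrix.diagonal_apply_ne _ hkl]
  -- the diagonal entry at `a` shows that no other scalar has the defining property
  have huniq : ∀ c : ℂ, E (wt a b) * F (wt a b)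
      - (-1 : ℂ) ^ rootParity n (wt a b) • (F (wt a b) * E (wt a b))
      = (c / (q - q⁻¹)) • (kV n q (wt a b) - kV n q (-wt a b)) → c = x * y := by
    intro c hc
    rw [hbr] at hc
    have h1 := congrFun (congrFun hc a) a
    have h2 : wt a b ⬝ᵥ eps n a = 1 := by
      simp [wt, sub_dotProduct, eps_dot_eps, hb, n1.symm, n3]
    simp only [Matrix.smul_apply, Matrix.sub_apply, kV, Matrix.diagonal_apply_eq, neg_dotProduct,
      h2, smul_eq_mul, zpow_one, zpow_neg] at h1
    rw [div_mul_cancel₀ _ hz, div_mul_cancel₀ _ hz] at h1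
    exact h1.symm
  exact huniq _ (Classical.epsilon_spec (p := fun c : ℂ => E (wt a b) * F (wt a b)
      - (-1 : ℂ) ^ rootParity n (wt a b) • (F (wt a b) * E (wt a b))
      = (c / (q - q⁻¹)) • (kV n q (wt a b) - kV n q (-wt a b))) ⟨_, hbr⟩)

end

/-! ### The factors of the quasi `R`-matrix

Operators of weight zero on `V ⊗ V` preserve the span of the `v_a ⊗ v_{-a}` and, for `b ≠ -a`, the
span of `v_a ⊗ v_b` and `v_b ⊗ v_a`. -/

/-- The operator that acts by the matrix `M` on the vectors `v_a ⊗ v_{-a}`, and by zero on the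
other basis vectors. -/
def zeroWt {n : ℕ} (M : EndV n) : EndVV n := fun x y =>
  if x.2 = -x.1 ∧ y.2 = -y.1 then M x.1 y.1 else 0

/-- The projection that kills the vectors `v_a ⊗ v_{-a}` and fixes the other basis vectors. -/
def nonzeroWt (n : ℕ) : EndVV n := fun x y => if y.2 ≠ -y.1 ∧ x = y then 1 else 0

/-- The operator `v_b ⊗ v_a ↦ c a b • v_a ⊗ v_b` for `b ≠ -a`, zero on the vectors
`v_a ⊗ v_{-a}`. -/
def swapWt {n : ℕ} (c : VIdx n → VIdx n → ℂ) : EndVV n := fun x y =>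
  if y.2 ≠ -y.1 ∧ x = (y.2, y.1) then c x.1 x.2 else 0

/-- The operator that acts by `M` on the vectors `v_a ⊗ v_{-a}`, and by
`v_b ⊗ v_a ↦ v_b ⊗ v_a + c a b • v_a ⊗ v_b` on the other basis vectors. -/
def block {n : ℕ} (M : EndV n) (c : VIdx n → VIdx n → ℂ) : EndVV n :=
  zeroWt M + nonzeroWt n + swapWt c

section
variable {n : ℕ}

theorem zeroWt_mul (M N : EndV n) : zeroWt M * zeroWt N = zeroWt (M * N) := by
  ext x y
  simp only [Matrix.mul_apply, zeroWt, Fintype.sum_prod_type]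
  by_cases hx : x.2 = -x.1
  · by_cases hy : y.2 = -y.1
    · simp [hx, hy]
    · simp [hy]
  · simp [hx]

theorem zeroWt_mul_nonzeroWt (M : EndV n) : zeroWt M * nonzeroWt n = 0 := by
  ext x y
  rw [Matrix.mul_apply]
  refine Finset.sum_eq_zero fun w _ => ?_
  simp only [zeroWt, nonzeroWt]
  by_cases h : w = y
  · subst h
    by_cases hy : w.2 = -w.1 <;> simp [hy]
  · simp [h]

theorem nonzeroWt_mul_zeroWt (M : EndV n) : nonzeroWt n * zeroWt M = 0 := by
  ext x y
  rw [Matrix.mul_apply]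
  refine Finset.sum_eq_zero fun w _ => ?_
  simp only [zeroWt, nonzeroWt]
  by_cases hy : w.2 = -w.1 <;> simp [hy]

theorem zeroWt_mul_swapWt (M : EndV n) (c : VIdx n → VIdx n → ℂ) : zeroWt M * swapWt c = 0 := by
  ext x y
  rw [Matrix.mul_apply]
  refine Finset.sum_eq_zero fun w _ => ?_
  simp only [zeroWt, swapWt]
  by_cases h : w = (y.2, y.1)
  · subst h
    by_cases hy : y.2 = -y.1
    · simp [hy]
    · have : y.1 ≠ -y.2 := fun h => hy (by rw [h, neg_neg])
      simp [this]
  · simp [h]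

theorem swapWt_mul_zeroWt (M : EndV n) (c : VIdx n → VIdx n → ℂ) : swapWt c * zeroWt M = 0 := by
  ext x y
  rw [Matrix.mul_apply]
  refine Finset.sum_eq_zero fun w _ => ?_
  simp only [zeroWt, swapWt]
  by_cases hy : w.2 = -w.1 <;> simp [hy]

theorem nonzeroWt_mul_self : nonzeroWt n * nonzeroWt n = nonzeroWt n := by
  ext x y
  rw [Matrix.mul_apply, Finset.sum_eq_single y]
  · simp only [nonzeroWt]
    by_cases hy : y.2 = -y.1 <;> simp [hy]
  · intro w _ hw
    simp [nonzeroWt, hw]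
  · simp

theorem swapWt_mul_nonzeroWt (c : VIdx n → VIdx n → ℂ) :
    swapWt c * nonzeroWt n = swapWt c := by
  ext x y
  rw [Matrix.mul_apply, Finset.sum_eq_single y]
  · simp only [nonzeroWt, swapWt]
    by_cases hy : y.2 = -y.1 <;> simp [hy]
  · intro w _ hw
    simp [nonzeroWt, hw]
  · simp

theorem nonzeroWt_mul_swapWt (c : VIdx n → VIdx n → ℂ) :
    nonzeroWt n * swapWt c = swapWt c := by
  ext x y
  rw [Matrix.mul_apply, Finset.sum_eq_single x]
  · simp only [nonzeroWt, swapWt]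
    by_cases hy : y.2 = -y.1
    · simp [hy]
    · by_cases hx : x = (y.2, y.1)
      · subst hx
        have : y.1 ≠ -y.2 := fun h => hy (by rw [h, neg_neg])
        simp [this]
      · simp [hx]
  · intro w _ hw
    simp [nonzeroWt, hw.symm]
  · simp

theorem swapWt_mul_swapWt {c d : VIdx n → VIdx n → ℂ} (h : ∀ a b, c a b * d b a = 0) :
    swapWt c * swapWt d = 0 := by
  ext x y
  rw [Matrix.mul_apply]
  refine Finset.sum_eq_zero fun w _ => ?_
  simp only [swapWt]
  by_cases hx : x = (w.2, w.1)
  · subst hx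
    by_cases hy : w = (y.2, y.1)
    · subst hy
      split_ifs <;> simp [h]
    · simp [hy]
  · simp [hx]

theorem zeroWt_add (M N : EndV n) : zeroWt (M + N) = zeroWt M + zeroWt N := by
  ext x y
  simp only [zeroWt, Matrix.add_apply]
  split_ifs <;> simp

theorem zeroWt_smul (r : ℂ) (M : EndV n) : zeroWt (r • M) = r • zeroWt M := by
  ext x y
  simp only [zeroWt, Matrix.smul_apply]
  split_ifs <;> simp

theorem zeroWt_zero : zeroWt (0 : EndV n) = 0 := by
  ext x y
  simp [zeroWt]

theorem swapWt_zero : swapWt (fun _ _ : VIdx n => (0 : ℂ)) = 0 := by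
  ext x y
  simp [swapWt]

theorem swapWt_add (c d : VIdx n → VIdx n → ℂ) :
    swapWt (fun a b => c a b + d a b) = swapWt c + swapWt d := by
  ext x y
  simp only [swapWt, Matrix.add_apply]
  split_ifs <;> simp

theorem zeroWt_one_add_nonzeroWt : zeroWt 1 + nonzeroWt n = 1 := by
  ext x y
  simp only [zeroWt, nonzeroWt, Matrix.add_apply, Matrix.one_apply]
  by_cases h : x = y
  · subst h
    by_cases hx : x.2 = -x.1 <;> simp [hx]
  · have : ¬ ((x.2 = -x.1 ∧ y.2 = -y.1) ∧ x.1 = y.1) := by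
      rintro ⟨⟨h1, h2⟩, h3⟩
      exact h (Prod.ext h3 (by rw [h1, h2, h3]))
    simp only [h, and_false, if_false, add_zero]
    split_ifs with h1 h2
    · exact absurd ⟨h1, h2⟩ this
    · rfl
    · rfl

theorem block_mul_block {M N : EndV n} {c d : VIdx n → VIdx n → ℂ}
    (h : ∀ a b, c a b * d b a = 0) :
    block M c * block N d = block (M * N) fun a b => c a b + d a b := by
  simp only [block, add_mul, mul_add, zeroWt_mul, zeroWt_mul_nonzeroWt, nonzeroWt_mul_zeroWt,
    zeroWt_mul_swapWt, swapWt_mul_zeroWt, nonzeroWt_mul_self, swapWt_mul_nonzeroWt,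
    nonzeroWt_mul_swapWt, swapWt_mul_swapWt h, swapWt_add]
  abel

theorem block_one : block (1 : EndV n) (fun _ _ => 0) = 1 := by
  rw [block, swapWt_zero, add_zero, zeroWt_one_add_nonzeroWt]

theorem zeroWt_single (a b : VIdx n) (u : ℂ) :
    zeroWt (Matrix.single a b u) = Matrix.single (a, -a) (b, -b) u := by
  ext x y
  obtain ⟨x1, x2⟩ := x
  obtain ⟨y1, y2⟩ := y
  simp only [zeroWt, Matrix.single, Matrix.of_apply, Prod.mk.injEq]
  by_cases h1 : a = x1
  · subst h1
    by_cases h2 : b = y1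
    · subst h2
      simp only [true_and, and_self, if_true]
      exact if_congr (and_congr eq_comm eq_comm) rfl rfl
    · simp [h2]
  · simp [h1]

theorem gradedTensor_single (p : ℕ) (a b c d : VIdx n) (u v : ℂ) :
    gradedTensor p (Matrix.single a b u) (Matrix.single c d v)
      = Matrix.single (a, c) (b, d) ((-1) ^ (p * parity b) * u * v) := by
  ext x y
  obtain ⟨x1, x2⟩ := x
  obtain ⟨y1, y2⟩ := y
  simp only [gradedTensor, Matrix.single, Matrix.of_apply, Prod.mk.injEq]
  by_cases h1 : a = x1
  · by_cases h2 : b = y1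
    · by_cases h3 : c = x2
      · by_cases h4 : d = y2
        · simp [h1, h2, h3, h4]
        · simp [h4]
      · simp [h3]
    · simp [h2]
  · simp [h1]

theorem gradedTensor_add_left (p : ℕ) (A B C : EndV n) :
    gradedTensor p (A + B) C = gradedTensor p A C + gradedTensor p B C := by
  ext x y
  simp only [gradedTensor, Matrix.add_apply]
  ring

theorem gradedTensor_add_right (p : ℕ) (A B C : EndV n) :
    gradedTensor p A (B + C) = gradedTensor p A B + gradedTensor p A C := by
  ext x y
  simp only [gradedTensor, Matrix.add_apply]
  ring

/-- For `X ^ 3 = 0` the `q`-exponential stops at the quadratic term, and `[2]_p! = 1 + p`. -/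
theorem qExp_of_cube_eq_zero {p : ℂ} (hp : p ≠ 1) {X : EndVV n} (hX : X * X * X = 0) :
    qExp p X = 1 + X + (1 + p)⁻¹ • (X * X) := by
  have h3 : X ^ 3 = 0 := by rw [pow_succ, pow_two, hX]
  have hs : (Function.support fun k : ℕ => (qFact p k)⁻¹ • X ^ k) ⊆ (Finset.range 3 : Finset ℕ) := by
    intro k hk
    rw [Finset.coe_range, Set.mem_Iio]
    by_contra hlt
    apply hk
    obtain ⟨m, rfl⟩ := Nat.exists_eq_add_of_le (not_lt.1 hlt)
    simp [pow_add, h3]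
  have hp' : 1 - p ≠ 0 := sub_ne_zero.2 hp.symm
  have hq2 : (1 - p ^ 2) / (1 - p) = 1 + p := by
    field_simp
    ring
  rw [qExp, finsum_eq_sum_of_support_subset _ hs]
  have e1 : qNum p (0 + 1) = 1 := by rw [qNum, zero_add, pow_one, div_self hp']
  have e2 : qNum p (1 + 1) = 1 + p := hq2
  simp only [Finset.sum_range_succ, Finset.range_zero, Finset.sum_empty, qFact,
    Finset.prod_range_succ, Finset.prod_empty, e1, e2, one_mul, inv_one, one_smul, pow_zero,
    zero_add, pow_one, pow_two]

/-- The function supported on the two pairs of labels `(x, y)` with `ε_x - ε_y = γ`. -/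
def rootSwap (q : ℂ) (γ : Fin n → ℤ) (x y : VIdx n) : ℂ :=
  if ht y < ht x ∧ wt x y = γ then (q - q⁻¹) * (sg x * sg y) else 0

/-- The matrix by which the factor of the quasi `R`-matrix for `γ = ε_a - ε_b` acts on the vectors
`v_k ⊗ v_{-k}`. -/
def rootBlock (L : List (Fin n → ℤ)) (q : ℂ) (a b : VIdx n) : EndV n :=
  1 + Matrix.single a b ((q - q⁻¹) * tau L q a b)
    + Matrix.single (-b) (-a) ((q - q⁻¹) * (tau L q a b)⁻¹)
    + if b = 0 then Matrix.single a (-a) ((q - q⁻¹) * (q + 1)) else 0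

theorem swapWt_rootSwap (q : ℂ) {a b : VIdx n} (hab : ht b < ht a) (hba : ht b ≠ -ht a) :
    swapWt (rootSwap q (wt a b)) = Matrix.single (a, b) (b, a) ((q - q⁻¹) * (sg a * sg b))
      + Matrix.single (-b, -a) (-a, -b) ((q - q⁻¹) * (sg a * sg b)) := by
  have n1 : a ≠ b := fun h => by rw [h] at hab; omega
  have n3 : b ≠ -a := by rwa [Ne, eq_neg_iff_ht]
  have n4 : a ≠ -b := fun h => n3 (by rw [h, neg_neg])
  ext x y
  obtain ⟨x1, x2⟩ := x
  obtain ⟨y1, y2⟩ := y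
  simp only [swapWt, rootSwap, Matrix.add_apply, Matrix.single, Matrix.of_apply, Prod.mk.injEq]
  by_cases h1 : x1 = y2 ∧ x2 = y1
  swap
  · rw [if_neg (fun h => h1 h.2), if_neg, if_neg, add_zero]
    · rintro ⟨⟨rfl, rfl⟩, rfl, rfl⟩; exact h1 ⟨rfl, rfl⟩
    · rintro ⟨⟨rfl, rfl⟩, rfl, rfl⟩; exact h1 ⟨rfl, rfl⟩
  obtain ⟨rfl, rfl⟩ := h1
  by_cases h2 : x1 = a ∧ x2 = b
  · obtain ⟨rfl, rfl⟩ := h2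
    simp [n4, hab]
    exact fun h => absurd h n4.symm
  by_cases h3 : x1 = -b ∧ x2 = -a
  · obtain ⟨rfl, rfl⟩ := h3
    rw [neg_neg, wt_neg_neg, ht_neg, ht_neg, sg_neg, sg_neg, mul_comm (sg b)]
    simp [n4, hab]
    exact fun h => absurd h n4.symm
  · have h4 : ¬ (ht x2 < ht x1 ∧ wt x1 x2 = wt a b) := by
      rintro ⟨-, h4⟩
      rcases wt_eq_wt h4.symm n1 n3 with h5 | h5
      · exact h2 h5
      · exact h3 h5
    rw [if_neg (show ¬ ((a = x1 ∧ b = x2) ∧ b = x2 ∧ a = x1) from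
      fun h => h2 ⟨h.1.1.symm, h.1.2.symm⟩), if_neg (show ¬ ((-b = x1 ∧ -a = x2) ∧ -a = x2 ∧ -b = x1)
      from fun h => h3 ⟨h.1.1.symm, h.1.2.symm⟩)]
    simp [h4]

theorem wt_dot_self {a b : VIdx n} (hab : ht b < ht a) (hba : ht b ≠ -ht a) (ha : a ≠ 0) :
    wt a b ⬝ᵥ wt a b = if b = 0 then 1 else 2 := by
  have n1 : a ≠ b := fun h => by rw [h] at hab; omega
  have n3 : b ≠ -a := by rwa [Ne, eq_neg_iff_ht]
  have n4 : a ≠ -b := fun h => n3 (by rw [h, neg_neg])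
  simp only [wt, sub_dotProduct, dotProduct_sub, eps_dot_eps, n1, n1.symm, n3, n4, ha, if_false,
    if_true]
  split_ifs <;> simp

variable {q : ℂ} {E F : (Fin n → ℤ) → EndV n} {L : List (Fin n → ℤ)}

/-- The factor of the quasi `R`-matrix for the root `ε_a - ε_b`. The nilpotent operator in the
exponential has square zero unless `b = 0`, when its square moves `v_{-a} ⊗ v_a` to `v_a ⊗ v_{-a}`. -/
theorem rTildeRoot_eq_block (hq : q ≠ 0) (hq2 : q ^ 2 ≠ 1) (hL : IsNormalOrdering n L)
    (hEF : IsRootVectors n q L E F) {a b : VIdx n} (hab : ht b < ht a) (hba : ht b ≠ -ht a)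
    (ha : a ≠ 0) :
    rTildeRoot n q E F (wt a b) = block (rootBlock L q a b) (rootSwap q (wt a b)) := by
  obtain ⟨x, x', y, y', hx', hy, hy', hE, hF, hxy, hx⟩ := hasRatio_tau hq hL hEF a b hab hba
  have hτ := tau_ne_zero L hq a b
  have hx0 : x ≠ 0 := hx ▸ mul_ne_zero hτ hx'
  have n1 : a ≠ b := fun h => by rw [h] at hab; omega
  have n3 : b ≠ -a := by rwa [Ne, eq_neg_iff_ht]
  have n4 : a ≠ -b := fun h => n3 (by rw [h, neg_neg])
  have n5 : a ≠ -a := by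
    intro h
    exact ha (ht_eq_zero.1 (by have := eq_neg_iff_ht.1 h; omega))
  have hsa : sg a = 1 := by simp [sg, ha]
  have hpa : parity a = 1 := by
    exact if_neg (fun h => ha (VIdx.ext_iff'.2 h))
  have hpar : rootParity n (wt a b) = if b = 0 then 1 else 0 := by
    rw [rootParity_wt hab n3]; simp [ha]
  have hsb : (-1 : ℂ) ^ rootParity n (wt a b) = sg b := by
    rw [hpar, sg]; split_ifs <;> simp
  have hsb' : (-1 : ℂ) ^ (rootParity n (wt a b) * parity b) = 1 := by
    rw [hpar]
    by_cases h : b = 0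
    · subst h; simp [parity]
    · simp [h]
  have hpna : parity (-a) = 1 := by
    rw [parity, if_neg]
    intro h
    rw [VIdx.coe_neg] at h
    exact ha (VIdx.ext_iff'.2 (by rw [VIdx.coe_zero]; omega))
  have hc := rootConst_eq hq hq2 hab hba hE hF hxy ha
  set N : EndV n := Matrix.single a b ((q - q⁻¹) * tau L q a b)
    + Matrix.single (-b) (-a) ((q - q⁻¹) * (tau L q a b)⁻¹) with hN
  have hX : ((-1 : ℂ) ^ rootParity n (wt a b) * (rootConst n q E F (wt a b))⁻¹ * (q - q⁻¹)) •
      gradedTensor (rootParity n (wt a b)) (E (wt a b)) (F (wt a b))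
      = zeroWt N + swapWt (rootSwap q (wt a b)) := by
    rw [hc, hE, hF, gradedTensor_add_left, gradedTensor_add_right, gradedTensor_add_right,
      gradedTensor_single, gradedTensor_single, gradedTensor_single, gradedTensor_single,
      swapWt_rootSwap q hab hba, hN, zeroWt_add, zeroWt_single, zeroWt_single, hsb', hpna, mul_one,
      hsb, smul_add, smul_add, smul_add, Matrix.smul_single, Matrix.smul_single, Matrix.smul_single,
      Matrix.smul_single, neg_neg, neg_neg]
    have e0 := sg_mul_self b
    rw [hsa, one_mul] at hxy
    have hxy' : x' * y' = sg b * (x * y) := by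
      linear_combination (-sg b) * hxy - (x' * y') * e0
    have e1 : (sg b * (x * y)⁻¹ * (q - q⁻¹)) • (1 * x * y) = (q - q⁻¹) * (sg a * sg b) := by
      rw [hsa, smul_eq_mul]; field_simp
    have e2 : (sg b * (x * y)⁻¹ * (q - q⁻¹)) • (sg b * x' * y') = (q - q⁻¹) * (sg a * sg b) := by
      have : sg b * x' * y' = x * y := by rw [hxy]; ring
      rw [hsa, smul_eq_mul, this]; field_simp
    have e3 : (sg b * (x * y)⁻¹ * (q - q⁻¹)) • (1 * x * y') = (q - q⁻¹) * tau L q a b := by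
      have : x * y' = tau L q a b * (sg b * (x * y)) := by rw [← hxy', hx]; ring
      rw [smul_eq_mul, one_mul, this]
      have h1 : sg b * (x * y)⁻¹ * (q - q⁻¹) * (tau L q a b * (sg b * (x * y)))
        = (sg b * sg b) * ((x * y)⁻¹ * (x * y)) * ((q - q⁻¹) * tau L q a b) := by ring
      rw [h1, e0, inv_mul_cancel₀ (mul_ne_zero hx0 hy)]; ring
    have e4 : (sg b * (x * y)⁻¹ * (q - q⁻¹)) • (sg b * x' * y)
        = (q - q⁻¹) * (tau L q a b)⁻¹ := by
      have h1 : sg b * (x * y)⁻¹ * (q - q⁻¹) * (sg b * x' * y)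
        = (sg b * sg b) * ((x * y)⁻¹ * (x' * y)) * (q - q⁻¹) := by ring
      rw [smul_eq_mul, h1, e0, hx]
      field_simp
    rw [e1, e2, e3, e4]
    abel
  -- the two matrix units in `N` are composable only if `b = 0`
  have hNN : N * N = if b = 0 then Matrix.single a (-a) ((q - q⁻¹) * (q - q⁻¹)) else 0 := by
    have n6 : -a ≠ -b := fun h => n1 (neg_injective h)
    rw [hN, add_mul, mul_add, mul_add, Matrix.single_mul_single_of_ne (h := n1.symm),
      Matrix.single_mul_single_of_ne (h := n5.symm), Matrix.single_mul_single_of_ne (h := n6),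
      zero_add, add_zero, add_zero]
    by_cases hb : b = 0
    · subst hb
      rw [if_pos rfl, VIdx.neg_zero, Matrix.single_mul_single_same]
      congr 1
      field_simp
    · rw [if_neg hb, Matrix.single_mul_single_of_ne]
      intro h
      exact hb (ht_eq_zero.1 (by have := eq_neg_iff_ht.1 h; omega))
  have hNNN : N * N * N = 0 := by
    rw [hNN]
    split_ifs with hb
    · subst hb
      have n6 : -a ≠ -0 := fun h => n1 (neg_injective h)
      rw [hN, mul_add, Matrix.single_mul_single_of_ne (h := n5.symm),
        Matrix.single_mul_single_of_ne (h := n6), add_zero]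
    · rw [zero_mul]
  have hcc : ∀ x y : VIdx n, rootSwap q (wt a b) x y * rootSwap q (wt a b) y x = 0 := by
    intro x y
    rw [rootSwap, rootSwap]
    by_cases h : ht y < ht x
    · rw [if_neg (show ¬ (ht x < ht y ∧ _) by omega), mul_zero]
    · rw [if_neg (show ¬ (ht y < ht x ∧ _) from fun h' => h h'.1), zero_mul]
  have hXX : (zeroWt N + swapWt (rootSwap q (wt a b))) * (zeroWt N + swapWt (rootSwap q (wt a b)))
      = zeroWt (N * N) := by
    rw [add_mul, mul_add, mul_add, zeroWt_mul, zeroWt_mul_swapWt, swapWt_mul_zeroWt,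
      swapWt_mul_swapWt hcc]
    abel
  have hp : (-1 : ℂ) ^ rootParity n (wt a b) * q ^ (-(wt a b ⬝ᵥ wt a b))
      = if b = 0 then -q⁻¹ else (q ^ 2)⁻¹ := by
    rw [hsb, wt_dot_self hab hba ha, sg]
    split_ifs
    · simp
    · rw [one_mul, zpow_neg]
      norm_cast
  rw [rTildeRoot, hX, hp, qExp_of_cube_eq_zero _ _, hXX, hNN]
  · rw [block, rootBlock, ← zeroWt_one_add_nonzeroWt]
    have : (1 + if b = 0 then -q⁻¹ else (q ^ 2)⁻¹)⁻¹ • zeroWt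
        (if b = 0 then Matrix.single a (-a) ((q - q⁻¹) * (q - q⁻¹)) else 0)
        = zeroWt (if b = 0 then Matrix.single a (-a) ((q - q⁻¹) * (q + 1)) else 0) := by
      rw [← zeroWt_smul]
      split_ifs
      · rw [Matrix.smul_single, smul_eq_mul]
        congr 2
        have : q - 1 ≠ 0 := fun h => hq2 (by linear_combination (q + 1) * h)
        have h2 : 1 + -q⁻¹ = (q - 1) / q := by field_simp; ring
        rw [h2]
        field_simp
        ring
      · rw [smul_zero]
    rw [this, hN]
    simp only [zeroWt_add]
    abel
  · split_ifs
    · intro h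
      apply hq2
      have : q = -1 := by
        field_simp at h
        linear_combination -h
      rw [this]; norm_num
    · intro h
      exact hq2 (inv_eq_one.1 h)
  · rw [hXX, mul_add, zeroWt_mul, zeroWt_mul_swapWt, hNNN, zeroWt_zero, add_zero]

end

/-! ### The quasi `R`-matrix -/

/-- The contribution of an intermediate label `k` to the entries in row `a` of `tailMat`. -/
def tailFactor {n : ℕ} (L : List (Fin n → ℤ)) (q : ℂ) (p : ℕ) (a k : VIdx n) : ℂ :=
  if p ≤ pos L a k then -q⁻¹ else -q

open Classical in
/-- The matrix by which the product of the factors of the quasi `R`-matrix at the positions `≥ p`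
acts on the vectors `v_k ⊗ v_{-k}`. The last summand is present only when `a > 0 > j` and `p` separates
the root `ε_a + ε_j`, at a position `< p`, from the root `ε_a`, at a position `≥ p`. -/
def tailMat {n : ℕ} (L : List (Fin n → ℤ)) (q : ℂ) (p : ℕ) : EndV n := fun a j =>
  if a = j then 1
  else if ht j < ht a ∧ p ≤ pos L a j then
    sg a * sg j * ((q - q⁻¹) * (∏ k ∈ mid a j, tailFactor L q p a k + (if j = -a then q else 0)
      - if 0 < ht a ∧ ht j < 0 ∧ -ht j < ht a ∧ p ≤ pos L a 0 ∧ pos L a (-j) < p then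
          (q - q⁻¹) * q * ∏ k ∈ mid a (-j), tailFactor L q p a k else 0))
  else 0

section
variable {n : ℕ} {L : List (Fin n → ℤ)} {q : ℂ} {p : ℕ}

theorem tailMat_self (a : VIdx n) : tailMat L q p a a = 1 := by simp [tailMat]

theorem tailMat_of_lt {a j : VIdx n} (h : ht a < ht j) : tailMat L q p a j = 0 := by
  have h1 : a ≠ j := fun e => by rw [e] at h; omega
  rw [tailMat, if_neg h1, if_neg]
  omega

theorem tailMat_of_pos_lt {a j : VIdx n} (h : a ≠ j) (h2 : pos L a j < p) :
    tailMat L q p a j = 0 := by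
  rw [tailMat, if_neg h, if_neg]
  omega

/-- The entry of `tailMat` at a pair of labels whose root has position `≥ p`, when the exceptional
summand is absent. -/
theorem tailMat_of_le {a j : VIdx n} (h : ht j < ht a) (h2 : p ≤ pos L a j)
    (h3 : ¬ (0 < ht a ∧ ht j < 0 ∧ -ht j < ht a ∧ p ≤ pos L a 0 ∧ pos L a (-j) < p)) :
    tailMat L q p a j = sg a * sg j * ((q - q⁻¹) * (∏ k ∈ mid a j, tailFactor L q p a k
      + (if j = -a then q else 0))) := by
  have h1 : a ≠ j := fun e => by rw [e] at h; omega
  rw [tailMat, if_neg h1, if_pos ⟨h, h2⟩, if_neg h3, sub_zero]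

theorem tailMat_exceptional {a j : VIdx n} (ha : 0 < ht a) (hj : ht j < 0) (h : -ht j < ht a)
    (h2 : p ≤ pos L a j) (h3 : p ≤ pos L a 0) (h4 : pos L a (-j) < p) :
    tailMat L q p a j = sg a * sg j * ((q - q⁻¹) * (∏ k ∈ mid a j, tailFactor L q p a k
      - (q - q⁻¹) * q * ∏ k ∈ mid a (-j), tailFactor L q p a k)) := by
  have h1 : a ≠ j := fun e => by rw [e] at ha; omega
  have h5 : j ≠ -a := by rw [Ne, eq_neg_iff_ht]; omega
  rw [tailMat, if_neg h1, if_pos ⟨by omega, h2⟩, if_neg h5, if_pos ⟨ha, hj, h, h3, h4⟩, add_zero]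

theorem pos_eq_row (hL : IsNormalOrdering n L) {a b c k : VIdx n} (hab : ht b < ht a)
    (hba : ht b ≠ -ht a) (h : pos L c k = pos L a b) : c = a ∨ c = -b := by
  have hba' : b ≠ -a := by rwa [Ne, eq_neg_iff_ht]
  by_cases hk : k = -c
  · rw [hk, pos_neg_right, ← pos_zero_right] at h
    by_cases hc : (0 : VIdx n) = -c
    · obtain rfl : c = 0 := by rw [← neg_neg c, ← hc]; rfl
      -- there is no root `ε_0`, so this position is not taken by a root
      rw [pos_zero_right, pos_of_ne hba'] at h
      have := idxOf_inj_of_mem hL (wt_mem hab hba') h.symm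
      have h2 := wtHt_wt a b
      have h3 := wtHt_eps (0 : VIdx n)
      rw [← this, ht_zero] at h3
      omega
    · rcases pos_eq_pos hL hab hba' hc h.symm with h1 | h1
      · exact Or.inl h1.1
      · exact Or.inr h1.1
  · rcases pos_eq_pos hL hab hba' hk h.symm with h1 | h1
    · exact Or.inl h1.1
    · exact Or.inr h1.1

/-- A row in which no root has position `p` does not change from `p + 1` to `p`. -/
theorem tailMat_row_eq {a j : VIdx n} (h : ∀ k, ht j ≤ ht k → ht k < ht a → pos L a k ≠ p) :
    tailMat L q p a j = tailMat L q (p + 1) a j := by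
  by_cases h1 : a = j
  · subst h1; rw [tailMat_self, tailMat_self]
  by_cases h2 : ht j < ht a
  · have hm : ∀ i : VIdx n, ht j ≤ ht i → ∏ k ∈ mid a i, tailFactor L q p a k
        = ∏ k ∈ mid a i, tailFactor L q (p + 1) a k := by
      intro i hi
      refine Finset.prod_congr rfl fun k hk => ?_
      rw [mem_mid] at hk
      have := h k (by omega) hk.1
      rw [tailFactor, tailFactor]
      exact if_congr (by omega) rfl rfl
    rw [tailMat, tailMat, if_neg h1, if_neg h1, hm j le_rfl]
    have e1 := h j le_rfl h2
    by_cases h3 : 0 < ht a ∧ ht j < 0 ∧ -ht j < ht a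
    · rw [hm (-j) (by rw [ht_neg]; omega)]
      have e2 := h 0 (by rw [ht_zero]; omega) (by rw [ht_zero]; omega)
      have e3 := h (-j) (by rw [ht_neg]; omega) (by rw [ht_neg]; omega)
      refine if_congr (by omega) ?_ rfl
      congr 3
      exact if_congr (by omega) rfl rfl
    · refine if_congr (by omega) ?_ rfl
      congr 3
      rw [if_neg (by omega), if_neg (by omega)]
  · have h3 : ht a ≠ ht j := fun e => h1 (ht_inj.1 e)
    rw [tailMat_of_lt (by omega), tailMat_of_lt (by omega)]

/-- The effect on row `a` of `tailMat` of the factor for a root `ε_a - ε_b` at position `p`. -/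
theorem tailMat_row (hL : IsNormalOrdering n L) {a b : VIdx n} (hab : ht b < ht a)
    (hba : ht b ≠ -ht a) (hb : b ≠ 0) (hp : pos L a b = p) (j : VIdx n) :
    tailMat L q p a j
      = tailMat L q (p + 1) a j + (q - q⁻¹) * tau L q a b * tailMat L q (p + 1) b j := by
  have hba' : b ≠ -a := by rwa [Ne, eq_neg_iff_ht]
  have hb0 : ht b ≠ 0 := fun h => hb (ht_eq_zero.1 h)
  have hab' : a ≠ -b := fun h => hba' (by rw [h, neg_neg])
  have hne : a ≠ b := fun h => by rw [h] at hab; omega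
  have h0 : ht (0 : VIdx n) = 0 := ht_zero
  have hua : ∀ k : VIdx n, ht k < ht a → k ≠ b → pos L a k ≠ p := by
    intro k hk hkb h
    by_cases hka : k = -a
    · rw [hka, pos_neg_right, ← pos_zero_right, ← hp] at h
      have h0a : (0 : VIdx n) ≠ -a := by
        rw [Ne, eq_neg_iff_ht]; rw [hka, ht_neg] at hk; omega
      rcases pos_eq_pos hL hab hba' h0a h.symm with h1 | h1
      · exact hb h1.2.symm
      · exact hab' h1.1
    · rw [← hp] at h
      rcases pos_eq_pos hL hab hba' hka h.symm with h1 | h1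
      · exact hkb h1.2
      · exact hab' h1.1
  have hub : ∀ k : VIdx n, pos L b k ≠ p := by
    intro k h
    rw [← hp] at h
    rcases pos_eq_row hL hab hba h with h1 | h1
    · exact hne h1.symm
    · have := eq_neg_iff_ht.1 h1
      omega
  have hsb : sg b = 1 := by simp [sg, hb]
  have hτ : tau L q a b = sg a * ∏ k ∈ mid a b, tailFactor L q p a k := by
    rw [tau, hsb, mul_one]
    congr 1
    refine Finset.prod_congr rfl fun k _ => ?_
    rw [tailFactor, hp]
    by_cases h : pos L a k < p
    · rw [if_pos h, if_neg (by omega)]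
    · rw [if_neg h, if_pos (by omega)]
  rcases lt_trichotomy (ht j) (ht b) with hjb | hjb | hjb
  swap
  · obtain rfl : j = b := ht_inj.1 hjb
    have h3 : ¬ (0 < ht a ∧ ht j < 0 ∧ -ht j < ht a ∧ p ≤ pos L a 0 ∧ pos L a (-j) < p) := by
      rintro ⟨-, h1, h2, h3, h4⟩
      have := hL.rank_two (a := a) (b := -j) (by rw [ht_neg]; omega) (by rw [ht_neg]; omega)
      rw [neg_neg] at this
      omega
    rw [tailMat_of_le hab hp.ge h3, tailMat_of_pos_lt hne (by omega), tailMat_self, hτ, if_neg hba',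
      hsb]
    ring
  swap
  · rw [tailMat_of_lt hjb, mul_zero, add_zero]
    refine tailMat_row_eq fun k h1 h2 => hua k h2 ?_
    rintro rfl
    omega
  have hc := hL.conv hab hjb (fun h => absurd h hb)
  rw [hp] at hc
  have haj : a ≠ j := fun h => by rw [h] at hab; omega
  have hbj : b ≠ j := fun h => by rw [h] at hjb; omega
  have hajp := hua j (by omega) hbj.symm
  by_cases hlt : pos L a j < p
  · rw [tailMat_of_pos_lt haj hlt, tailMat_of_pos_lt haj (by omega),
      tailMat_of_pos_lt hbj (by omega)]
    ring
  -- The products that enter the three entries differ only in the factor of the label `b`.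
  have e1 : ∀ i : VIdx n, ht b ≤ ht i → ∏ k ∈ mid a i, tailFactor L q (p + 1) a k
      = ∏ k ∈ mid a i, tailFactor L q p a k := by
    intro i hi
    refine Finset.prod_congr rfl fun k hk => ?_
    rw [mem_mid] at hk
    have := hua k hk.1 (by rintro rfl; omega)
    rw [tailFactor, tailFactor]
    exact if_congr (by omega) rfl rfl
  have e2 : ∀ i : VIdx n, ∏ k ∈ mid b i, tailFactor L q (p + 1) a k
      = ∏ k ∈ mid b i, tailFactor L q (p + 1) b k := by
    intro i
    refine Finset.prod_congr rfl fun k hk => ?_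
    rw [mem_mid] at hk
    have c1 := hL.conv hab hk.1 (fun h => absurd h hb)
    rw [tailFactor, tailFactor]
    exact if_congr (by omega) rfl rfl
  have e3 : ∀ i : VIdx n, ∏ k ∈ mid b i, tailFactor L q p a k
      = ∏ k ∈ mid b i, tailFactor L q (p + 1) b k := by
    intro i
    rw [← e2]
    refine Finset.prod_congr rfl fun k hk => ?_
    rw [mem_mid] at hk
    have := hua k (by omega) (by rintro rfl; omega)
    rw [tailFactor, tailFactor]
    exact if_congr (by omega) rfl rfl
  have e4 : ∀ i : VIdx n, ht i < ht b → ∏ k ∈ mid a i, tailFactor L q p a k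
      = (∏ k ∈ mid a b, tailFactor L q p a k) * (-q⁻¹)
        * ∏ k ∈ mid b i, tailFactor L q (p + 1) b k := by
    intro i hi
    rw [prod_mid_split hab hi, if_neg hb, e3, tailFactor, if_pos hp.ge]
  have e5 : ∀ i : VIdx n, ht i < ht b → ∏ k ∈ mid a i, tailFactor L q (p + 1) a k
      = (∏ k ∈ mid a b, tailFactor L q p a k) * (-q)
        * ∏ k ∈ mid b i, tailFactor L q (p + 1) b k := by
    intro i hi
    rw [prod_mid_split hab hi, if_neg hb, e2, e1 b le_rfl]
    rw [show tailFactor L q (p + 1) a b = -q by rw [tailFactor, if_neg (by omega)]]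
  by_cases hQ : 0 < ht a ∧ ht j < 0 ∧ -ht j < ht a
  swap
  · have hjb' : j ≠ -b := by rw [Ne, eq_neg_iff_ht]; omega
    rw [tailMat_of_le (by omega) (by omega) (by omega),
      tailMat_of_le (by omega) (by omega) (by omega),
      tailMat_of_le (by omega) (by omega) (by omega), e4 j hjb, e5 j hjb, if_neg hjb', hτ, hsb]
    ring
  obtain ⟨hQ1, hQ2, hQ3⟩ := hQ
  have hja : j ≠ -a := by rw [Ne, eq_neg_iff_ht]; omega
  have hr := hL.rank_two (a := a) (b := -j) (by rw [ht_neg]; omega) (by rw [ht_neg]; omega)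
  rw [neg_neg] at hr
  rcases lt_trichotomy (ht b) (-ht j) with hbm | hbm | hbm
  · -- `b` lies below `-j`
    have hjb' : j ≠ -b := by rw [Ne, eq_neg_iff_ht]; omega
    have u1 := hua 0 (by omega) (Ne.symm hb)
    have u2 := hua (-j) (by rw [ht_neg]; omega) (by rintro rfl; rw [ht_neg] at hbm; omega)
    rw [tailMat_of_le (a := b) (by omega) (by omega) (by omega), if_neg hjb']
    by_cases hC : p ≤ pos L a 0 ∧ pos L a (-j) < p
    · rw [tailMat_exceptional hQ1 hQ2 hQ3 (by omega) hC.1 hC.2,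
        tailMat_exceptional hQ1 hQ2 hQ3 (by omega) (by omega) (by omega), e4 j hjb, e5 j hjb, hτ,
        hsb, e1 (-j) (by rw [ht_neg]; omega)]
      ring
    · rw [tailMat_of_le (by omega) (by omega) (by omega),
        tailMat_of_le (by omega) (by omega) (by omega), e4 j hjb, e5 j hjb, hτ, hsb, if_neg hja]
      ring
  · -- `b = -j`: the exceptional summand disappears
    obtain rfl : b = -j := eq_neg_iff_ht.2 hbm
    have u1 := hua 0 (by omega) (Ne.symm hb)
    rw [tailMat_of_le (by omega) (by omega) (by omega),
      tailMat_exceptional hQ1 hQ2 hQ3 (by omega) (by omega) (by omega),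
      tailMat_of_le hjb (by omega) (by omega), e4 j hjb, e5 j hjb, hτ, hsb,
      if_neg hja, if_pos (neg_neg j).symm, e1 (-j) le_rfl]
    ring
  · -- `b` lies above `-j`
    have hjb' : j ≠ -b := by rw [Ne, eq_neg_iff_ht]; omega
    have u1 := hua 0 (by omega) (Ne.symm hb)
    have u2 := hua (-j) (by rw [ht_neg]; omega) (by rintro rfl; rw [ht_neg] at hbm; omega)
    have c1 := hL.conv (c := 0) hab (by omega) (fun h => absurd h hb)
    have c2 := hL.conv (c := -j) hab (by rw [ht_neg]; omega) (fun h => absurd h hb)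
    have hjb2 : ht (-j) < ht b := by rw [ht_neg]; omega
    by_cases hC : p ≤ pos L a 0 ∧ pos L a (-j) < p
    · rw [tailMat_exceptional hQ1 hQ2 hQ3 (by omega) hC.1 hC.2,
        tailMat_exceptional hQ1 hQ2 hQ3 (by omega) (by omega) (by omega),
        tailMat_exceptional (by omega) hQ2 (by omega) (by omega) (by omega) (by omega), e4 j hjb,
        e5 j hjb, hτ, hsb, e4 (-j) hjb2, e5 (-j) hjb2]
      ring
    · rw [tailMat_of_le (by omega) (by omega) (by omega),
        tailMat_of_le (by omega) (by omega) (by omega),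
        tailMat_of_le hjb (by omega) (by omega), e4 j hjb, e5 j hjb, hτ, hsb, if_neg hja,
        if_neg hjb']
      ring

/-- Exactly one of the roots `ε_a ± ε_k` precedes `ε_a`, so that the factors of `k` and `-k` cancel. -/
theorem prod_tailFactor_symm (hq : q ≠ 0) (hL : IsNormalOrdering n L) {a m : VIdx n}
    (hma : ht m ≤ ht a) (hp : pos L a 0 = p) :
    ∏ k ∈ mid m (-m), tailFactor L q p a k = 1 := by
  have key : ∀ k : VIdx n, 0 < ht k → ht k < ht a →
      tailFactor L q p a k * tailFactor L q p a (-k) = 1 := by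
    intro k h1 h2
    have := hL.rank_two h1 h2
    rw [tailFactor, tailFactor]
    by_cases h : p ≤ pos L a k
    · rw [if_pos h, if_neg (by omega)]; field_simp
    · rw [if_neg h, if_pos (by omega)]; field_simp
  refine Finset.prod_involution (fun k _ => -k) ?_ ?_ ?_ ?_
  · intro k hk
    rw [mem_mid, Ne, ← ht_eq_zero, ht_neg] at hk
    rcases lt_or_gt_of_ne hk.2.2 with h | h
    · have := key (-k) (by rw [ht_neg]; omega) (by rw [ht_neg]; omega)
      rw [neg_neg] at this
      rw [mul_comm, this]
    · exact key k h (by omega)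
  · intro k hk _ h
    rw [mem_mid, Ne, ← ht_eq_zero] at hk
    have := eq_neg_iff_ht.1 h.symm
    omega
  · intro k hk
    rw [mem_mid, Ne, ← ht_eq_zero, ht_neg] at hk ⊢
    rw [ht_neg]
    omega
  · intro k _
    exact neg_neg k

/-- The effect on row `a` of `tailMat` of the factor for the odd root `ε_a` at position `p`. -/
theorem tailMat_row_odd (hq : q ≠ 0) (hL : IsNormalOrdering n L) {a : VIdx n} (ha : 0 < ht a)
    (hp : pos L a 0 = p) (j : VIdx n) :
    tailMat L q p a j
      = tailMat L q (p + 1) a j + (q - q⁻¹) * tau L q a 0 * tailMat L q (p + 1) 0 j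
        + (q - q⁻¹) * (q + 1) * tailMat L q (p + 1) (-a) j := by
  have h0 : ht (0 : VIdx n) = 0 := ht_zero
  have hna : ht (-a) = -ht a := ht_neg a
  have ha0 : a ≠ 0 := by rintro rfl; omega
  have hna0 : -a ≠ 0 := by rw [Ne, ← ht_eq_zero]; omega
  have hsa : sg a = 1 := by simp [sg, ha0]
  have hs0 : sg (0 : VIdx n) = -1 := by simp [sg]
  have h0a : (0 : VIdx n) ≠ -a := hna0.symm
  have hua : ∀ k : VIdx n, k ≠ 0 → k ≠ -a → pos L a k ≠ p := by
    intro k hk hka h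
    rw [← hp] at h
    rcases pos_eq_pos hL (by omega) h0a hka h.symm with h1 | h1
    · exact hk h1.2
    · exact ha0 h1.1
  have hpn : pos L a (-a) = p := by rw [pos_neg_right, ← pos_zero_right, hp]
  have hp0 : pos L 0 (-a) = p := by
    rw [← hp, ← pos_dual a 0]; rfl
  have hτ : tau L q a 0 = -∏ k ∈ mid a 0, tailFactor L q p a k := by
    rw [tau, hsa, hs0, one_mul, neg_one_mul]
    congr 1
    refine Finset.prod_congr rfl fun k _ => ?_
    rw [tailFactor, hp]
    by_cases h : pos L a k < p
    · rw [if_pos h, if_neg (by omega)]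
    · rw [if_neg h, if_pos (by omega)]
  rcases lt_or_ge 0 (ht j) with hj | hj
  · rw [tailMat_of_lt (a := 0) (by omega), tailMat_of_lt (a := -a) (by omega), mul_zero, mul_zero,
      add_zero, add_zero]
    refine tailMat_row_eq fun k h1 h2 => hua k ?_ ?_
    · rintro rfl; omega
    · rintro rfl; omega
  rcases eq_or_lt_of_le hj with hj | hj
  · obtain rfl : j = 0 := ht_eq_zero.1 hj
    rw [tailMat_of_le (by omega) hp.ge (by omega), tailMat_of_pos_lt ha0 (by omega), tailMat_self,
      tailMat_of_lt (a := -a) (by omega), hτ, if_neg h0a, hsa, hs0]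
    ring
  have hj0 : j ≠ 0 := by rintro rfl; omega
  have haj : a ≠ j := by rintro rfl; omega
  have e1 : ∀ i : VIdx n, -ht a ≤ ht i → ∏ k ∈ mid a i, tailFactor L q (p + 1) a k
      = ∏ k ∈ mid a i, tailFactor L q p a k := by
    intro i hi
    refine Finset.prod_congr rfl fun k hk => ?_
    rw [mem_mid] at hk
    have := hua k hk.2.2 (by rintro rfl; omega)
    rw [tailFactor, tailFactor]
    exact if_congr (by omega) rfl rfl
  have e2 : ∀ i : VIdx n, -ht a ≤ ht i → ∏ k ∈ mid 0 i, tailFactor L q (p + 1) 0 k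
      = ∏ k ∈ mid 0 i, tailFactor L q p a k := by
    intro i hi
    refine Finset.prod_congr rfl fun k hk => ?_
    rw [mem_mid] at hk
    have hk1 : k ≠ -a := by rintro rfl; omega
    have := hL.conv (a := a) (b := 0) (c := k) (by omega) hk.1 (fun _ => hk1)
    rw [tailFactor, tailFactor]
    exact if_congr (by omega) rfl rfl
  rcases lt_trichotomy (ht j) (-ht a) with hja | hja | hja
  · -- `j` lies below `-a`
    have hjna : -a ≠ j := by rintro rfl; omega
    have hja' : j ≠ -a := hjna.symm
    have hju := hua j hj0 hja'
    have c1 := hL.conv (a := a) (b := 0) (c := j) (by omega) (by omega) (fun _ => hja')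
    have c2 := hL.conv (a := a) (b := -a) (c := j) (by omega) (by omega) (fun h => absurd h hna0)
    rw [hp] at c1
    rw [hpn] at c2
    have hj0' : (0 : VIdx n) ≠ j := hj0.symm
    by_cases hlt : pos L a j < p
    · rw [tailMat_of_pos_lt haj hlt, tailMat_of_pos_lt haj (by omega),
        tailMat_of_pos_lt hj0' (by omega), tailMat_of_pos_lt hjna (by omega)]
      ring
    have hB1 : ∏ k ∈ mid (-a) j, tailFactor L q (p + 1) a k
        = ∏ k ∈ mid (-a) j, tailFactor L q p a k := by
      refine Finset.prod_congr rfl fun k hk => ?_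
      rw [mem_mid] at hk
      have := hua k hk.2.2 (by rintro rfl; omega)
      rw [tailFactor, tailFactor]
      exact if_congr (by omega) rfl rfl
    have hB2 : ∏ k ∈ mid (-a) j, tailFactor L q (p + 1) (-a) k
        = ∏ k ∈ mid (-a) j, tailFactor L q p a k := by
      refine Finset.prod_congr rfl fun k hk => ?_
      rw [mem_mid] at hk
      have := hL.conv (a := a) (b := -a) (c := k) (by omega) hk.1 (fun h => absurd h hna0)
      rw [tailFactor, tailFactor]
      exact if_congr (by omega) rfl rfl
    have hB3 : ∏ k ∈ mid (-a) j, tailFactor L q (p + 1) 0 k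
        = ∏ k ∈ mid (-a) j, tailFactor L q p a k := by
      refine Finset.prod_congr rfl fun k hk => ?_
      rw [mem_mid] at hk
      have hk1 : k ≠ -a := by rintro rfl; omega
      have := hL.conv (a := a) (b := 0) (c := k) (by omega) (by omega) (fun _ => hk1)
      rw [tailFactor, tailFactor]
      exact if_congr (by omega) rfl rfl
    have hone := prod_tailFactor_symm (q := q) (m := a) (a := a) hq hL le_rfl hp
    have hone' := hone
    rw [prod_mid_split (a := a) (k := 0) (b := -a) (by omega) (by omega), if_pos rfl, mul_one] at hone'
    have f1 : tailFactor L q p a (-a) = -q⁻¹ := by rw [tailFactor, if_pos (by omega)]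
    have f2 : tailFactor L q (p + 1) a (-a) = -q := by rw [tailFactor, if_neg (by omega)]
    have f3 : tailFactor L q (p + 1) 0 (-a) = -q := by rw [tailFactor, if_neg (by omega)]
    have hj0n : j ≠ -0 := hj0
    have hjaa : j ≠ - -a := by rw [neg_neg]; exact haj.symm
    rw [tailMat_of_le (by omega) (by omega) (by omega),
      tailMat_of_le (by omega) (by omega) (by omega),
      tailMat_of_le (by omega) (by omega) (by omega),
      tailMat_of_le (by omega) (by omega) (by omega), if_neg hja', if_neg hj0n, if_neg hjaa,
      hB2, prod_mid_split (a := a) (k := -a) (b := j) (by omega) (by omega),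
      prod_mid_split (a := a) (k := -a) (b := j) (by omega) (by omega),
      prod_mid_split (a := 0) (k := -a) (b := j) (by omega) (by omega), if_neg hna0, if_neg hna0,
      if_neg hna0, hB1, hB3, f1, f2, f3, e1 _ (by omega), e2 _ (by omega), hone, hτ, hs0, sg_neg,
      hsa]
    linear_combination ((q - q⁻¹) ^ 2 * sg j * q * ∏ k ∈ mid (-a) j, tailFactor L q p a k) * hone'
  · obtain rfl : j = -a := by rw [eq_neg_iff_ht]; omega
    rw [tailMat_of_le (by omega) (by omega) (by omega), tailMat_of_pos_lt haj (by omega),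
      tailMat_of_pos_lt h0a (by omega), tailMat_self, if_pos rfl,
      prod_tailFactor_symm hq hL le_rfl hp, sg_neg, hsa]
    ring
  · -- `j` lies between `0` and `-a`
    have hja' : j ≠ -a := by rw [Ne, eq_neg_iff_ht]; omega
    have hju := hua j hj0 hja'
    have hj0' : (0 : VIdx n) ≠ j := hj0.symm
    have c1 := hL.conv (a := a) (b := 0) (c := j) (by omega) (by omega) (fun _ => hja')
    rw [hp] at c1
    rw [tailMat_of_lt (a := -a) (by omega), mul_zero, add_zero]
    by_cases hlt : pos L a j < p
    · rw [tailMat_of_pos_lt haj hlt, tailMat_of_pos_lt haj (by omega),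
        tailMat_of_pos_lt hj0' (by omega)]
      ring
    have hnj : ht (-j) = -ht j := ht_neg j
    have hr := hL.rank_two (a := a) (b := -j) (by omega) (by omega)
    rw [neg_neg] at hr
    have hone := prod_tailFactor_symm (q := q) (m := -j) hq hL (a := a) (by omega) hp
    rw [neg_neg] at hone
    have hnj0 : -j ≠ 0 := by rw [Ne, ← ht_eq_zero]; omega
    have f1 : tailFactor L q p a (-j) = -q := by rw [tailFactor, if_neg (by omega)]
    have hs := prod_mid_split (a := a) (k := -j) (b := j) (by omega) (by omega)
      (tailFactor L q p a)
    rw [if_neg hnj0, f1, hone, mul_one] at hs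
    have hs' := hs
    rw [prod_mid_split (a := a) (k := 0) (b := j) (by omega) (by omega), if_pos rfl, mul_one] at hs'
    have hj0n : j ≠ -0 := hj0
    rw [tailMat_exceptional ha hj (by omega) (by omega) (by omega) (by omega),
      tailMat_of_le (by omega) (by omega) (by omega),
      tailMat_of_le (by omega) (by omega) (by omega), if_neg hja', if_neg hj0n,
      e1 _ (by omega), e2 _ (by omega), hs, hτ, hs0, hsa]
    linear_combination (-(q - q⁻¹) ^ 2 * sg j) * hs'

end

/-- The swap coefficients of the product of the factors of the quasi `R`-matrix at the positions
`≥ p`. -/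
def tailSwap {n : ℕ} (L : List (Fin n → ℤ)) (q : ℂ) (p : ℕ) (x y : VIdx n) : ℂ :=
  if ht y < ht x ∧ y ≠ -x ∧ p ≤ L.idxOf (wt x y) then (q - q⁻¹) * (sg x * sg y) else 0

section
variable {n : ℕ} {q : ℂ} {E F : (Fin n → ℤ) → EndV n} {L : List (Fin n → ℤ)}

theorem HasRatio.unique {a b : VIdx n} (hab : ht b < ht a) (hba : ht b ≠ -ht a) {t u : ℂ}
    (h1 : HasRatio E F a b t) (h2 : HasRatio E F a b u) : t = u := by
  obtain ⟨x, x', y, y', hx', -, -, hE, -, -, hx⟩ := h1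
  obtain ⟨v, v', w, w', hv', -, -, hE2, -, -, hv⟩ := h2
  have hne : ¬ (-b = a ∧ -a = b) := by
    rintro ⟨rfl, -⟩
    rw [ht_neg] at hba
    omega
  have hne' : ¬ (a = -b ∧ b = -a) := fun h => hne ⟨h.1.symm, h.2.symm⟩
  rw [hE] at hE2
  have e1 := congrFun (congrFun hE2 a) b
  have e2 := congrFun (congrFun hE2 (-b)) (-a)
  simp only [Matrix.add_apply, Matrix.single, Matrix.of_apply, if_neg hne, if_neg hne', and_self,
    if_true, add_zero, zero_add] at e1 e2
  rw [hx, hv, e2] at e1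
  exact mul_right_cancel₀ hv' e1

theorem rootBlock_mul_apply (a b : VIdx n) (M : EndV n) (c j : VIdx n) :
    (rootBlock L q a b * M) c j = M c j
      + (if c = a then (q - q⁻¹) * tau L q a b * M b j else 0)
      + (if c = -b then (q - q⁻¹) * (tau L q a b)⁻¹ * M (-a) j else 0)
      + (if b = 0 ∧ c = a then (q - q⁻¹) * (q + 1) * M (-a) j else 0) := by
  have key : ∀ (x y : VIdx n) (u : ℂ),
      (Matrix.single x y u * M) c j = if c = x then u * M y j else 0 := by
    intro x y u
    split_ifs with h
    · subst h
      rw [Matrix.single_mul_apply_same]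
    · rw [Matrix.single_mul_apply_of_ne (h := h)]
  rw [rootBlock, add_mul, add_mul, add_mul, one_mul, Matrix.add_apply, Matrix.add_apply,
    Matrix.add_apply, key, key]
  congr 1
  by_cases hb : b = 0
  · rw [if_pos hb, key]
    exact if_congr (by simp [hb]) rfl rfl
  · rw [if_neg hb, zero_mul, Matrix.zero_apply, if_neg (fun h => hb h.1)]

/-- The product of the factors of the quasi `R`-matrix at the positions `≥ p`, by descending induction
on `p`: each new factor changes at most two rows of `tailMat`, those of the labels `a` and `-b` when
the root at position `p` is `ε_a - ε_b`. -/
theorem tail_prod (hq : q ≠ 0) (hq2 : q ^ 2 ≠ 1) (hL : IsNormalOrdering n L)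
    (hEF : IsRootVectors n q L E F) (d : ℕ) (hd : d ≤ L.length) :
    ((L.drop (L.length - d)).map (rTildeRoot n q E F)).prod
      = block (tailMat L q (L.length - d)) (tailSwap L q (L.length - d)) := by
  have hlen : ∀ γ ∈ reducedRoots n, L.idxOf γ < L.length := fun γ hγ =>
    List.idxOf_lt_length_of_mem ((hL.mem_iff γ).2 hγ)
  induction d with
  | zero =>
    have h1 : tailMat L q (L.length - 0) = 1 := by
      ext a j
      rw [Matrix.one_apply]
      by_cases h : a = j
      · rw [if_pos h, h, tailMat_self]
      · rw [if_neg h]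
        rcases lt_or_ge (ht a) (ht j) with h2 | h2
        · exact tailMat_of_lt h2
        · refine tailMat_of_pos_lt h ?_
          have h3 : ht j < ht a := lt_of_le_of_ne h2 fun h' => h (ht_inj.1 h').symm
          rw [tsub_zero]
          by_cases h4 : j = -a
          · subst h4
            rw [pos_neg_right]
            refine hlen _ (eps_mem ?_)
            rw [ht_neg] at h3; omega
          · rw [pos_of_ne h4]
            exact hlen _ (wt_mem h3 h4)
    have h2 : tailSwap L q (L.length - 0) = fun _ _ => 0 := by
      funext x y
      rw [tailSwap, if_neg]
      rintro ⟨h1, h2, h3⟩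
      have := hlen _ (wt_mem h1 h2)
      omega
    rw [h1, h2, block_one, tsub_zero, List.drop_length, List.map_nil, List.prod_nil]
  | succ d ih =>
    have hp1 : L.length - (d + 1) + 1 = L.length - d := by omega
    have hp2 : L.length - (d + 1) < L.length := by omega
    have ih' := ih (by omega)
    rw [← hp1] at ih'
    generalize L.length - (d + 1) = p at ih' hp2
    rw [List.drop_eq_getElem_cons hp2, List.map_cons, List.prod_cons, ih']
    have hmem : L[p] ∈ reducedRoots n := (hL.mem_iff _).1 (List.getElem_mem _)
    have hidx : L.idxOf L[p] = p := hL.nodup.idxOf_getElem p hp2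
    obtain ⟨a, b, hab, hba, ha, hγ⟩ : ∃ a b : VIdx n, ht b < ht a ∧ ht b ≠ -ht a ∧ a ≠ 0 ∧
        L[p] = wt a b := by
      obtain ⟨a, b, h1, h2, h3⟩ := mem_reducedRoots_iff.1 hmem
      rw [Ne, eq_neg_iff_ht] at h2
      -- an expression `ε_0 - ε_b` with first label `0` is replaced by `ε_{-b} - ε_0`
      by_cases ha : a = 0
      · refine ⟨-b, -a, ?_, ?_, ?_, ?_⟩
        · rw [ht_neg, ht_neg]; omega
        · rw [ht_neg, ht_neg]; omega
        · rw [ha, ht_zero] at h1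
          rw [Ne, ← ht_eq_zero, ht_neg]; omega
        · rw [h3, wt_neg_neg]
      · exact ⟨a, b, h1, h2, ha, h3⟩
    have hba' : b ≠ -a := by rwa [Ne, eq_neg_iff_ht]
    have hp : pos L a b = p := by rw [pos_of_ne hba', ← hγ, hidx]
    have hpd : pos L (-b) (-a) = p := by rw [pos_dual, hp]
    have hab' : ht (-a) < ht (-b) := by rw [ht_neg, ht_neg]; omega
    have hba2 : ht (-a) ≠ -ht (-b) := by rw [ht_neg, ht_neg]; omega
    have hna : -a ≠ 0 := by
      rw [Ne, ← ht_eq_zero, ht_neg, neg_eq_zero, ht_eq_zero]; exact ha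
    have hτ : (tau L q a b)⁻¹ = tau L q (-b) (-a) :=
      HasRatio.unique hab' hba2 ((hasRatio_tau hq hL hEF a b hab hba).dual (tau_ne_zero L hq a b))
        (hasRatio_tau hq hL hEF (-b) (-a) hab' hba2)
    rw [hγ, rTildeRoot_eq_block hq hq2 hL hEF hab hba ha, block_mul_block]
    · congr 1
      · ext c j
        rw [rootBlock_mul_apply]
        have hca_ne : c = a → c ≠ -b := fun h h' => hba' (by rw [← h, h', neg_neg])
        by_cases hb : b = 0
        · have ha0 : 0 < ht a := by rw [hb, ht_zero] at hab; exact hab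
          by_cases hca : c = a
          · have h1 : c ≠ -b := hca_ne hca
            have h2 : b = 0 ∧ c = a := ⟨hb, hca⟩
            rw [if_pos hca, if_neg h1, if_pos h2, add_zero, hca, hb]
            rw [hb] at hp
            exact (tailMat_row_odd hq hL ha0 hp j).symm
          · have h2 : ¬ (b = 0 ∧ c = a) := fun h => hca h.2
            rw [if_neg hca, if_neg h2, add_zero, add_zero]
            by_cases hc0 : c = -b
            · rw [if_pos hc0, hc0, hτ, tailMat_row hL hab' hba2 hna hpd]
            · rw [if_neg hc0, add_zero]
              refine (tailMat_row_eq fun k _ hk h => ?_).symm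
              rw [← hp] at h
              rcases pos_eq_row hL hab hba h with h1 | h1
              · exact hca h1
              · exact hc0 h1
        · have h2 : ¬ (b = 0 ∧ c = a) := fun h => hb h.1
          rw [if_neg h2, add_zero]
          by_cases hca : c = a
          · have h1 : c ≠ -b := hca_ne hca
            rw [if_pos hca, if_neg h1, add_zero, hca, tailMat_row hL hab hba hb hp]
          · rw [if_neg hca, add_zero]
            by_cases hcb : c = -b
            · rw [if_pos hcb, hcb, hτ, tailMat_row hL hab' hba2 hna hpd]
            · rw [if_neg hcb, add_zero]
              refine (tailMat_row_eq fun k _ hk h => ?_).symm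
              rw [← hp] at h
              rcases pos_eq_row hL hab hba h with h1 | h1
              · exact hca h1
              · exact hcb h1
      · funext x y
        rw [rootSwap, tailSwap, tailSwap]
        by_cases hxy : ht y < ht x ∧ y ≠ -x
        · have hw := wt_mem hxy.1 hxy.2
          have hiff : wt x y = wt a b ↔ L.idxOf (wt x y) = p := by
            constructor
            · intro h; rw [h, ← hγ, hidx]
            · intro h
              refine idxOf_inj_of_mem hL hw ?_
              rw [h, ← hγ, hidx]
          by_cases h1 : L.idxOf (wt x y) = p
          · rw [if_pos ⟨hxy.1, hiff.2 h1⟩, if_neg (by omega), if_pos ⟨hxy.1, hxy.2, h1.ge⟩, add_zero]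
          · have hn1 : ¬ (ht y < ht x ∧ wt x y = wt a b) := fun h => h1 (hiff.1 h.2)
            rw [if_neg hn1, zero_add]
            refine if_congr ?_ rfl rfl
            rw [and_congr_right_iff]
            intro _
            rw [and_congr_right_iff]
            intro _
            omega
        · have hn : ∀ m, ¬ (ht y < ht x ∧ y ≠ -x ∧ m ≤ L.idxOf (wt x y)) :=
            fun m h => hxy ⟨h.1, h.2.1⟩
          rw [if_neg (hn _), if_neg (hn _), if_neg, zero_add]
          rintro ⟨h1, h2⟩
          have h3 : a ≠ b := fun e => by rw [e] at hab; omega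
          have h4 : y = -x := by
            by_contra h
            exact hxy ⟨h1, h⟩
          rcases wt_eq_wt h2.symm h3 hba' with ⟨rfl, rfl⟩ | ⟨rfl, rfl⟩
          · exact hba' h4
          · rw [neg_neg] at h4
            exact hba' h4.symm
    · intro x y
      rw [rootSwap, tailSwap]
      by_cases h : ht y < ht x
      · rw [if_neg (show ¬ (ht x < ht y ∧ _) by omega), mul_zero]
      · rw [if_neg (show ¬ (ht y < ht x ∧ _) from fun h' => h h'.1), zero_mul]

theorem rTilde_eq_block (hq : q ≠ 0) (hq2 : q ^ 2 ≠ 1) (hL : IsNormalOrdering n L)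
    (hEF : IsRootVectors n q L E F) :
    rTilde n q L E F = block (tailMat L q 0) (tailSwap L q 0) := by
  have := tail_prod hq hq2 hL hEF L.length le_rfl
  rwa [tsub_self, List.drop_zero] at this

end

/-! ### The braiding in closed form -/

/-- The coefficients of the invariant vector `∑ A_a v_{-a} ⊗ v_a`; their inverses are those of the
invariant form on `V`. -/
def cupCoef {n : ℕ} (q : ℂ) (a : VIdx n) : ℂ :=
  sg a * (-q) ^ (-(if 0 ≤ ht a then ht a - 1 else ht a))

/-- The rank one operator `v_b ⊗ v_{-b} ↦ A_b⁻¹ ∑ A_a v_{-a} ⊗ v_a`. -/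
def cupCap {n : ℕ} (q : ℂ) : EndVV n := fun x y =>
  if x.2 = -x.1 ∧ y.2 = -y.1 then cupCoef q x.2 / cupCoef q y.1 else 0

/-- The weighted permutation `v_a ⊗ v_b ↦ -(-1)^{[a][b]} q^{(ε_a, ε_b)} v_b ⊗ v_a`. -/
def wtPerm {n : ℕ} (q : ℂ) : EndVV n := fun x y =>
  if x = (y.2, y.1) then
    -((-1) ^ (parity y.1 * parity y.2) * q ^ (eps n y.1 ⬝ᵥ eps n y.2)) else 0

/-- The operator `g = -Ř` on `V ⊗ V` in closed form. -/
def gMat {n : ℕ} (q : ℂ) : EndVV n := fun x y =>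
  wtPerm q x y + (q - q⁻¹) * ((if ht y.1 < ht y.2 ∧ x = y then 1 else 0)
    - if ht y.1 < ht x.2 then cupCap q x y else 0)

section
variable {n : ℕ} {q : ℂ} {E F : (Fin n → ℤ) → EndV n} {L : List (Fin n → ℤ)}

theorem cupCoef_ne_zero (hq : q ≠ 0) (a : VIdx n) : cupCoef q a ≠ 0 :=
  mul_ne_zero (sg_ne_zero a) (zpow_ne_zero _ (neg_ne_zero.2 hq))

theorem card_mid {a j : VIdx n} (h : ht j < ht a) :
    ((mid a j).card : ℤ) = ht a - ht j - 1 - if ht j < 0 ∧ 0 < ht a then 1 else 0 := by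
  have h1 : (mid a j).card = ((Finset.Ioo (ht j) (ht a)).erase 0).card := by
    refine Finset.card_bij (fun k _ => ht k) ?_ ?_ ?_
    · intro k hk
      rw [mem_mid, Ne, ← ht_eq_zero] at hk
      rw [Finset.mem_erase, Finset.mem_Ioo]
      exact ⟨hk.2.2, hk.2.1, hk.1⟩
    · intro k _ l _ hkl
      exact ht_inj.1 hkl
    · intro m hm
      rw [Finset.mem_erase, Finset.mem_Ioo] at hm
      have b1 := ht_bounds a
      have b2 := ht_bounds j
      obtain ⟨k, hk⟩ := exists_ht_eq (n := n) m (by omega) (by omega)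
      refine ⟨k, ?_, hk⟩
      rw [mem_mid, Ne, ← ht_eq_zero]
      omega
  rw [h1]
  by_cases h0 : ht j < 0 ∧ 0 < ht a
  · rw [if_pos h0, Finset.card_erase_of_mem (Finset.mem_Ioo.2 h0), Int.card_Ioo]
    omega
  · rw [if_neg h0, Finset.erase_eq_of_notMem (by rw [Finset.mem_Ioo]; exact h0), Int.card_Ioo]
    omega

/-- The entries of `cupCap` in the form in which they appear in `tailMat`. -/
theorem cupCoef_div (hq : q ≠ 0) {a j : VIdx n} (h : ht j < ht a) :
    cupCoef q a / cupCoef q j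
      = -((if a = 0 then 1 else q⁻¹) * (sg j * ∏ _k ∈ mid a j, (-q⁻¹))) := by
  have hq' : -q ≠ 0 := neg_ne_zero.2 hq
  have hc := card_mid h
  have e1 : (-q⁻¹ : ℂ) = (-q) ^ (-1 : ℤ) := by rw [zpow_neg_one, inv_neg]
  have e2 : cupCoef q a / cupCoef q j = sg a * sg j *
      (-q) ^ ((if 0 ≤ ht j then ht j - 1 else ht j) - (if 0 ≤ ht a then ht a - 1 else ht a)) := by
    have : (sg j)⁻¹ = sg j := inv_eq_of_mul_eq_one_left (sg_mul_self j)
    rw [cupCoef, cupCoef, div_eq_mul_inv, mul_inv, this, ← zpow_neg, neg_neg]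
    rw [zpow_sub₀ hq', zpow_neg]
    ring
  rw [Finset.prod_const, e2, e1, ← zpow_natCast, ← zpow_mul, hc]
  have ha0 := ht_eq_zero (a := a)
  by_cases ha : a = 0
  · have hs : sg a = -1 := by simp [sg, ha]
    have e3 : (if 0 ≤ ht j then ht j - 1 else ht j) - (if 0 ≤ ht a then ht a - 1 else ht a)
        = -1 * (ht a - ht j - 1 - if ht j < 0 ∧ 0 < ht a then 1 else 0) := by
      have := ha0.2 ha
      split_ifs <;> omega
    rw [if_pos ha, hs, e3]
    ring
  · have hs : sg a = 1 := by simp [sg, ha]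
    have e3 : (if 0 ≤ ht j then ht j - 1 else ht j) - (if 0 ≤ ht a then ht a - 1 else ht a)
        = -1 + -1 * (ht a - ht j - 1 - if ht j < 0 ∧ 0 < ht a then 1 else 0) := by
      have : ht a ≠ 0 := fun h => ha (ha0.1 h)
      split_ifs <;> omega
    rw [if_neg ha, hs, e3, zpow_add₀ hq', zpow_neg_one, inv_neg]
    ring

/-- At `p = 0` all factors are present, and the matrix no longer depends on the normal ordering. -/
theorem tailMat_zero {a j : VIdx n} (h : ht j < ht a) :
    tailMat L q 0 a j = sg a * sg j * ((q - q⁻¹) * (∏ _k ∈ mid a j, (-q⁻¹)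
      + (if j = -a then q else 0))) := by
  rw [tailMat_of_le h (Nat.zero_le _) (by omega)]
  simp [tailFactor]

theorem parity_eq (a : VIdx n) : parity a = if a = 0 then 0 else 1 := by
  rw [parity]
  exact if_congr (by rw [VIdx.ext_iff', VIdx.coe_zero]) rfl rfl

/-- The braiding `-Ř` in closed form; it depends neither on the normal ordering nor on the choice of the
root vectors. -/
theorem neg_rCheck_eq_gMat (hq : q ≠ 0) (hq2 : q ^ 2 ≠ 1) (hL : IsNormalOrdering n L)
    (hEF : IsRootVectors n q L E F) : -rCheck n q L E F = gMat q := by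
  ext ⟨x1, x2⟩ ⟨y1, y2⟩
  have e1 : rCheck n q L E F (x1, x2) (y1, y2) = (-1) ^ (parity x2 * parity x1) *
      (q ^ (eps n x2 ⬝ᵥ eps n x1) * block (tailMat L q 0) (tailSwap L q 0) (x2, x1) (y1, y2)) := by
    rw [rCheck, Matrix.mul_apply, Finset.sum_eq_single (x2, x1)]
    · rw [gradedPerm, if_pos rfl, cartanPart, Matrix.diagonal_mul, rTilde_eq_block hq hq2 hL hEF]
    · intro w _ hw
      rw [gradedPerm, if_neg, zero_mul]
      intro h
      apply hw
      rw [Prod.ext_iff] at h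
      exact Prod.ext h.2.symm h.1.symm
    · simp
  rw [Matrix.neg_apply, e1, gMat]
  have hxn : ∀ a : VIdx n, a = -a ↔ a = 0 := fun a => by rw [eq_neg_iff_ht, ← ht_eq_zero]; omega
  by_cases hy : y2 = -y1
  · subst hy
    by_cases hx : x1 = -x2
    · -- both basis vectors have weight zero
      subst hx
      have hd : eps n x2 ⬝ᵥ eps n (-x2) = if x2 = 0 then 0 else -1 := by
        rw [← VIdx.coe_neg, eps_dot_eps]
        by_cases h : x2 = 0
        · simp [h]
        · rw [if_neg h, if_neg h, if_neg, if_pos (neg_neg x2).symm]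
          rw [hxn]; exact h
      have hb : block (tailMat L q 0) (tailSwap L q 0) (x2, -x2) (y1, -y1) = tailMat L q 0 x2 y1 := by
        simp [block, zeroWt, nonzeroWt, swapWt]
      have hc : cupCap q (-x2, x2) (y1, -y1) = cupCoef q x2 / cupCoef q y1 := by
        simp [cupCap]
      have hw : wtPerm q (-x2, x2) (y1, -y1) = if x2 = y1 then
          -((-1) ^ (parity x2 * parity (-x2)) * q ^ (if x2 = 0 then (0 : ℤ) else -1)) else 0 := by
        rw [wtPerm]
        by_cases h : x2 = y1
        · subst h
          rw [if_pos rfl, if_pos rfl, ← hd]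
          rfl
        · rw [if_neg h, if_neg]
          intro h'
          exact h (Prod.ext_iff.1 h').2
      rw [hb, hc, hw, VIdx.coe_neg, hd]
      dsimp only
      rcases lt_trichotomy (ht x2) (ht y1) with h | h | h
      · have h1 : x2 ≠ y1 := by rintro rfl; omega
        have h2 : ¬ (ht y1 < ht (-y1) ∧ ((-x2, x2) : VIdx n × VIdx n) = (y1, -y1)) := by
          rintro ⟨h3, h4⟩
          have h5 : x2 = -y1 := (Prod.ext_iff.1 h4).2
          rw [h5] at h
          omega
        rw [tailMat_of_lt h, if_neg h1, if_neg (show ¬ ht y1 < ht x2 by omega), if_neg h2]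
        ring
      · obtain rfl : x2 = y1 := ht_inj.1 h
        have h2 : ¬ (ht x2 < ht (-x2) ∧ ((-x2, x2) : VIdx n × VIdx n) = (x2, -x2)) := by
          rintro ⟨h3, h4⟩
          have := (Prod.ext_iff.1 h4).2
          simp only at this
          rw [← this] at h3
          omega
        rw [tailMat_self, if_pos rfl, if_neg (show ¬ ht x2 < ht x2 by omega), if_neg h2]
        ring
      · have h1 : x2 ≠ y1 := by rintro rfl; omega
        have h2 : (ht y1 < ht (-y1) ∧ ((-x2, x2) : VIdx n × VIdx n) = (y1, -y1)) ↔ y1 = -x2 := by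
          constructor
          · rintro ⟨-, h4⟩
            exact (Prod.ext_iff.1 h4).1.symm
          · rintro rfl
            rw [neg_neg]
            exact ⟨h, rfl⟩
        rw [tailMat_zero h, if_neg h1, if_pos h, if_congr h2 rfl rfl, cupCoef_div hq h]
        rw [parity_eq, parity_eq]
        by_cases hx2 : x2 = 0
        · have hs : sg x2 = -1 := by simp [sg, hx2]
          have h3 : y1 ≠ -x2 := by
            rintro rfl
            rw [hx2] at h
            exact absurd h (by simp)
          rw [hs, if_pos hx2, if_neg h3, if_neg h3, if_pos hx2, if_pos hx2]
          simp
          ring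
        · have hs : sg x2 = 1 := by simp [sg, hx2]
          have h5 : -x2 ≠ 0 := by
            rw [Ne, ← ht_eq_zero, ht_neg, neg_eq_zero, ht_eq_zero]; exact hx2
          rw [hs, if_neg hx2, if_neg h5, if_neg hx2, if_neg hx2, zpow_neg_one]
          by_cases h3 : y1 = -x2
          · have hs2 : sg y1 = 1 := by rw [h3, sg_neg, hs]
            rw [if_pos h3, if_pos h3, hs2]
            field_simp
            ring
          · rw [if_neg h3, if_neg h3]
            ring
    · -- the column has weight zero and the row has not
      have hx' : x2 ≠ -x1 := fun h => hx (by rw [h, neg_neg])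
      have hb : block (tailMat L q 0) (tailSwap L q 0) (x2, x1) (y1, -y1) = 0 := by
        simp [block, zeroWt, nonzeroWt, swapWt, hx]
      have hc : cupCap q (x1, x2) (y1, -y1) = 0 := by
        simp [cupCap, hx']
      have hw : wtPerm q (x1, x2) (y1, -y1) = 0 := by
        rw [wtPerm, if_neg]
        intro h
        have h1 := (Prod.ext_iff.1 h).1
        have h2 := (Prod.ext_iff.1 h).2
        simp only at h1 h2
        exact hx (by rw [h1, h2])
      have h2 : ¬ (ht y1 < ht (-y1) ∧ ((x1, x2) : VIdx n × VIdx n) = (y1, -y1)) := by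
        rintro ⟨-, h⟩
        have h1 := (Prod.ext_iff.1 h).1
        have h2 := (Prod.ext_iff.1 h).2
        simp only at h1 h2
        exact hx' (by rw [h1, h2])
      rw [hb, hc, hw, if_neg h2]
      simp
  · -- the column has non-zero weight
    have hc : cupCap q (x1, x2) (y1, y2) = 0 := by
      simp [cupCap, hy]
    have hyn : y1 ≠ -y2 := fun h => hy (by rw [h, neg_neg])
    have hb : block (tailMat L q 0) (tailSwap L q 0) (x2, x1) (y1, y2)
        = (if x2 = y1 ∧ x1 = y2 then 1 else 0)
          + if x2 = y2 ∧ x1 = y1 then tailSwap L q 0 x2 x1 else 0 := by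
      simp [block, zeroWt, nonzeroWt, swapWt, hy]
    rw [hb, hc, ite_self, sub_zero, wtPerm]
    by_cases h1 : x2 = y1 ∧ x1 = y2
    · obtain ⟨rfl, rfl⟩ := h1
      rw [if_pos ⟨rfl, rfl⟩, if_pos rfl]
      by_cases h2 : x2 = x1
      · subst h2
        have h3 : ¬ (ht x2 < ht x2 ∧ ((x2, x2) : VIdx n × VIdx n) = (x2, x2)) := by omega
        rw [if_pos ⟨rfl, rfl⟩, tailSwap, if_neg (by omega), if_neg h3]
        ring
      · rw [if_neg (fun h => h2 h.1), if_neg (fun h => h2 (Prod.ext_iff.1 h.2).2)]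
        ring
    · have h1' : ¬ ((x1, x2) : VIdx n × VIdx n) = (y2, y1) := by
        intro h
        exact h1 ⟨(Prod.ext_iff.1 h).2, (Prod.ext_iff.1 h).1⟩
      rw [if_neg h1, if_neg h1']
      by_cases h2 : x2 = y2 ∧ x1 = y1
      · obtain ⟨rfl, rfl⟩ := h2
        rw [if_pos ⟨rfl, rfl⟩, tailSwap]
        by_cases h3 : ht x1 < ht x2
        · have h4 : x2 ≠ x1 := by rintro rfl; omega
          rw [if_pos ⟨h3, hyn, Nat.zero_le _⟩, if_pos ⟨h3, rfl⟩, eps_dot_eps]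
          rw [parity_eq, parity_eq, if_neg h4, if_neg hy, ite_self]
          by_cases h5 : x2 = 0
          · have h6 : x1 ≠ 0 := fun h => h4 (h5.trans h.symm)
            simp [h5, h6, sg]
          · by_cases h6 : x1 = 0
            · simp [h5, h6, sg]
            · simp [h5, h6, sg]
        · rw [if_neg (fun h => h3 h.1), if_neg (fun h => h3 h.1)]
          ring
      · rw [if_neg h2, if_neg]
        · ring
        · rintro ⟨-, h⟩
          exact h2 ⟨(Prod.ext_iff.1 h).2, (Prod.ext_iff.1 h).1⟩

end

/-! ### Vectors in `V ⊗ V` -/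

/-- The basis vector `v_a ⊗ v_b`. -/
def ket {n : ℕ} (a b : VIdx n) : VIdx n × VIdx n → ℂ := Pi.single (a, b) 1

/-- The truncation `∑ A_j v_{-j} ⊗ v_j`, over the labels `j` of height above `h`, of the invariant
vector. -/
def cupVec {n : ℕ} (q : ℂ) (h : ℤ) : VIdx n × VIdx n → ℂ :=
  ∑ j : VIdx n, (if h < ht j then cupCoef q j else 0) • ket (-j) j

/-- The scalar by which the weighted permutation takes `v_a ⊗ v_b` to `v_b ⊗ v_a`. -/
def swapCoef {n : ℕ} (q : ℂ) (a b : VIdx n) : ℂ :=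
  -((-1) ^ (parity a * parity b) * q ^ (eps n a ⬝ᵥ eps n b))

section
variable {n : ℕ} {q : ℂ}

theorem VIdx.neg_eq_zero' {a : VIdx n} : -a = 0 ↔ a = 0 := by
  rw [← ht_eq_zero, ht_neg, _root_.neg_eq_zero, ht_eq_zero]

theorem VIdx.eq_neg_self {a : VIdx n} : a = -a ↔ a = 0 := by
  rw [eq_neg_iff_ht, ← ht_eq_zero]; omega

theorem ket_apply (a b : VIdx n) (x : VIdx n × VIdx n) :
    ket a b x = if x.1 = a ∧ x.2 = b then 1 else 0 := by
  rw [ket, Pi.single_apply]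
  exact if_congr Prod.ext_iff rfl rfl

theorem mulVec_ket (M : EndVV n) (a b : VIdx n) (x : VIdx n × VIdx n) :
    (M.mulVec (ket a b)) x = M x (a, b) := by
  rw [ket, Matrix.mulVec_single_one]; rfl

theorem ext_ket {M N : EndVV n} (h : ∀ a b, M.mulVec (ket a b) = N.mulVec (ket a b)) : M = N :=
  Matrix.ext_of_mulVec_single fun i => h i.1 i.2

theorem cupVec_apply (h : ℤ) (x : VIdx n × VIdx n) :
    cupVec q h x = if x.1 = -x.2 ∧ h < ht x.2 then cupCoef q x.2 else 0 := by
  rw [cupVec, Finset.sum_apply, Finset.sum_eq_single x.2]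
  · rw [Pi.smul_apply, ket_apply, smul_eq_mul]
    by_cases h1 : x.1 = -x.2 <;> simp [h1]
  · intro j _ hj
    have h1 : ¬ (x.1 = -j ∧ x.2 = j) := fun h' => hj h'.2.symm
    rw [Pi.smul_apply, ket_apply, if_neg h1, smul_zero]
  · simp

theorem swapCoef_eq (a b : VIdx n) : swapCoef q a b =
    if a = 0 ∨ b = 0 then -1 else if a = b then q else if a = -b then q⁻¹ else 1 := by
  rw [swapCoef, eps_dot_eps, parity_eq, parity_eq]
  by_cases ha : a = 0
  · simp [ha]
  by_cases hb : b = 0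
  · have : a ≠ -b := by rw [hb]; exact ha
    subst hb
    simp [ha]
  have hab : ¬ (a = 0 ∨ b = 0) := by tauto
  rw [if_neg ha, if_neg ha, if_neg hb, if_neg hab]
  by_cases h1 : a = b
  · rw [if_pos h1, if_pos h1]; simp
  rw [if_neg h1, if_neg h1]
  by_cases h2 : a = -b
  · rw [if_pos h2, if_pos h2]; simp
  · rw [if_neg h2, if_neg h2]; simp

theorem gMat_mulVec_ket (a b : VIdx n) : (gMat q).mulVec (ket a b) =
    swapCoef q a b • ket b a + (if ht a < ht b then q - q⁻¹ else 0) • ket a b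
      - (if b = -a then (q - q⁻¹) / cupCoef q a else 0) • cupVec q (ht a) := by
  ext x
  have h1 : wtPerm q x (a, b) = swapCoef q a b * ket b a x := by
    rw [wtPerm, ket_apply, if_congr Prod.ext_iff rfl rfl, mul_ite, mul_one, mul_zero]
    rfl
  have h2 : (if ht a < ht b ∧ x = (a, b) then 1 else 0) = (if ht a < ht b then 1 else 0) * ket a b x := by
    rw [ket_apply, if_congr (and_congr_right' Prod.ext_iff) rfl rfl, ite_and, ite_mul, one_mul,
      zero_mul]
  have h3 : (if ht a < ht x.2 then cupCap q x (a, b) else 0)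
      = (if b = -a then 1 / cupCoef q a else 0) * cupVec q (ht a) x := by
    have h : x.2 = -x.1 ↔ x.1 = -x.2 := ⟨fun h => by rw [h, neg_neg], fun h => by rw [h, neg_neg]⟩
    rw [cupCap, cupVec_apply, if_congr (and_congr_left' h) rfl rfl]
    split_ifs <;> first | (exfalso; tauto) | ring
  rw [mulVec_ket, gMat, h1, h3]
  simp only [Pi.add_apply, Pi.sub_apply, Pi.smul_apply, smul_eq_mul]
  rw [h2]
  split_ifs <;> ring

theorem cupCap_mulVec_ket (a b : VIdx n) : (cupCap q).mulVec (ket a b) =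
    (if b = -a then (cupCoef q a)⁻¹ else 0) • cupVec q (-(n + 1 : ℤ)) := by
  ext x
  simp only [mulVec_ket, cupCap, Pi.smul_apply, cupVec_apply, smul_eq_mul]
  have h1 : x.2 = -x.1 ↔ x.1 = -x.2 := ⟨fun h => by rw [h, neg_neg], fun h => by rw [h, neg_neg]⟩
  have h2 : -(n + 1 : ℤ) < ht x.2 := by have := ht_bounds x.2; omega
  rw [if_congr (and_congr_left' h1) rfl rfl]
  split_ifs <;> first | (exfalso; tauto) | ring

/-! ### Intertwining operators -/

/-- The action of a simple root vector on `V`, up to a scalar; `c` and `d` are labels of adjacent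
heights, and the vectors `v_d`, `v_{-c}` are raised to `v_c`, `v_{-d}`. -/
def raise {n : ℕ} (c d : VIdx n) : EndV n :=
  Matrix.single c d 1 + Matrix.single (-d) (-c) (sg c * sg d)

/-- The eigenvalues of `K_α` on `V`, for `α = ε_c - ε_d`. -/
def raiseK {n : ℕ} (q : ℂ) (c d : VIdx n) (a : VIdx n) : ℂ := q ^ (wt c d ⬝ᵥ eps n a)

/-- The sign that the root vector `raise c d` picks up when it passes `v_a`. -/
def raiseSign {n : ℕ} (c d : VIdx n) (a : VIdx n) : ℂ :=
  if c = 0 ∨ d = 0 then (-1) ^ parity a else 1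

open scoped Kronecker in
/-- The operator `e ⊗ k + s ⊗ f` on `W ⊗ V`, with `k` and `s` diagonal: the shape of the coproduct of
a simple root vector. -/
def coprod {n : ℕ} {I : Type*} [DecidableEq I] (e : Matrix I I ℂ) (s : I → ℂ) (k : VIdx n → ℂ)
    (f : EndV n) : Matrix (I × VIdx n) (I × VIdx n) ℂ :=
  e ⊗ₖ Matrix.diagonal k + Matrix.diagonal s ⊗ₖ f

/-- The action of the simple root vector `raise c d` on `V ⊗ V`. -/
def raiseVV {n : ℕ} (q : ℂ) (c d : VIdx n) : EndVV n :=
  coprod (raise c d) (raiseSign c d) (raiseK q c d) (raise c d)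

theorem raiseK_mul_neg (hq : q ≠ 0) (c d a : VIdx n) : raiseK q c d a * raiseK q c d (-a) = 1 := by
  rw [raiseK, raiseK, VIdx.coe_neg, eps_neg, dotProduct_neg, zpow_neg,
    mul_inv_cancel₀ (zpow_ne_zero _ hq)]

theorem raiseSign_mul_neg (c d a : VIdx n) : raiseSign c d a * raiseSign c d (-a) = 1 := by
  rw [raiseSign, raiseSign, parity_eq, parity_eq, if_congr VIdx.neg_eq_zero' rfl rfl]
  split_ifs <;> norm_num

open scoped Kronecker in
theorem single_kronecker_mulVec_ket (c d : VIdx n) (u : ℂ) (k : VIdx n → ℂ) (a b : VIdx n) :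
    (Matrix.single c d u ⊗ₖ Matrix.diagonal k).mulVec (ket a b)
      = (if a = d then u * k b else 0) • ket c b := by
  ext x
  rw [mulVec_ket, Matrix.kroneckerMap_apply, Matrix.diagonal_apply, Matrix.single_apply,
    Pi.smul_apply, ket_apply, smul_eq_mul]
  have e1 : (if x.2 = b then k x.2 else 0) = if x.2 = b then k b else 0 :=
    ite_congr rfl (fun h => by rw [h]) fun _ => rfl
  rw [e1]
  split_ifs <;> first | (exfalso; tauto) | ring

open scoped Kronecker in
theorem kronecker_single_mulVec_ket (c d : VIdx n) (u : ℂ) (s : VIdx n → ℂ) (a b : VIdx n) :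
    (Matrix.diagonal s ⊗ₖ Matrix.single c d u).mulVec (ket a b)
      = (if b = d then s a * u else 0) • ket a c := by
  ext x
  rw [mulVec_ket, Matrix.kroneckerMap_apply, Matrix.diagonal_apply, Matrix.single_apply,
    Pi.smul_apply, ket_apply, smul_eq_mul]
  have e1 : (if x.1 = a then s x.1 else 0) = if x.1 = a then s a else 0 :=
    ite_congr rfl (fun h => by rw [h]) fun _ => rfl
  rw [e1]
  split_ifs <;> first | (exfalso; tauto) | ring

theorem raiseVV_mulVec_ket (c d a b : VIdx n) :
    (raiseVV q c d).mulVec (ket a b) =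
      (if a = d then raiseK q c d b else 0) • ket c b
      + (if a = -c then sg c * sg d * raiseK q c d b else 0) • ket (-d) b
      + (if b = d then raiseSign c d a else 0) • ket a c
      + (if b = -c then raiseSign c d a * (sg c * sg d) else 0) • ket a (-d) := by
  rw [raiseVV, coprod, raise, Matrix.add_kronecker, Matrix.kronecker_add, Matrix.add_mulVec,
    Matrix.add_mulVec, Matrix.add_mulVec, single_kronecker_mulVec_ket, single_kronecker_mulVec_ket,
    kronecker_single_mulVec_ket, kronecker_single_mulVec_ket, one_mul, mul_one]
  abel

end

section
variable {n : ℕ} {q : ℂ}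

theorem raiseK_eq {c d : VIdx n} (hd : d ≠ 0) (hc : c ≠ 0) (hcd : c ≠ d) (hcd' : d ≠ -c) (b : VIdx n) :
    raiseK q c d b = if b = c ∨ b = -d then q else if b = -c ∨ b = d then q⁻¹ else 1 := by
  have h1 : c ≠ -c := fun h => hc (VIdx.eq_neg_self.1 h)
  have h2 : d ≠ -d := fun h => hd (VIdx.eq_neg_self.1 h)
  have h3 : c ≠ -d := fun h => hcd' (by rw [h, neg_neg])
  rw [raiseK, wt, sub_dotProduct, eps_dot_eps, eps_dot_eps, if_neg hd, if_neg hc]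
  by_cases e1 : b = c
  · subst e1; simp [hcd.symm, hcd']
  by_cases e2 : b = -d
  · subst e2; simp [hcd, h2, h3]
  by_cases e3 : b = -c
  · subst e3; simp [hcd.symm, hcd', h1, h1.symm, e2]
  by_cases e4 : b = d
  · subst e4; simp [e1, e2, hcd, h3]
  have e1' : c ≠ b := fun h => e1 h.symm
  have e2' : d ≠ -b := fun h => e2 (by rw [h, neg_neg])
  have e3' : c ≠ -b := fun h => e3 (by rw [h, neg_neg])
  have e4' : d ≠ b := fun h => e4 h.symm
  simp [e1, e2, e3, e4, e1', e2', e3', e4']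

theorem raiseK_zero {c : VIdx n} (hc : c ≠ 0) (b : VIdx n) :
    raiseK q c 0 b = if b = c then q else if b = -c then q⁻¹ else 1 := by
  have h1 : c ≠ -c := fun h => hc (VIdx.eq_neg_self.1 h)
  rw [raiseK, wt_zero_right, eps_dot_eps, if_neg hc]
  by_cases e1 : b = c
  · subst e1; simp
  have e1' : c ≠ b := fun h => e1 h.symm
  rw [if_neg e1, if_neg e1']
  by_cases e3 : b = -c
  · subst e3; simp
  · have e3' : c ≠ -b := fun h => e3 (by rw [h, neg_neg])
    rw [if_neg e3, if_neg e3', zpow_zero]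

theorem cupCoef_succ (hq : q ≠ 0) {c d : VIdx n} (hd : 0 < ht d) (hcd : ht c = ht d + 1) :
    cupCoef q d = -q * cupCoef q c ∧ cupCoef q (-c) = -q * cupCoef q (-d) := by
  have hq' : -q ≠ 0 := neg_ne_zero.2 hq
  have hc0 : c ≠ 0 := by rw [Ne, ← ht_eq_zero]; omega
  have hd0 : d ≠ 0 := by rw [Ne, ← ht_eq_zero]; omega
  have s1 : sg c = 1 := by simp [sg, hc0]
  have s2 : sg d = 1 := by simp [sg, hd0]
  constructor
  · rw [cupCoef, cupCoef, s1, s2, if_pos (by omega), if_pos (by omega), one_mul, one_mul,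
      ← zpow_one_add₀ hq', hcd]
    congr 1; ring
  · rw [cupCoef, cupCoef, sg_neg, sg_neg, s1, s2, ht_neg, ht_neg, if_neg (by omega),
      if_neg (by omega), one_mul, one_mul, ← zpow_one_add₀ hq', hcd]
    congr 1; ring

theorem cupCoef_one {c : VIdx n} (hc : ht c = 1) :
    cupCoef q c = 1 ∧ cupCoef q (0 : VIdx n) = q ∧ cupCoef q (-c) = -q := by
  have hc0 : c ≠ 0 := by rw [Ne, ← ht_eq_zero]; omega
  have s1 : sg c = 1 := by simp [sg, hc0]
  refine ⟨?_, ?_, ?_⟩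
  · rw [cupCoef, s1, hc]; simp
  · rw [cupCoef, ht_zero]; simp [sg]
  · rw [cupCoef, sg_neg, s1, ht_neg, hc]; simp

/-- The invariant vector is annihilated by the simple root vectors; a truncation of it loses one of
two cancelling terms when it separates the labels `c` and `d`, or `-d` and `-c`. -/
theorem raiseVV_mulVec_cupVec (hq : q ≠ 0) {c d : VIdx n} (hc : 0 < ht c) (hcd : ht c = ht d + 1) (h : ℤ) :
    (raiseVV q c d).mulVec (cupVec q h) =
      (if h = ht d then cupCoef q c * (sg c * sg d) * raiseK q c d c else 0) • ket (-d) c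
      + (if h = ht (-c) then cupCoef q (-d) * raiseK q c d (-d) else 0) • ket c (-d) := by
  have key : ∀ j : VIdx n, (raiseVV q c d).mulVec ((if h < ht j then cupCoef q j else 0) • ket (-j) j)
      = (if j = -d then (if h < ht (-d) then cupCoef q (-d) * raiseK q c d (-d) else 0) • ket c (-d) else 0)
        + (if j = c then (if h < ht c then cupCoef q c * (sg c * sg d) * raiseK q c d c else 0) • ket (-d) c
          else 0)
        + (if j = d then (if h < ht d then cupCoef q d * raiseSign c d (-d) else 0) • ket (-d) c else 0)
        + (if j = -c then
            (if h < ht (-c) then cupCoef q (-c) * raiseSign c d c * (sg c * sg d) else 0) • ket c (-d)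
          else 0) := by
    intro j
    have e1 : -j = d ↔ j = -d := neg_eq_iff_eq_neg
    rw [Matrix.mulVec_smul, raiseVV_mulVec_ket, if_congr e1 rfl rfl, if_congr neg_inj rfl rfl,
      smul_add, smul_add, smul_add]
    congr 1
    · congr 1
      · congr 1
        · by_cases hj : j = -d
          · rw [if_pos hj, if_pos hj, hj, smul_smul, ite_mul, zero_mul]
          · rw [if_neg hj, if_neg hj, zero_smul, smul_zero]
        · by_cases hj : j = c
          · rw [if_pos hj, if_pos hj, hj, smul_smul, ite_mul, zero_mul, mul_assoc (cupCoef q c)]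
          · rw [if_neg hj, if_neg hj, zero_smul, smul_zero]
      · by_cases hj : j = d
        · rw [if_pos hj, if_pos hj, hj, smul_smul, ite_mul, zero_mul]
        · rw [if_neg hj, if_neg hj, zero_smul, smul_zero]
    · by_cases hj : j = -c
      · rw [if_pos hj, if_pos hj, hj, neg_neg, smul_smul, ite_mul, zero_mul, mul_assoc (cupCoef q (-c))]
      · rw [if_neg hj, if_neg hj, zero_smul, smul_zero]
  rw [cupVec, Matrix.mulVec_sum, Finset.sum_congr rfl fun j _ => key j]
  simp only [Finset.sum_add_distrib, Finset.sum_ite_eq', Finset.mem_univ, if_true]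
  have hc0 : c ≠ 0 := by rw [Ne, ← ht_eq_zero]; omega
  have hcd1 : c ≠ d := by rintro rfl; omega
  have hcd2 : d ≠ -c := by rw [Ne, eq_neg_iff_ht]; omega
  -- the four terms cancel in pairs when both members of a pair are present
  have inv : cupCoef q c * (sg c * sg d) * raiseK q c d c + cupCoef q d * raiseSign c d (-d) = 0 ∧
      cupCoef q (-d) * raiseK q c d (-d) + cupCoef q (-c) * raiseSign c d c * (sg c * sg d) = 0 := by
    by_cases hd : d = 0
    · subst hd
      rw [ht_zero, zero_add] at hcd
      obtain ⟨a1, a2, a3⟩ := cupCoef_one (q := q) hcd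
      have h0c : (0 : VIdx n) ≠ -c := hcd2
      rw [VIdx.neg_zero, raiseK_zero hc0, raiseK_zero hc0, a1, a2, a3]
      simp [raiseSign, parity_eq, sg, hc0, hcd1.symm, h0c]
    · have hd0 : 0 < ht d := by
        have : ht d ≠ 0 := fun h => hd (ht_eq_zero.1 h)
        omega
      obtain ⟨a1, a2⟩ := cupCoef_succ hq hd0 hcd
      rw [raiseK_eq hd hc0 hcd1 hcd2, raiseK_eq hd hc0 hcd1 hcd2, a1, a2]
      simp [raiseSign, sg, hc0, hd]
      constructor <;> ring
  have h1 : cupCoef q d * raiseSign c d (-d) = -(cupCoef q c * (sg c * sg d) * raiseK q c d c) := by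
    linear_combination inv.1
  have h2 : cupCoef q (-c) * raiseSign c d c * (sg c * sg d) = -(cupCoef q (-d) * raiseK q c d (-d)) := by
    linear_combination inv.2
  rw [h1, h2, ht_neg, ht_neg]
  have e1 : h < ht c ↔ h < ht d ∨ h = ht d := by omega
  have e2 : h < -ht d ↔ h < -ht c ∨ h = -ht c := by omega
  rw [if_congr e1 rfl rfl, if_congr e2 rfl rfl]
  have e3 : ∀ u : ℂ, (if h < ht d ∨ h = ht d then u else 0) = (if h = ht d then u else 0) - if h < ht d then -u else 0 := by
    intro u
    split_ifs <;> first | (exfalso; omega) | ring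
  have e4 : ∀ u : ℂ, (if h < -ht c ∨ h = -ht c then u else 0)
      = (if h = -ht c then u else 0) - if h < -ht c then -u else 0 := by
    intro u
    split_ifs <;> first | (exfalso; omega) | ring
  rw [e3, e4]
  module

theorem cupVec_step {h : ℤ} {c : VIdx n} (hc : ht c = h + 1) :
    cupVec q h = cupVec q (ht c) + cupCoef q c • ket (-c) c := by
  ext x
  rw [Pi.add_apply, Pi.smul_apply, cupVec_apply, cupVec_apply, ket_apply, smul_eq_mul]
  by_cases h1 : x.2 = c
  · rw [h1, if_neg (by omega : ¬ (x.1 = -c ∧ ht c < ht c))]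
    by_cases h2 : x.1 = -c
    · rw [if_pos ⟨h2, by omega⟩, if_pos ⟨h2, rfl⟩]; ring
    · rw [if_neg (by tauto), if_neg (by tauto)]; ring
  · rw [if_neg (by tauto : ¬ (x.1 = -c ∧ x.2 = c)), mul_zero, add_zero]
    refine if_congr (and_congr_right' ?_) rfl rfl
    have : ht x.2 ≠ ht c := fun h => h1 (ht_inj.1 h)
    omega

end

section
variable {n : ℕ} {q : ℂ}

theorem raiseVV_mulVec_cupVec_of_ne (hq : q ≠ 0) {c d : VIdx n} (hc : 0 < ht c)
    (hcd : ht c = ht d + 1) {h : ℤ} (h1 : h ≠ ht d) (h2 : h ≠ ht (-c)) :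
    (raiseVV q c d).mulVec (cupVec q h) = 0 := by
  rw [raiseVV_mulVec_cupVec hq hc hcd, if_neg h1, if_neg h2, zero_smul, zero_smul, add_zero]

/-- The intertwining property for the even simple roots. The identity is compared on the basis vectors
`v_a ⊗ v_b`; only the relations of `a` and `b` to `c`, `d`, `-c`, `-d`, `0` matter. -/
theorem gMat_raiseVV_of_ne_zero (hq : q ≠ 0) {c d : VIdx n} (hd : 0 < ht d) (hcd : ht c = ht d + 1) :
    gMat q * raiseVV q c d = raiseVV q c d * gMat q := by
  have hc : 0 < ht c := by omega
  have hc0 : c ≠ 0 := by rw [Ne, ← ht_eq_zero]; omega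
  have hd0 : d ≠ 0 := by rw [Ne, ← ht_eq_zero]; omega
  have hnc0 : -c ≠ 0 := by rw [Ne, ← ht_eq_zero, ht_neg]; omega
  have hnd0 : -d ≠ 0 := by rw [Ne, ← ht_eq_zero, ht_neg]; omega
  have n1 : c ≠ d := by rintro rfl; omega
  have n2 : c ≠ -d := by rw [Ne, eq_neg_iff_ht]; omega
  have n3 : c ≠ -c := by rw [Ne, eq_neg_iff_ht]; omega
  have n4 : d ≠ -d := by rw [Ne, eq_neg_iff_ht]; omega
  have n5 : d ≠ -c := by rw [Ne, eq_neg_iff_ht]; omega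
  have sc : sg c = 1 := by simp [sg, hc0]
  have sd : sg d = 1 := by simp [sg, hd0]
  obtain ⟨a1, a2⟩ := cupCoef_succ hq hd hcd
  have a3 : cupCoef q c ≠ 0 := cupCoef_ne_zero hq c
  have a4 : cupCoef q (-d) ≠ 0 := cupCoef_ne_zero hq (-d)
  have hs : ∀ a, raiseSign c d a = 1 := fun a => by simp [raiseSign, hc0, hd0]
  have hk := raiseK_eq (q := q) hd0 hc0 n1 n5
  have l1 : ¬ ht c < ht d := by omega
  have l2 : ht d < ht c := by omega
  have l3 : ¬ ht c < ht (-d) := by rw [ht_neg]; omega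
  have l4 : ¬ ht c < ht (-c) := by rw [ht_neg]; omega
  have l5 : ¬ ht d < ht (-d) := by rw [ht_neg]; omega
  have l6 : ¬ ht d < ht (-c) := by rw [ht_neg]; omega
  have l7 : ht (-d) < ht c := by rw [ht_neg]; omega
  have l8 : ht (-d) < ht d := by rw [ht_neg]; omega
  have l9 : ¬ ht (-d) < ht (-c) := by rw [ht_neg, ht_neg]; omega
  have l10 : ht (-c) < ht c := by rw [ht_neg]; omega
  have l11 : ht (-c) < ht d := by rw [ht_neg]; omega
  have l12 : ht (-c) < ht (-d) := by rw [ht_neg, ht_neg]; omega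
  have t1 : cupVec q (ht d) = cupVec q (ht c) + cupCoef q c • ket (-c) c := cupVec_step hcd
  have t2 : cupVec q (ht (-c)) = cupVec q (ht (-d)) + cupCoef q (-d) • ket d (-d) := by
    have := cupVec_step (q := q) (c := -d) (h := ht (-c)) (by rw [ht_neg, ht_neg]; omega)
    rwa [neg_neg] at this
  refine ext_ket fun a b => ?_
  rw [← Matrix.mulVec_mulVec, ← Matrix.mulVec_mulVec]
  -- neither factor is moved by the root vector
  by_cases hab : (a ≠ d ∧ a ≠ -c) ∧ (b ≠ d ∧ b ≠ -c)
  · obtain ⟨⟨ha1, ha2⟩, hb1, hb2⟩ := hab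
    have h0 : (raiseVV q c d).mulVec (cupVec q (ht a)) = 0 :=
      raiseVV_mulVec_cupVec_of_ne hq hc hcd (fun h => ha1 (ht_inj.1 h)) (fun h => ha2 (ht_inj.1 h))
    simp only [gMat_mulVec_ket, raiseVV_mulVec_ket, Matrix.mulVec_add, Matrix.mulVec_sub,
      Matrix.mulVec_smul, ha1, ha2, hb1, hb2, if_false, zero_smul, add_zero, h0, smul_zero, sub_zero,
      Matrix.mulVec_zero]
  -- as `c` and `d` have adjacent heights, any other label compares in the same way with both
  have cases : ∀ a : VIdx n, a = d ∨ a = -c ∨ a = c ∨ a = -d ∨ a = 0 ∨ (a ≠ d ∧ d ≠ a ∧ a ≠ -c ∧ -c ≠ a ∧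
      a ≠ c ∧ c ≠ a ∧ a ≠ -d ∧ -d ≠ a ∧ a ≠ 0 ∧ d ≠ -a ∧ c ≠ -a ∧
      (ht a < ht c ↔ ht a < ht d) ∧ (ht c < ht a ↔ ht d < ht a) ∧
      (ht a < ht (-c) ↔ ht a < ht (-d)) ∧ (ht (-c) < ht a ↔ ht (-d) < ht a)) := by
    intro a
    have hac : a = c ↔ ht a = ht c := ht_inj.symm
    have hca : c = a ↔ ht c = ht a := ht_inj.symm
    have had : a = d ↔ ht a = ht d := ht_inj.symm
    have hda : d = a ↔ ht d = ht a := ht_inj.symm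
    simp only [hac, hca, had, hda, eq_neg_iff_ht, neg_eq_iff_eq_neg, ht_neg, ← ht_eq_zero, Ne]
    omega
  have lc0 : ht (0 : VIdx n) < ht c := by rw [ht_zero]; omega
  have ld0 : ht (0 : VIdx n) < ht d := by rw [ht_zero]; omega
  have lnc0 : ht (-c) < ht (0 : VIdx n) := by rw [ht_zero, ht_neg]; omega
  have lnd0 : ht (-d) < ht (0 : VIdx n) := by rw [ht_zero, ht_neg]; omega
  have hT : ∀ a, (raiseVV q c d).mulVec (cupVec q (ht a)) = (if a = d then cupCoef q c * q else 0) • ket (-d) c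
      + (if a = -c then cupCoef q (-d) * q else 0) • ket c (-d) := by
    intro a
    rw [raiseVV_mulVec_cupVec hq hc hcd, if_congr ht_inj rfl rfl, if_congr ht_inj rfl rfl, sc, sd, hk, hk,
      if_pos (Or.inl rfl), if_pos (Or.inr rfl), one_mul, mul_one]
  have z1 := hc0.symm
  have z2 := hd0.symm
  have z3 := hnc0.symm
  have z4 := hnd0.symm
  clear hcd hd hc
  rcases cases a with rfl | rfl | rfl | rfl | rfl | ⟨h1, h2, h3, h4, h5, h6, h7, h8, h9, h10, h11, h12, h13, h14, h15⟩ <;>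
  rcases cases b with rfl | rfl | rfl | rfl | rfl | ⟨g1, g2, g3, g4, g5, g6, g7, g8, g9, g10, g11, g12, g13, g14, g15⟩
  all_goals simp only [gMat_mulVec_ket, raiseVV_mulVec_ket, Matrix.mulVec_add, Matrix.mulVec_sub,
      Matrix.mulVec_smul, Matrix.mulVec_zero, swapCoef_eq,
      n1.symm, n2.symm, n3.symm, n4.symm, n5.symm,
      lc0.not_gt, ld0.not_gt, lnc0.not_gt, lnd0.not_gt,
      neg_neg, neg_inj, lt_self_iff_false, if_true, if_false, or_true, or_false, or_self,
      VIdx.neg_zero, zero_smul, smul_zero, add_zero, zero_add, sub_zero, one_mul, mul_one, *]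
  all_goals try (match_scalars <;> field_simp <;> ring)

/-- The intertwining property for the odd simple root. -/
theorem gMat_raiseVV_zero (hq : q ≠ 0) {c : VIdx n} (hcd : ht c = 1) :
    gMat q * raiseVV q c 0 = raiseVV q c 0 * gMat q := by
  have hc : 0 < ht c := by omega
  have hcd' : ht c = ht (0 : VIdx n) + 1 := by rw [hcd, ht_zero]; rfl
  have hc0 : c ≠ 0 := by rw [Ne, ← ht_eq_zero]; omega
  have hnc0 : -c ≠ 0 := by rw [Ne, ← ht_eq_zero, ht_neg]; omega
  have n3 : c ≠ -c := by rw [Ne, eq_neg_iff_ht]; omega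
  have sc : sg c = 1 := by simp [sg, hc0]
  have sd : sg (0 : VIdx n) = -1 := by simp [sg]
  obtain ⟨a1, a2, a3⟩ := cupCoef_one (q := q) hcd
  have hs : ∀ a, raiseSign c 0 a = if a = 0 then 1 else -1 := fun a => by
    by_cases h : a = 0 <;> simp [raiseSign, parity_eq, h]
  have hk := raiseK_zero (q := q) hc0
  have lc0 : ht (0 : VIdx n) < ht c := by rw [ht_zero]; omega
  have lnc0 : ht (-c) < ht (0 : VIdx n) := by rw [ht_zero, ht_neg]; omega
  have l10 : ht (-c) < ht c := by rw [ht_neg]; omega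
  have t1 : (cupVec q (ht (0 : VIdx n)) : VIdx n × VIdx n → ℂ) = cupVec q (ht c) + (1 : ℂ) • ket (-c) c := by
    rw [← a1]; exact cupVec_step hcd'
  have t2 : (cupVec q (ht (-c)) : VIdx n × VIdx n → ℂ) = cupVec q (ht (0 : VIdx n)) + q • ket (0 : VIdx n) (0 : VIdx n) := by
    have := cupVec_step (q := q) (c := (0 : VIdx n)) (h := ht (-c)) (by rw [ht_neg, ht_zero]; omega)
    rwa [a2, VIdx.neg_zero] at this
  rw [t1] at t2
  refine ext_ket fun a b => ?_
  rw [← Matrix.mulVec_mulVec, ← Matrix.mulVec_mulVec]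
  by_cases hab : (a ≠ 0 ∧ a ≠ -c) ∧ (b ≠ 0 ∧ b ≠ -c)
  · obtain ⟨⟨ha1, ha2⟩, hb1, hb2⟩ := hab
    have h0 : (raiseVV q c 0).mulVec (cupVec q (ht a)) = 0 :=
      raiseVV_mulVec_cupVec_of_ne hq hc hcd' (fun h => ha1 (ht_inj.1 h)) (fun h => ha2 (ht_inj.1 h))
    simp only [gMat_mulVec_ket, raiseVV_mulVec_ket, Matrix.mulVec_add, Matrix.mulVec_sub,
      Matrix.mulVec_smul, ha1, ha2, hb1, hb2, if_false, zero_smul, add_zero, h0, smul_zero, sub_zero,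
      Matrix.mulVec_zero]
  have cases : ∀ a : VIdx n, a = 0 ∨ a = -c ∨ a = c ∨ (a ≠ 0 ∧ a ≠ -c ∧ -c ≠ a ∧
      a ≠ c ∧ c ≠ a ∧ 0 ≠ a ∧ c ≠ -a ∧ 0 ≠ -a ∧
      (ht a < ht c ↔ ht a < ht (0 : VIdx n)) ∧ (ht c < ht a ↔ ht (0 : VIdx n) < ht a) ∧
      (ht a < ht (-c) ↔ ht a < ht (0 : VIdx n)) ∧ (ht (-c) < ht a ↔ ht (0 : VIdx n) < ht a)) := by
    intro a
    have hac : a = c ↔ ht a = ht c := ht_inj.symm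
    have hca : c = a ↔ ht c = ht a := ht_inj.symm
    have hda : 0 = a ↔ 0 = ht a := by rw [← ht_inj, ht_zero]
    simp only [hac, hca, hda, eq_neg_iff_ht, neg_eq_iff_eq_neg, ht_neg, ← ht_eq_zero, Ne, ht_zero]
    omega
  have hT : ∀ a, (raiseVV q c 0).mulVec (cupVec q (ht a)) = (if a = 0 then -q else 0) • ket 0 c
      + (if a = -c then q else 0) • ket c 0 := by
    intro a
    rw [raiseVV_mulVec_cupVec hq hc hcd', if_congr ht_inj rfl rfl, if_congr ht_inj rfl rfl, sc, sd, hk, hk,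
      VIdx.neg_zero, a1, a2, if_pos rfl, if_neg hc0.symm, if_neg hnc0.symm]
    norm_num
  have z1 := hc0.symm
  have z3 := hnc0.symm
  clear hcd hcd' hc
  rcases cases a with rfl | rfl | rfl | ⟨h1, h2, h3, h4, h5, h6, h7, h8, h9, h10, h11, h12⟩ <;>
  rcases cases b with rfl | rfl | rfl | ⟨g1, g2, g3, g4, g5, g6, g7, g8, g9, g10, g11, g12⟩
  all_goals simp only [gMat_mulVec_ket, raiseVV_mulVec_ket, Matrix.mulVec_add, Matrix.mulVec_sub,
      Matrix.mulVec_smul, Matrix.mulVec_zero, swapCoef_eq, n3.symm,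
      lc0.not_gt, lnc0.not_gt, l10.not_gt,
      neg_neg, neg_inj, lt_self_iff_false, if_true, if_false, or_true, or_false, or_self,
      VIdx.neg_zero, zero_smul, smul_zero, add_zero, zero_add, sub_zero, one_mul, mul_one, *]
  all_goals try (match_scalars <;> field_simp <;> ring)

theorem raiseVV_neg_neg (c d : VIdx n) :
    raiseVV q (-d) (-c) = (sg c * sg d) • raiseVV q c d := by
  have h1 : raise (-d) (-c) = (sg c * sg d) • raise c d := by
    have h : sg c * sg d * (sg c * sg d) = 1 := by
      linear_combination sg d * sg d * sg_mul_self c + sg_mul_self d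
    rw [raise, raise, smul_add, Matrix.smul_single, Matrix.smul_single, neg_neg, neg_neg, sg_neg,
      sg_neg, smul_eq_mul, smul_eq_mul, h, mul_one, mul_comm (sg d), add_comm]
  have h2 : raiseK q (-d) (-c) = raiseK q c d := by
    funext a
    rw [raiseK, raiseK, wt_neg_neg]
  have h3 : raiseSign (-d) (-c) = raiseSign c d := by
    funext a
    rw [raiseSign, raiseSign]
    refine if_congr ?_ rfl rfl
    rw [VIdx.neg_eq_zero', VIdx.neg_eq_zero', or_comm]
  rw [raiseVV, raiseVV, h1, h2, h3, coprod, coprod, Matrix.smul_kronecker, Matrix.kronecker_smul,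
    smul_add]

/-- Statements on the root vectors `raise c d` need only be verified for labels of non-negative
height. -/
theorem commute_raiseVV {M : EndVV n}
    (h : ∀ c d : VIdx n, 0 < ht c → ht c = ht d + 1 → M * raiseVV q c d = raiseVV q c d * M)
    (c d : VIdx n) (hcd : ht c = ht d + 1) : M * raiseVV q c d = raiseVV q c d * M := by
  by_cases hc : 0 < ht c
  · exact h c d hc hcd
  · have h1 := h (-d) (-c) (by rw [ht_neg]; omega) (by rw [ht_neg, ht_neg]; omega)
    rw [raiseVV_neg_neg, Matrix.mul_smul, Matrix.smul_mul] at h1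
    have h2 := congrArg (fun X => (sg c * sg d) • X) h1
    simpa only [smul_smul, show sg c * sg d * (sg c * sg d) = 1 by
      linear_combination sg d * sg d * sg_mul_self c + sg_mul_self d, one_smul] using h2

/-- The braiding commutes with the simple root vectors. -/
theorem gMat_mul_raiseVV (hq : q ≠ 0) (c d : VIdx n) (hcd : ht c = ht d + 1) :
    gMat q * raiseVV q c d = raiseVV q c d * gMat q := by
  refine commute_raiseVV (fun c d hc hcd => ?_) c d hcd
  by_cases hd : d = 0
  · subst hd
    exact gMat_raiseVV_zero hq (by rw [hcd, ht_zero]; rfl)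
  · refine gMat_raiseVV_of_ne_zero hq ?_ hcd
    have : ht d ≠ 0 := fun h => hd (ht_eq_zero.1 h)
    omega

/-- The invariance of the form with values `A_b⁻¹` on `v_b ⊗ v_{-b}` under the simple root vectors. -/
theorem cup_invariance (hq : q ≠ 0) {c d : VIdx n} (hc : 0 < ht c) (hcd : ht c = ht d + 1) :
    raiseK q c d (-c) * (cupCoef q c)⁻¹ + raiseSign c d d * (sg c * sg d) * (cupCoef q d)⁻¹ = 0 ∧
      sg c * sg d * raiseK q c d d * (cupCoef q (-d))⁻¹
        + raiseSign c d (-c) * (cupCoef q (-c))⁻¹ = 0 := by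
  have hc0 : c ≠ 0 := by rw [Ne, ← ht_eq_zero]; omega
  have n1 : c ≠ d := by rintro rfl; omega
  have n5 : d ≠ -c := by rw [Ne, eq_neg_iff_ht]; omega
  have hcc := cupCoef_ne_zero hq c
  have hcd2 := cupCoef_ne_zero hq (-d)
  by_cases hd : d = 0
  · subst hd
    rw [ht_zero, zero_add] at hcd
    obtain ⟨a1, a2, a3⟩ := cupCoef_one (q := q) hcd
    have h1 : -c ≠ c := fun h => hc0 (VIdx.eq_neg_self.1 h.symm)
    have h2 : -c ≠ 0 := fun h => hc0 (VIdx.neg_eq_zero'.1 h)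
    rw [raiseK_zero hc0, raiseK_zero hc0, VIdx.neg_zero, a1, a2, a3]
    simp [raiseSign, parity_eq, sg, hc0, h1, h2, n1.symm, n5]
  · have hd0 : 0 < ht d := by
      have : ht d ≠ 0 := fun h => hd (ht_eq_zero.1 h)
      omega
    obtain ⟨a1, a2⟩ := cupCoef_succ hq hd0 hcd
    have h1 : -c ≠ c := fun h => hc0 (VIdx.eq_neg_self.1 h.symm)
    have h2 : d ≠ -d := fun h => hd (VIdx.eq_neg_self.1 h)
    rw [raiseK_eq hd hc0 n1 n5, raiseK_eq hd hc0 n1 n5, a1, a2]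
    simp [raiseSign, sg, hc0, hd, h1, h2, n1, n1.symm, n5]
    constructor <;> field_simp <;> ring

/-- The rank one operator `cupCap` commutes with the simple root vectors. -/
theorem cupCap_mul_raiseVV (hq : q ≠ 0) (c d : VIdx n) (hcd : ht c = ht d + 1) :
    cupCap q * raiseVV q c d = raiseVV q c d * cupCap q := by
  refine commute_raiseVV (fun c d hc hcd => ?_) c d hcd
  have hT : (raiseVV q c d).mulVec (cupVec q (-(n + 1 : ℤ))) = 0 :=
    raiseVV_mulVec_cupVec_of_ne hq hc hcd (by have := ht_bounds d; omega)
      (by have := ht_bounds (-c); omega)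
  have hc0 : c ≠ 0 := by rw [Ne, ← ht_eq_zero]; omega
  have n1 : c ≠ d := by rintro rfl; omega
  have n5 : d ≠ -c := by rw [Ne, eq_neg_iff_ht]; omega
  have e1 : ∀ a : VIdx n, -d = -a ↔ a = d := fun a => by rw [neg_inj, eq_comm]
  have inv := cup_invariance hq hc hcd
  refine ext_ket fun a b => ?_
  rw [← Matrix.mulVec_mulVec, ← Matrix.mulVec_mulVec]
  simp only [cupCap_mulVec_ket, raiseVV_mulVec_ket, Matrix.mulVec_add, Matrix.mulVec_smul, hT, smul_zero]
  simp only [smul_smul, ← add_smul]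
  convert zero_smul ℂ _ using 2
  by_cases hab : a = d ∧ b = -c
  · obtain ⟨rfl, rfl⟩ := hab
    have n2 : -c ≠ a := n5.symm
    simpa [n5, n2] using inv.1
  by_cases hab' : a = -c ∧ b = d
  · obtain ⟨rfl, rfl⟩ := hab'
    have n2 : -c ≠ b := n5.symm
    simpa [n5, n2, n1, mul_assoc] using inv.2
  have k1 : ¬ (a = d ∧ b = -c) := hab
  have k2 : ¬ (a = -c ∧ b = - -d) := by rw [neg_neg]; exact hab'
  have k3 : ¬ (b = d ∧ c = -a) := fun h => hab' ⟨by rw [h.2, neg_neg], h.1⟩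
  have k4 : ¬ (b = -c ∧ -d = -a) := fun h => hab ⟨(e1 a).1 h.2, h.1⟩
  rw [ite_zero_mul_ite_zero, ite_zero_mul_ite_zero, ite_zero_mul_ite_zero, ite_zero_mul_ite_zero,
    if_neg k1, if_neg k2, if_neg k3, if_neg k4]
  ring

end

open scoped Kronecker

section
variable {n : ℕ} {q : ℂ}

theorem exists_ht_eq_sub_one {b : VIdx n} (h : ht b ≠ -n) : ∃ d : VIdx n, ht b = ht d + 1 := by
  have h1 := ht_bounds b
  obtain ⟨d, hd⟩ := exists_ht_eq (n := n) (ht b - 1) (by omega) (by omega)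
  exact ⟨d, by omega⟩

/-- An operator on `W ⊗ V` that commutes with the simple root vectors is determined by its values on
`W ⊗ v`, where `v` is the lowest weight vector of `V`. -/
theorem eq_zero_of_commute_coprod {I : Type*} [Fintype I] [DecidableEq I]
    {M : Matrix (I × VIdx n) (I × VIdx n) ℂ} (e : VIdx n → VIdx n → Matrix I I ℂ)
    (s : VIdx n → VIdx n → I → ℂ) (k : VIdx n → VIdx n → VIdx n → ℂ) (hs : ∀ c d i, s c d i ≠ 0)
    (hM : ∀ c d, ht c = ht d + 1 → M * coprod (e c d) (s c d) (k c d) (raise c d)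
      = coprod (e c d) (s c d) (k c d) (raise c d) * M)
    (h0 : ∀ i b, ht b = -n → ∀ x, M x (i, b) = 0) : M = 0 := by
  -- induction on the height: the vector `v_c` is obtained from `v_d` by a root vector
  have key : ∀ (m : ℕ) (b : VIdx n), ht b = -n + m → ∀ i x, M x (i, b) = 0 := by
    intro m
    induction m with
    | zero => exact fun b hb i x => h0 i b (by rw [hb]; simp) x
    | succ m ih =>
      intro c hc i x
      obtain ⟨d, hd⟩ := exists_ht_eq_sub_one (b := c) (by rw [hc]; push_cast; omega)
      have ihd := ih d (by push_cast at hc; omega)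
      have hdc : -c ≠ d := by
        intro h
        have : ht d = -ht c := by rw [← h, ht_neg]
        omega
      have h1 := congrFun (congrFun (hM c d hd) x) (i, d)
      have h2 : (coprod (e c d) (s c d) (k c d) (raise c d) * M) x (i, d) = 0 := by
        rw [Matrix.mul_apply]
        exact Finset.sum_eq_zero fun w _ => by rw [ihd, mul_zero]
      have h3 : (M * coprod (e c d) (s c d) (k c d) (raise c d)) x (i, d) = M x (i, c) * s c d i := by
        rw [coprod, mul_add, Matrix.add_apply, Matrix.mul_apply, Matrix.mul_apply,
          Finset.sum_eq_zero, zero_add, Finset.sum_eq_single (i, c)]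
        · rw [Matrix.kroneckerMap_apply, Matrix.diagonal_apply_eq, raise, Matrix.add_apply,
            Matrix.single_apply_same, Matrix.single_apply, if_neg (fun h => hdc h.2), add_zero,
            mul_one]
        · intro w _ hw
          rw [Matrix.kroneckerMap_apply]
          by_cases h4 : w.1 = i
          · have h5 : c ≠ w.2 := fun h => hw (Prod.ext h4 h.symm)
            rw [raise, Matrix.add_apply, Matrix.single_apply, Matrix.single_apply,
              if_neg (fun h => h5 h.1), if_neg (fun h => hdc h.2), add_zero, mul_zero, mul_zero]
          · rw [Matrix.diagonal_apply_ne _ h4, zero_mul, mul_zero]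
        · simp
        · intro w _
          rw [Matrix.kroneckerMap_apply]
          by_cases h4 : w.2 = d
          · rw [show w = (w.1, d) from Prod.ext rfl h4, ihd, zero_mul]
          · rw [Matrix.diagonal_apply_ne _ h4, mul_zero, mul_zero]
      rw [h3, h2] at h1
      exact (mul_eq_zero.1 h1).resolve_right (hs c d i)
  ext x ⟨i, b⟩
  have hb := ht_bounds b
  exact key (ht b + n).toNat b (by omega) i x

/-- The braiding preserves weights. -/
theorem mul_gMat_apply {f : VIdx n → ℂ} {u : ℂ} (hf : ∀ a, f a * f (-a) = u)
    (x y : VIdx n × VIdx n) :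
    f x.1 * f x.2 * gMat q x y = gMat q x y * (f y.1 * f y.2) := by
  have h1 : f x.1 * f x.2 * wtPerm q x y = wtPerm q x y * (f y.1 * f y.2) := by
    rw [wtPerm]
    split_ifs with h
    · rw [h]; ring
    · ring
  have h2 : f x.1 * f x.2 * cupCap q x y = cupCap q x y * (f y.1 * f y.2) := by
    rw [cupCap]
    split_ifs with h
    · rw [h.1, h.2, hf, hf]; ring
    · ring
  rw [gMat]
  by_cases h3 : ht y.1 < ht y.2 ∧ x = y
  · rw [if_pos h3]
    by_cases h4 : ht y.1 < ht x.2
    · rw [if_pos h4]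
      have h5 : f x.1 * f x.2 = f y.1 * f y.2 := by rw [h3.2]
      linear_combination h1 - (q - q⁻¹) * h2 + (q - q⁻¹) * h5
    · rw [if_neg h4]
      have h5 : f x.1 * f x.2 = f y.1 * f y.2 := by rw [h3.2]
      linear_combination h1 + (q - q⁻¹) * h5
  · rw [if_neg h3]
    by_cases h4 : ht y.1 < ht x.2
    · rw [if_pos h4]
      linear_combination h1 - (q - q⁻¹) * h2
    · rw [if_neg h4]
      linear_combination h1

theorem gMat_mul_diagonal {f : VIdx n → ℂ} {u : ℂ} (hf : ∀ a, f a * f (-a) = u) :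
    gMat q * (Matrix.diagonal f ⊗ₖ Matrix.diagonal f)
      = (Matrix.diagonal f ⊗ₖ Matrix.diagonal f) * gMat q := by
  rw [Matrix.diagonal_kronecker_diagonal]
  ext x y
  rw [Matrix.mul_diagonal, Matrix.diagonal_mul]
  exact (mul_gMat_apply hf x y).symm

theorem raiseSign_ne_zero (c d a : VIdx n) : raiseSign c d a ≠ 0 :=
  left_ne_zero_of_mul_eq_one (raiseSign_mul_neg c d a)

/-- Two intertwining operators on `V ⊗ V` are equal if they agree on the `v ⊗ v_b`, with `v_b` the lowest
weight vector. -/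
theorem eq_of_commute_raiseVV {M N : EndVV n}
    (hM : ∀ c d : VIdx n, ht c = ht d + 1 → M * raiseVV q c d = raiseVV q c d * M)
    (hN : ∀ c d : VIdx n, ht c = ht d + 1 → N * raiseVV q c d = raiseVV q c d * N)
    (h0 : ∀ a b : VIdx n, ht b = -n → M.mulVec (ket a b) = N.mulVec (ket a b)) : M = N := by
  rw [← sub_eq_zero]
  refine eq_zero_of_commute_coprod raise raiseSign (raiseK q) raiseSign_ne_zero ?_ ?_
  · intro c d h
    have h1 := hM c d h
    have h2 := hN c d h
    rw [raiseVV] at h1 h2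
    rw [sub_mul, mul_sub, h1, h2]
  · intro a b hb x
    rw [Matrix.sub_apply, ← mulVec_ket M, ← mulVec_ket N, h0 a b hb, sub_self]

theorem gMat_mulVec_ket_lowest {b : VIdx n} (hb : ht b = -n) (a : VIdx n) :
    (gMat q).mulVec (ket a b) = swapCoef q a b • ket b a := by
  have h1 := ht_bounds a
  rw [gMat_mulVec_ket, if_neg (by omega), zero_smul, add_zero, sub_eq_self]
  split_ifs with h
  · have h2 : cupVec q (ht a) = (0 : VIdx n × VIdx n → ℂ) := by
      ext x
      have h3 := ht_bounds x.2
      rw [h, ht_neg] at hb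
      rw [cupVec_apply, if_neg (by omega)]
      rfl
    rw [h2, smul_zero]
  · rw [zero_smul]

theorem swapCoef_mul_neg (hq : q ≠ 0) (b a : VIdx n) : swapCoef q a b * swapCoef q (-a) b = 1 := by
  rw [swapCoef, swapCoef, VIdx.coe_neg, eps_neg, neg_dotProduct, zpow_neg]
  have h1 : parity (-a) = parity a := by
    rw [parity_eq, parity_eq]
    exact if_congr VIdx.neg_eq_zero' rfl rfl
  have h2 : ((-1 : ℂ) ^ (parity a * parity b)) * (-1) ^ (parity a * parity b) = 1 := by
    rw [← mul_pow]; norm_num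
  have h3 := mul_inv_cancel₀ (zpow_ne_zero (eps n a ⬝ᵥ eps n b) hq)
  rw [h1]
  linear_combination h2 + (-1 : ℂ) ^ (parity a * parity b) * (-1) ^ (parity a * parity b) * h3

/-! ### The braid relation -/

/-- An operator on the first two factors of `V ⊗ V ⊗ V`. -/
def leg12 {n : ℕ} (M : EndVV n) :
    Matrix ((VIdx n × VIdx n) × VIdx n) ((VIdx n × VIdx n) × VIdx n) ℂ := M ⊗ₖ 1

/-- An operator on the last two factors of `V ⊗ V ⊗ V`. -/
def leg23 {n : ℕ} (M : EndVV n) :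
    Matrix ((VIdx n × VIdx n) × VIdx n) ((VIdx n × VIdx n) × VIdx n) ℂ :=
  (Matrix.reindexAlgEquiv ℂ ℂ (Equiv.prodAssoc (VIdx n) (VIdx n) (VIdx n))).symm (1 ⊗ₖ M)

theorem leg12_mulVec (M : EndVV n) (f : (VIdx n × VIdx n) × VIdx n → ℂ) (x) :
    (leg12 M).mulVec f x = ∑ y : VIdx n × VIdx n, M x.1 y * f (y, x.2) := by
  rw [Matrix.mulVec, dotProduct, Fintype.sum_prod_type]
  refine Finset.sum_congr rfl fun y _ => ?_
  rw [Finset.sum_eq_single x.2]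
  · rw [leg12, Matrix.kroneckerMap_apply, Matrix.one_apply_eq, mul_one]
  · intro z _ hz
    rw [leg12, Matrix.kroneckerMap_apply, Matrix.one_apply_ne hz.symm, mul_zero, zero_mul]
  · simp

theorem leg23_apply (M : EndVV n) (x y : (VIdx n × VIdx n) × VIdx n) :
    leg23 M x y = (1 : EndV n) x.1.1 y.1.1 * M (x.1.2, x.2) (y.1.2, y.2) := rfl

theorem leg23_mulVec (M : EndVV n) (f : (VIdx n × VIdx n) × VIdx n → ℂ) (x) :
    (leg23 M).mulVec f x = ∑ y : VIdx n × VIdx n, M (x.1.2, x.2) y * f ((x.1.1, y.1), y.2) := by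
  rw [Matrix.mulVec, dotProduct, Fintype.sum_prod_type, Fintype.sum_prod_type]
  rw [Finset.sum_eq_single x.1.1]
  · rw [Fintype.sum_prod_type]
    refine Finset.sum_congr rfl fun y _ => Finset.sum_congr rfl fun z _ => ?_
    rw [leg23_apply, Matrix.one_apply_eq, one_mul]
  · intro z _ hz
    refine Finset.sum_eq_zero fun y _ => Finset.sum_eq_zero fun w _ => ?_
    rw [leg23_apply, Matrix.one_apply_ne hz.symm, zero_mul, zero_mul]
  · simp

/-- The action of the simple root vector `raise c d` on `V ⊗ V ⊗ V`. -/
def raiseVVV {n : ℕ} (q : ℂ) (c d : VIdx n) :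
    Matrix ((VIdx n × VIdx n) × VIdx n) ((VIdx n × VIdx n) × VIdx n) ℂ :=
  coprod (raiseVV q c d) (fun x => raiseSign c d x.1 * raiseSign c d x.2) (raiseK q c d) (raise c d)

theorem leg12_mul_raiseVVV (hq : q ≠ 0) (c d : VIdx n) (hcd : ht c = ht d + 1) :
    leg12 (gMat q) * raiseVVV q c d = raiseVVV q c d * leg12 (gMat q) := by
  have h1 := gMat_mul_raiseVV hq c d hcd
  have h2 := gMat_mul_diagonal (q := q) (raiseSign_mul_neg c d)
  rw [Matrix.diagonal_kronecker_diagonal] at h2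
  rw [leg12, raiseVVV, coprod, mul_add, add_mul, ← Matrix.mul_kronecker_mul, ← Matrix.mul_kronecker_mul,
    ← Matrix.mul_kronecker_mul, ← Matrix.mul_kronecker_mul, h1, h2]
  simp only [one_mul, mul_one]

theorem leg23_mul_raiseVVV (hq : q ≠ 0) (c d : VIdx n) (hcd : ht c = ht d + 1) :
    leg23 (gMat q) * raiseVVV q c d = raiseVVV q c d * leg23 (gMat q) := by
  set φ := Matrix.reindexAlgEquiv ℂ ℂ (Equiv.prodAssoc (VIdx n) (VIdx n) (VIdx n)) with hφ
  have e1 : raiseVVV q c d = φ.symm (raise c d ⊗ₖ (Matrix.diagonal (raiseK q c d) ⊗ₖ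
      Matrix.diagonal (raiseK q c d)) + Matrix.diagonal (raiseSign c d) ⊗ₖ raiseVV q c d) := by
    rw [AlgEquiv.eq_symm_apply, raiseVVV, raiseVV, coprod, coprod,
      ← Matrix.diagonal_kronecker_diagonal, Matrix.add_kronecker, Matrix.kronecker_add, map_add,
      map_add, hφ, Matrix.coe_reindexAlgEquiv, Matrix.kronecker_assoc, Matrix.kronecker_assoc, Matrix.kronecker_assoc, add_assoc]
  rw [leg23, e1, ← map_mul, ← map_mul, mul_add, add_mul, ← Matrix.mul_kronecker_mul,
    ← Matrix.mul_kronecker_mul, ← Matrix.mul_kronecker_mul, ← Matrix.mul_kronecker_mul,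
    gMat_mul_raiseVV hq c d hcd, gMat_mul_diagonal (raiseK_mul_neg hq c d)]
  simp only [one_mul, mul_one, hφ]

/-- The braid relation on `V ⊗ V ⊗ V`: both sides move the lowest weight vector from the last factor
to the first one, past the same operator on the other two factors. -/
theorem gMat_braid (hq : q ≠ 0) : leg12 (gMat q) * leg23 (gMat q) * leg12 (gMat q)
    = leg23 (gMat q) * leg12 (gMat q) * leg23 (gMat (n := n) q) := by
  rw [← sub_eq_zero]
  refine eq_zero_of_commute_coprod (raiseVV q)
    (fun c d x => raiseSign c d x.1 * raiseSign c d x.2) (raiseK q)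
    (fun c d i => mul_ne_zero (raiseSign_ne_zero _ _ _) (raiseSign_ne_zero _ _ _)) ?_ ?_
  · intro c d h
    have h1 := leg12_mul_raiseVVV hq c d h
    have h2 := leg23_mul_raiseVVV hq c d h
    change _ * raiseVVV q c d = raiseVVV q c d * _
    have h3 : Commute (leg12 (gMat q)) (raiseVVV q c d) := h1
    have h4 : Commute (leg23 (gMat q)) (raiseVVV q c d) := h2
    exact (((h3.mul_left h4).mul_left h3).sub_left ((h4.mul_left h3).mul_left h4)).eq
  · rintro ⟨a, b⟩ l hl x
    -- `right u = u ⊗ v_l` and `left u = v_l ⊗ u`, with `v_l` the lowest weight vector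
    set right : (VIdx n × VIdx n → ℂ) → (VIdx n × VIdx n) × VIdx n → ℂ :=
      fun u x => if x.2 = l then u x.1 else 0 with hright
    set left : (VIdx n × VIdx n → ℂ) → (VIdx n × VIdx n) × VIdx n → ℂ :=
      fun u x => if x.1.1 = l then u (x.1.2, x.2) else 0 with hleft
    have hg : ∀ x : VIdx n × VIdx n, ∀ y, gMat q x (y, l) = if x.1 = l ∧ x.2 = y then swapCoef q y l else 0 := by
      intro x y
      rw [← mulVec_ket (gMat q), gMat_mulVec_ket_lowest hl, Pi.smul_apply, ket_apply, smul_eq_mul, mul_ite,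
        mul_one, mul_zero]
    have h1 : ∀ u, (leg12 (gMat q)).mulVec (right u) = right ((gMat q).mulVec u) := by
      intro u
      funext x
      rw [leg12_mulVec]
      simp only [hright]
      split_ifs with h
      · rfl
      · simp
    have h2 : ∀ u, (leg23 (gMat q)).mulVec (left u) = left ((gMat q).mulVec u) := by
      intro u
      funext x
      rw [leg23_mulVec]
      simp only [hleft]
      split_ifs with h
      · rfl
      · simp
    have h3 : ∀ u, (leg12 (gMat q)).mulVec ((leg23 (gMat q)).mulVec (right u))
        = left (fun x => swapCoef q x.1 l * swapCoef q x.2 l * u x) := by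
      intro u
      have h4 : ∀ x : (VIdx n × VIdx n) × VIdx n, (leg23 (gMat q)).mulVec (right u) x
          = if x.1.2 = l then swapCoef q x.2 l * u (x.1.1, x.2) else 0 := by
        intro x
        rw [leg23_mulVec, Finset.sum_eq_single (x.2, l)]
        · rw [hg]
          simp [hright]
        · intro y _ hy
          simp only [hright]
          split_ifs with h
          · rw [show y = (y.1, l) from Prod.ext rfl h, hg, if_neg, zero_mul]
            rintro ⟨-, h5⟩
            exact hy (Prod.ext h5.symm h)
          · rw [mul_zero]
        · simp
      funext x
      rw [leg12_mulVec, Finset.sum_eq_single (x.1.2, l)]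
      · rw [hg, h4]
        simp [hleft, mul_assoc]
      · intro y _ hy
        rw [h4]
        simp only
        split_ifs with h
        · rw [show y = (y.1, l) from Prod.ext rfl h, hg, if_neg, zero_mul]
          rintro ⟨-, h5⟩
          exact hy (Prod.ext h5.symm h)
        · rw [mul_zero]
      · simp
    have h5 : (Pi.single ((a, b), l) 1 : (VIdx n × VIdx n) × VIdx n → ℂ) = right (ket a b) := by
      funext x
      simp only [hright, ket, Pi.single_apply]
      rw [← ite_and]
      exact if_congr (by rw [Prod.ext_iff, and_comm]) rfl rfl
    have h6 : ∀ M : Matrix ((VIdx n × VIdx n) × VIdx n) ((VIdx n × VIdx n) × VIdx n) ℂ,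
        M x ((a, b), l) = M.mulVec (right (ket a b)) x := by
      intro M
      rw [← h5, Matrix.mulVec_single_one]
      rfl
    rw [h6 (_ - _), Matrix.sub_mulVec, ← Matrix.mulVec_mulVec, ← Matrix.mulVec_mulVec, ← Matrix.mulVec_mulVec,
      ← Matrix.mulVec_mulVec, h1, h3, h3]
    have h7 : (fun x : VIdx n × VIdx n => swapCoef q x.1 l * swapCoef q x.2 l * ket a b x)
        = (swapCoef q a l * swapCoef q b l) • ket a b := by
      funext x
      rw [Pi.smul_apply, ket_apply, smul_eq_mul]
      split_ifs with h
      · rw [h.1, h.2]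
      · rw [mul_zero, mul_zero]
    have h8 : (fun x : VIdx n × VIdx n => swapCoef q x.1 l * swapCoef q x.2 l * (gMat q).mulVec (ket a b) x)
        = (swapCoef q a l * swapCoef q b l) • (gMat q).mulVec (ket a b) := by
      funext x
      rw [Pi.smul_apply, mulVec_ket, mul_gMat_apply (swapCoef_mul_neg hq l), smul_eq_mul, mul_comm]
    rw [h7, h8, h2, Matrix.mulVec_smul, sub_self]
    rfl

end

/-! ### The skein, tangle and trace relations -/

/-- The inverse of the braiding `gMat`. -/
def gInv {n : ℕ} (q : ℂ) : EndVV n := gMat q - (q - q⁻¹) • (1 - cupCap q)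

/-- The weights `A_{-a} / A_a` of the quantum supertrace. -/
def traceWt {n : ℕ} (q : ℂ) (a : VIdx n) : ℂ := cupCoef q (-a) / cupCoef q a

section
variable {n : ℕ} {q : ℂ}

theorem cupCoef_lowest (hn : 1 ≤ n) {b : VIdx n} (hb : ht b = -n) :
    cupCoef q b = (-q) ^ n ∧ cupCoef q (-b) = ((-q) ^ (n - 1))⁻¹ := by
  have hb0 : b ≠ 0 := by rw [Ne, ← ht_eq_zero]; omega
  have hs : sg b = 1 := by simp [sg, hb0]
  constructor
  · rw [cupCoef, hs, if_neg (by omega), hb, neg_neg, one_mul, zpow_natCast]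
  · rw [cupCoef, sg_neg, hs, ht_neg, if_pos (by omega), hb, neg_neg, one_mul, zpow_neg,
      ← zpow_natCast, Nat.cast_sub hn, Nat.cast_one]

/-- By the uniqueness principle, the skein relation need only be verified on `v_a ⊗ v_b` with `v_b` of
lowest weight. -/
theorem gInv_mul_gMat (hn : 1 ≤ n) (hq : q ≠ 0) : gInv q * gMat (n := n) q = 1 := by
  have hA : ∀ c d : VIdx n, ht c = ht d + 1 → Commute (gInv q) (raiseVV q c d) := fun c d h =>
    Commute.sub_left (gMat_mul_raiseVV hq c d h)
      (Commute.smul_left (Commute.sub_left (Commute.one_left _) (cupCap_mul_raiseVV hq c d h)) _)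
  refine eq_of_commute_raiseVV (q := q) (fun c d h => ?_) (fun c d h => ?_) fun a b hb => ?_
  · exact ((hA c d h).mul_left (gMat_mul_raiseVV hq c d h)).eq
  · rw [one_mul, mul_one]
  · have hb0 : b ≠ 0 := by rw [Ne, ← ht_eq_zero]; omega
    have hbn : b ≠ -b := fun h => hb0 (VIdx.eq_neg_self.1 h)
    have ha := ht_bounds a
    have hbc := cupCoef_ne_zero hq b
    have hT : cupVec q (-(n + 1 : ℤ)) = cupVec q (ht b) + cupCoef q b • ket (-b) b :=
      cupVec_step (by omega)
    have hlt : (if ht b < ht a then q - q⁻¹ else 0) = if a = b then 0 else q - q⁻¹ := by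
      by_cases hab : a = b
      · rw [if_pos hab, if_neg (by rw [hab]; omega)]
      · have : ht a ≠ ht b := fun h => hab (ht_inj.1 h)
        rw [if_neg hab, if_pos (by omega)]
    rw [← Matrix.mulVec_mulVec, gMat_mulVec_ket_lowest hb, Matrix.mulVec_smul, Matrix.one_mulVec, gInv,
      Matrix.sub_mulVec, Matrix.smul_mulVec, Matrix.sub_mulVec, Matrix.one_mulVec,
      gMat_mulVec_ket, cupCap_mulVec_ket, hT, hlt, swapCoef_eq, swapCoef_eq]
    by_cases h1 : a = b
    · subst h1
      simp only [hb0, hbn, or_self, if_true, if_false]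
      match_scalars <;> field_simp <;> ring
    by_cases h2 : a = -b
    · subst h2
      have h3 : -b ≠ 0 := fun h => hb0 (VIdx.neg_eq_zero'.1 h)
      simp only [hb0, h3, hbn, hbn.symm, or_self, neg_neg, if_true, if_false]
      match_scalars <;> field_simp <;> ring
    have h1' : b ≠ a := fun h => h1 h.symm
    have h2' : b ≠ -a := fun h => h2 (by rw [h, neg_neg])
    by_cases h3 : a = 0
    · simp only [hb0, h3, or_true, true_or, if_true, if_false]
      have h4 : (0 : VIdx n) ≠ b := hb0.symm
      have h5 : (0 : VIdx n) ≠ -b := by rw [← h3]; exact h2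
      simp only [h4, h5, if_false]
      module
    · simp only [hb0, h1, h2, h1', h2', h3, or_self, if_false]
      module

theorem gMat_mul_gInv (hn : 1 ≤ n) (hq : q ≠ 0) : gMat (n := n) q * gInv q = 1 :=
  mul_eq_one_comm.1 (gInv_mul_gMat hn hq)

theorem cupCap_mul_gMat (hn : 1 ≤ n) (hq : q ≠ 0) :
    cupCap q * gMat (n := n) q = (-q ^ (2 * n))⁻¹ • cupCap q := by
  refine eq_of_commute_raiseVV (q := q) (fun c d h => ?_) (fun c d h => ?_) fun a b hb => ?_
  · exact (Commute.mul_left (cupCap_mul_raiseVV hq c d h) (gMat_mul_raiseVV hq c d h)).eq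
  · exact (Commute.smul_left (cupCap_mul_raiseVV hq c d h) _).eq
  · have hb0 : b ≠ 0 := by rw [Ne, ← ht_eq_zero]; omega
    have hbn : b ≠ -b := fun h => hb0 (VIdx.eq_neg_self.1 h)
    rw [← Matrix.mulVec_mulVec, gMat_mulVec_ket_lowest hb, Matrix.mulVec_smul, Matrix.smul_mulVec,
      cupCap_mulVec_ket, cupCap_mulVec_ket, swapCoef_eq]
    by_cases h2 : a = -b
    · subst h2
      have h3 : -b ≠ 0 := fun h => hb0 (VIdx.neg_eq_zero'.1 h)
      obtain ⟨c1, c2⟩ := cupCoef_lowest (q := q) hn hb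
      simp only [hb0, h3, hbn.symm, or_self, neg_neg, if_true, if_false, smul_smul]
      congr 1
      rw [c1, c2, inv_inv]
      obtain ⟨m, rfl⟩ : ∃ m, n = m + 1 := ⟨n - 1, by omega⟩
      rw [Nat.add_sub_cancel]
      rw [inv_neg, show 2 * (m + 1) = (m + 1) + m + 1 by omega, pow_succ q, pow_add q]
      rw [neg_pow q (m + 1), neg_pow q m]
      have e : ((-1 : ℂ) ^ m) * (-1) ^ m = 1 := by rw [← mul_pow]; norm_num
      have e2 : ((-1 : ℂ) ^ (m + 1)) ≠ 0 := pow_ne_zero _ (by norm_num)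
      field_simp
      rw [pow_succ, mul_comm]
      linear_combination -e
    · have h2' : b ≠ -a := fun h => h2 (by rw [h, neg_neg])
      have h3 : ¬ b = -a := h2'
      simp only [h2, h3, if_false, zero_smul, smul_zero]

theorem traceWt_eq (hq : q ≠ 0) (a : VIdx n) : traceWt q a =
    if a = 0 then 1 else if 0 < ht a then -q ^ (2 * ht a - 1) else -q ^ (2 * ht a + 1) := by
  rw [traceWt, cupCoef, cupCoef, sg_neg, ht_neg, mul_div_mul_left _ _ (sg_ne_zero a)]
  have hq' : -q ≠ 0 := neg_ne_zero.2 hq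
  rw [← zpow_sub₀ hq']
  by_cases h0 : a = 0
  · rw [if_pos h0, h0, ht_zero, neg_zero, sub_self, zpow_zero]
  have h1 : ht a ≠ 0 := fun h => h0 (ht_eq_zero.1 h)
  rw [if_neg h0]
  by_cases h2 : 0 < ht a
  · rw [if_pos h2, if_neg (by omega), if_pos h2.le, ← Odd.neg_zpow ⟨ht a - 1, by ring⟩]
    congr 1; ring
  · rw [if_neg h2, if_pos (by omega), if_neg (by omega), ← Odd.neg_zpow ⟨ht a, by ring⟩]
    congr 1; ring

/-- The partial sums of the weights of the quantum supertrace telescope. -/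
theorem sum_traceWt (hq : q ≠ 0) (m : ℕ) (h : ℤ) (hm : h = n - m) (hm2 : m ≤ 2 * n + 1) :
    (q - q⁻¹) * ∑ a : VIdx n, (if h < ht a then traceWt q a else 0)
      = -q ^ (2 * n) + if 0 ≤ h then q ^ (2 * h) else q ^ (2 * h + 2) + (q - q⁻¹) := by
  induction m generalizing h with
  | zero =>
    rw [Finset.sum_eq_zero, mul_zero, if_pos (by omega), hm]
    · rw [Nat.cast_zero, sub_zero, show (2 * n : ℤ) = ((2 * n : ℕ) : ℤ) by push_cast; ring,
        zpow_natCast]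
      ring
    · intro a _
      have := ht_bounds a
      rw [if_neg (by omega)]
  | succ m ih =>
    obtain ⟨c, hc⟩ := exists_ht_eq (n := n) (h + 1) (by push_cast at hm; omega) (by omega)
    have h1 : ∀ a : VIdx n, (if h < ht a then traceWt q a else 0)
        = (if h + 1 < ht a then traceWt q a else 0) + if a = c then traceWt q c else 0 := by
      intro a
      by_cases hac : a = c
      · rw [if_pos hac, hac, if_pos (by omega), if_neg (by omega), zero_add]
      · have : ht a ≠ ht c := fun h => hac (ht_inj.1 h)
        rw [if_neg hac, add_zero]
        exact if_congr (by omega) rfl rfl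
    rw [Finset.sum_congr rfl fun a _ => h1 a, Finset.sum_add_distrib, mul_add,
      ih (h + 1) (by push_cast at hm; omega) (by omega), Finset.sum_ite_eq', if_pos (Finset.mem_univ c),
      traceWt_eq hq, hc]
    have hc0 : c = 0 ↔ h = -1 := by rw [← ht_eq_zero, hc]; omega
    rcases lt_trichotomy h (-1) with h2 | h2 | h2
    · rw [if_neg (by omega), if_neg (by rw [hc0]; omega), if_neg (by omega), if_neg (by omega)]
      rw [show 2 * (h + 1) + 2 = (2 * h + 2) + 1 + 1 by ring, show 2 * (h + 1) + 1 = (2 * h + 2) + 1 by ring,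
        zpow_add_one₀ hq, zpow_add_one₀ hq]
      field_simp
      ring
    · rw [if_pos (by omega), if_pos (by rw [hc0]; omega), if_neg (by omega), h2]
      norm_num
      ring
    · rw [if_pos (by omega), if_neg (by rw [hc0]; omega), if_pos (by omega), if_pos (by omega)]
      rw [show 2 * (h + 1) = 2 * h + 1 + 1 by ring, add_sub_cancel_right, zpow_add_one₀ hq,
        zpow_add_one₀ hq]
      field_simp
      ring

/-- The quantum superdimension is the parameter `x` of the Birman-Wenzl-Murakami algebra. -/
theorem sum_traceWt_eq_bwX (hq : q ≠ 0) (hq2 : q ^ 2 ≠ 1) :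
    ∑ a : VIdx n, traceWt q a = bwX (-q ^ (2 * n)) q := by
  have hz := sub_inv_ne_zero_of_sq hq hq2
  have h1 := sum_traceWt (n := n) hq (2 * n + 1) (-n - 1) (by push_cast; ring) le_rfl
  rw [if_neg (by omega)] at h1
  have h2 : ∀ a : VIdx n, (if -(n : ℤ) - 1 < ht a then traceWt q a else 0) = traceWt q a := fun a => by
    have := ht_bounds a
    rw [if_pos (by omega)]
  rw [Finset.sum_congr rfl fun a _ => h2 a, show 2 * (-(n : ℤ) - 1) + 2 = -((2 * n : ℕ) : ℤ) by
    push_cast; ring, zpow_neg, zpow_natCast] at h1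
  rw [bwX, inv_neg, ← mul_right_inj' hz, h1]
  field_simp
  ring

/-- The partial quantum supertrace of the rank one operator over the second factor. -/
theorem ptrace_cupCap (hq : q ≠ 0) (b b' : VIdx n) :
    ∑ d, traceWt q d * cupCap q (b, d) (b', d) = if b = b' then 1 else 0 := by
  rw [Finset.sum_eq_single (-b)]
  · rw [cupCap, traceWt]
    have h1 : -b = -b' ↔ b = b' := neg_inj
    have h2 := cupCoef_ne_zero hq b
    have h3 := cupCoef_ne_zero hq (-b)
    by_cases h : b = b'
    · subst h
      rw [if_pos ⟨rfl, rfl⟩, if_pos rfl, neg_neg]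
      field_simp
    · rw [if_neg (fun h' => h (h1.1 h'.2)), if_neg h, mul_zero]
  · intro d _ hd
    rw [cupCap, if_neg (fun h => hd h.1), mul_zero]
  · simp

/-- The partial quantum supertrace of the braiding over the second factor. -/
theorem ptrace_gMat (hq : q ≠ 0) (b b' : VIdx n) :
    ∑ d, traceWt q d * gMat q (b, d) (b', d) = if b = b' then -q ^ (2 * n) else 0 := by
  by_cases h : b = b'
  · subst h
    rw [if_pos rfl]
    have h1 : ∀ d : VIdx n, traceWt q d * gMat q (b, d) (b, d)
        = (if d = b then traceWt q b * swapCoef q b b else 0)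
          + (q - q⁻¹) * (if ht b < ht d then traceWt q d else 0)
          - (if d = -b then if ht b < 0 then q - q⁻¹ else 0 else 0) := by
      intro d
      have h2 := cupCoef_ne_zero hq b
      have h3 := cupCoef_ne_zero hq (-b)
      have e1 : wtPerm q (b, d) (b, d) = if d = b then swapCoef q b b else 0 := by
        rw [wtPerm]
        by_cases hd : d = b
        · rw [hd, if_pos rfl, if_pos rfl]; rfl
        · rw [if_neg hd, if_neg]
          intro h
          exact hd (Prod.ext_iff.1 h).2
      have e2 : traceWt q d * (if ht b < ht d then cupCap q (b, d) (b, d) else 0)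
          = if d = -b then if ht b < 0 then 1 else 0 else 0 := by
        by_cases hd : d = -b
        · subst hd
          have e : cupCap q (b, -b) (b, -b) = cupCoef q (-b) / cupCoef q b := if_pos ⟨rfl, rfl⟩
          rw [ht_neg, if_pos rfl, e, traceWt, neg_neg]
          by_cases hb : ht b < 0
          · have hb' : ht b < -ht b := by omega
            rw [if_pos hb, if_pos hb']
            field_simp
          · have hb' : ¬ ht b < -ht b := by omega
            rw [if_neg hb, if_neg hb', mul_zero]
        · have e : cupCap q (b, d) (b, d) = 0 := if_neg fun h => hd h.1
          rw [e, ite_self, mul_zero, if_neg hd]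
      rw [gMat, e1]
      have e3 : (if d = -b then if ht b < 0 then q - q⁻¹ else 0 else 0)
          = (q - q⁻¹) * if d = -b then if ht b < 0 then 1 else 0 else 0 := by
        split_ifs <;> ring
      rw [e3, ← e2]
      by_cases hd : d = b
      · subst hd
        simp
      · by_cases hlt : ht b < ht d
        · simp only [hd, hlt, if_true, if_false, and_self]
          ring
        · simp only [hd, hlt, if_false, false_and]
          ring
    have hb := ht_bounds b
    rw [Finset.sum_congr rfl fun d _ => h1 d, Finset.sum_sub_distrib, Finset.sum_add_distrib,
      Finset.sum_ite_eq', Finset.sum_ite_eq', if_pos (Finset.mem_univ _), if_pos (Finset.mem_univ _),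
      ← Finset.mul_sum, sum_traceWt hq (n - ht b).toNat (ht b) (by omega) (by omega), traceWt_eq hq,
      swapCoef_eq]
    rcases lt_trichotomy (ht b) 0 with h2 | h2 | h2
    · have hb0 : b ≠ 0 := by rw [Ne, ← ht_eq_zero]; omega
      rw [if_neg hb0, if_neg (by omega), if_neg (by tauto), if_pos rfl, if_neg (by omega), if_pos h2]
      rw [show 2 * ht b + 2 = 2 * ht b + 1 + 1 by ring, zpow_add_one₀ hq (2 * ht b + 1)]
      ring
    · have hb0 : b = 0 := ht_eq_zero.1 h2
      rw [if_pos hb0, if_pos (Or.inl hb0), h2]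
      simp
    · have hb0 : b ≠ 0 := by rw [Ne, ← ht_eq_zero]; omega
      rw [if_neg hb0, if_pos h2, if_neg (by tauto), if_pos rfl, if_pos (by omega), if_neg (by omega)]
      rw [show (2 * ht b) = (2 * ht b - 1) + 1 by ring, zpow_add_one₀ hq, add_sub_cancel_right]
      ring
  · rw [if_neg h]
    refine Finset.sum_eq_zero fun d _ => ?_
    have e1 : ¬ ((b, d) : VIdx n × VIdx n) = (d, b') := fun h' =>
      h ((Prod.ext_iff.1 h').1.trans (Prod.ext_iff.1 h').2)
    have e2 : ¬ (ht b' < ht d ∧ ((b, d) : VIdx n × VIdx n) = (b', d)) := fun h' =>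
      h (Prod.ext_iff.1 h'.2).1
    have e3 : ¬ (d = -b ∧ d = -b') := fun h' => h (neg_inj.1 (h'.1.symm.trans h'.2))
    rw [gMat, wtPerm, if_neg e1, if_neg e2, cupCap, if_neg e3, ite_self]
    ring

theorem ptrace_gInv (hq : q ≠ 0) (hq2 : q ^ 2 ≠ 1) (b b' : VIdx n) :
    ∑ d, traceWt q d * gInv q (b, d) (b', d) = if b = b' then (-q ^ (2 * n))⁻¹ else 0 := by
  have hz := sub_inv_ne_zero_of_sq hq hq2
  have h1 : ∀ d, traceWt q d * gInv q (b, d) (b', d) = traceWt q d * gMat q (b, d) (b', d)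
      - (q - q⁻¹) * ((if b = b' then traceWt q d else 0) - traceWt q d * cupCap q (b, d) (b', d)) := by
    intro d
    rw [gInv, Matrix.sub_apply, Matrix.smul_apply, Matrix.sub_apply, Matrix.one_apply, smul_eq_mul]
    by_cases h : b = b'
    · rw [if_pos h, if_pos (by rw [h])]; ring
    · rw [if_neg h, if_neg (fun h' => h (Prod.ext_iff.1 h').1)]; ring
  rw [Finset.sum_congr rfl fun d _ => h1 d, Finset.sum_sub_distrib, ← Finset.mul_sum,
    Finset.sum_sub_distrib, ptrace_gMat hq, ptrace_cupCap hq]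
  by_cases h : b = b'
  · simp only [h, if_true]
    rw [sum_traceWt_eq_bwX hq hq2, bwX, mul_sub, mul_add, mul_div_cancel₀ _ hz]
    ring
  · simp [h]

end

section
variable {n : ℕ} {q : ℂ}

/-- Contracting an operator on the first two factors between rank one operators on the last two
factors takes its partial quantum supertrace. -/
theorem cupCap_leg12_cupCap (M : EndVV n) (x y : (VIdx n × VIdx n) × VIdx n) :
    (leg23 (cupCap q) * leg12 M * leg23 (cupCap q) :
      Matrix ((VIdx n × VIdx n) × VIdx n) ((VIdx n × VIdx n) × VIdx n) ℂ) x y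
      = (∑ d, traceWt q d * M (x.1.1, d) (y.1.1, d)) * cupCap q (x.1.2, x.2) (y.1.2, y.2) := by
  have h0 : ∀ N : Matrix ((VIdx n × VIdx n) × VIdx n) ((VIdx n × VIdx n) × VIdx n) ℂ,
      N x y = N.mulVec (Pi.single y 1) x := by
    intro N
    rw [Matrix.mulVec_single_one]
    rfl
  have h1 : ∀ s, (leg23 (cupCap q)).mulVec (Pi.single y 1) s
      = (1 : EndV n) s.1.1 y.1.1 * cupCap q (s.1.2, s.2) (y.1.2, y.2) := by
    intro s
    rw [Matrix.mulVec_single_one]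
    rfl
  rw [h0 (_ * _), ← Matrix.mulVec_mulVec, ← Matrix.mulVec_mulVec, leg23_mulVec, Fintype.sum_prod_type,
    Finset.sum_mul]
  refine Finset.sum_congr rfl fun d _ => ?_
  rw [Finset.sum_eq_single (-d)]
  · rw [leg12_mulVec, Finset.sum_eq_single (y.1.1, d)]
    · rw [h1, Matrix.one_apply_eq, one_mul, cupCap, cupCap, cupCap, traceWt]
      simp only [true_and, and_true]
      by_cases e1 : x.2 = -x.1.2 <;> by_cases e2 : y.2 = -y.1.2 <;> simp only [e1, e2, and_self,
        and_true, and_false, if_true, if_false, mul_zero, zero_mul]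
      ring
    · rintro ⟨s1, s2⟩ _ hs
      rw [h1]
      by_cases e1 : s1 = y.1.1
      · have e2 : ¬ (-d = -s2 ∧ y.2 = -y.1.2) := by
          rintro ⟨h, -⟩
          exact hs (by rw [e1, neg_inj.1 h])
        simp only [cupCap, e2, if_false, mul_zero]
      · simp only [Matrix.one_apply_ne e1, zero_mul, mul_zero]
    · simp
  · intro d' _ hd'
    have e2 : ¬ (x.2 = -x.1.2 ∧ d' = -d) := fun h => hd' h.2
    simp only [cupCap, e2, if_false, zero_mul]
  · simp

theorem cupCap_leg12_cupCap_of_ptrace {M : EndVV n} {u : ℂ}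
    (hM : ∀ b b', ∑ d, traceWt q d * M (b, d) (b', d) = if b = b' then u else 0) :
    leg23 (cupCap q) * leg12 M * leg23 (cupCap q) = u • leg23 (cupCap q) := by
  ext x y
  rw [cupCap_leg12_cupCap, hM, Matrix.smul_apply, leg23_apply, Matrix.one_apply, smul_eq_mul]
  split_ifs <;> ring

/-! ### Operators on tensor powers -/

/-- Operators on one factor of a tensor product, where a bijection `Φ` of index sets exhibits a space
as the tensor product. -/
def locHom {X S C : Type*} [Fintype X] [DecidableEq X] [Fintype S] [DecidableEq S] [Fintype C]
    [DecidableEq C] (Φ : X ≃ S × C) : Matrix S S ℂ →ₐ[ℂ] Matrix X X ℂ :=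
  (Matrix.reindexAlgEquiv ℂ ℂ Φ).symm.toAlgHom.comp
    { toFun := fun M => M ⊗ₖ (1 : Matrix C C ℂ)
      map_one' := Matrix.one_kronecker_one
      map_mul' := fun M N => by rw [← Matrix.mul_kronecker_mul, one_mul]
      map_zero' := Matrix.zero_kronecker _
      map_add' := fun M N => Matrix.add_kronecker _ _ _
      commutes' := fun r => by
        rw [Algebra.algebraMap_eq_smul_one, Algebra.algebraMap_eq_smul_one, Matrix.smul_kronecker,
          Matrix.one_kronecker_one] }

theorem locHom_apply {X S C : Type*} [Fintype X] [DecidableEq X] [Fintype S] [DecidableEq S]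
    [Fintype C] [DecidableEq C] (Φ : X ≃ S × C) (M : Matrix S S ℂ) (a b : X) :
    locHom Φ M a b = if (Φ a).2 = (Φ b).2 then M (Φ a).1 (Φ b).1 else 0 := by
  change M (Φ a).1 (Φ b).1 * (1 : Matrix C C ℂ) (Φ a).2 (Φ b).2 = _
  rw [Matrix.one_apply, mul_ite, mul_one, mul_zero]

/-- Splitting off the factors `i` and `i + 1` of a tensor power. -/
def pairEquiv (n t i : ℕ) (h : i + 1 < t) : (Fin t → VIdx n) ≃
    (VIdx n × VIdx n) × ({j : Fin t // (j : ℕ) ≠ i ∧ (j : ℕ) ≠ i + 1} → VIdx n) where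
  toFun a := ((a ⟨i, by omega⟩, a ⟨i + 1, h⟩), fun j => a j)
  invFun p j := if h1 : (j : ℕ) = i then p.1.1 else if h2 : (j : ℕ) = i + 1 then p.1.2 else
    p.2 ⟨j, h1, h2⟩
  left_inv a := by
    funext j
    dsimp only
    split_ifs with h1 h2
    · exact congrArg a (Fin.ext h1.symm)
    · exact congrArg a (Fin.ext h2.symm)
    · rfl
  right_inv p := by
    refine Prod.ext (Prod.ext ?_ ?_) (funext fun j => ?_)
    · simp
    · simp
    · simp [j.2.1, j.2.2]

/-- Splitting off the factors `i`, `i + 1` and `i + 2` of a tensor power. -/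
def tripleEquiv (n t i : ℕ) (h : i + 1 + 1 < t) : (Fin t → VIdx n) ≃
    ((VIdx n × VIdx n) × VIdx n) ×
      ({j : Fin t // (j : ℕ) ≠ i ∧ (j : ℕ) ≠ i + 1 ∧ (j : ℕ) ≠ i + 1 + 1} → VIdx n) where
  toFun a := (((a ⟨i, by omega⟩, a ⟨i + 1, by omega⟩), a ⟨i + 1 + 1, h⟩), fun j => a j)
  invFun p j := if h1 : (j : ℕ) = i then p.1.1.1 else if h2 : (j : ℕ) = i + 1 then p.1.1.2 else
    if h3 : (j : ℕ) = i + 1 + 1 then p.1.2 else p.2 ⟨j, h1, h2, h3⟩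
  left_inv a := by
    funext j
    dsimp only
    split_ifs with h1 h2 h3
    · exact congrArg a (Fin.ext h1.symm)
    · exact congrArg a (Fin.ext h2.symm)
    · exact congrArg a (Fin.ext h3.symm)
    · rfl
  right_inv p := by
    refine Prod.ext (Prod.ext (Prod.ext ?_ ?_) ?_) (funext fun j => ?_)
    · simp
    · simp
    · have h1 : ¬ i + 1 + 1 = i := by omega
      simp [h1]
    · simp [j.2.1, j.2.2.1, j.2.2.2]

/-- `onFactors` as a homomorphism of algebras. -/
def onFactorsHom (n t i : ℕ) (h : i + 1 < t) : EndVV n →ₐ[ℂ] EndVt n t := locHom (pairEquiv n t i h)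

theorem onFactorsHom_apply (t i : ℕ) (h : i + 1 < t) (M : EndVV n) :
    onFactorsHom n t i h M = onFactors M t i h := by
  ext a b
  rw [onFactorsHom, locHom_apply, onFactors]
  refine if_congr ?_ rfl rfl
  rw [funext_iff]
  exact ⟨fun H j h1 h2 => H ⟨j, h1, h2⟩, fun H j => H j j.2.1 j.2.2⟩

theorem locHom_leg12 (t i : ℕ) (h : i + 1 + 1 < t) (M : EndVV n) :
    locHom (tripleEquiv n t i h) (leg12 M) = onFactors M t i (by omega) := by
  ext a b
  rw [locHom_apply, onFactors, leg12, Matrix.kroneckerMap_apply, Matrix.one_apply, mul_ite, mul_one,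
    mul_zero, ← ite_and]
  refine if_congr ?_ rfl rfl
  rw [funext_iff]
  constructor
  · rintro ⟨H, H2⟩ j h1 h2
    by_cases h3 : (j : ℕ) = i + 1 + 1
    · rw [show j = ⟨i + 1 + 1, h⟩ from Fin.ext h3]; exact H2
    · exact H ⟨j, h1, h2, h3⟩
  · intro H
    exact ⟨fun j => H j j.2.1 j.2.2.1, H ⟨i + 1 + 1, h⟩ (by simp; omega) (by simp)⟩

theorem locHom_leg23 (t i : ℕ) (h : i + 1 + 1 < t) (M : EndVV n) :
    locHom (tripleEquiv n t i h) (leg23 M) = onFactors M t (i + 1) h := by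
  ext a b
  rw [locHom_apply, onFactors, leg23_apply, Matrix.one_apply, ite_mul, one_mul,
    zero_mul, ← ite_and]
  refine if_congr ?_ rfl rfl
  rw [funext_iff]
  constructor
  · rintro ⟨H, H2⟩ j h1 h2
    by_cases h3 : (j : ℕ) = i
    · rw [show j = ⟨i, by omega⟩ from Fin.ext h3]; exact H2
    · exact H ⟨j, h3, h1, h2⟩
  · intro H
    exact ⟨fun j => H j j.2.2.1 j.2.2.2, H ⟨i, by omega⟩ (by simp) (by simp; omega)⟩

theorem onFactors_mul_apply {t i j : ℕ} (hi : i + 1 < t) (hj : j + 1 < t) (hij : i + 1 < j ∨ j + 1 < i)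
    (M N : EndVV n) (a b : Fin t → VIdx n) :
    (onFactors M t i hi * onFactors N t j hj) a b =
      if ∀ k : Fin t, (k : ℕ) ≠ i → (k : ℕ) ≠ i + 1 → (k : ℕ) ≠ j → (k : ℕ) ≠ j + 1 → a k = b k then
        M (a ⟨i, by omega⟩, a ⟨i + 1, hi⟩) (b ⟨i, by omega⟩, b ⟨i + 1, hi⟩)
          * N (a ⟨j, by omega⟩, a ⟨j + 1, hj⟩) (b ⟨j, by omega⟩, b ⟨j + 1, hj⟩)
      else 0 := by
  set c0 : Fin t → VIdx n := fun k => if (k : ℕ) = i ∨ (k : ℕ) = i + 1 then b k else a k with hc0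
  rw [Matrix.mul_apply, Finset.sum_eq_single c0]
  · have h1 : onFactors M t i hi a c0
        = M (a ⟨i, by omega⟩, a ⟨i + 1, hi⟩) (b ⟨i, by omega⟩, b ⟨i + 1, hi⟩) := by
      rw [onFactors, if_pos]
      · simp [hc0]
      · intro k h1 h2
        simp [hc0, h1, h2]
    have h2 : c0 ⟨j, by omega⟩ = a ⟨j, by omega⟩ := if_neg (by simp only; omega)
    have h3 : c0 ⟨j + 1, hj⟩ = a ⟨j + 1, hj⟩ := if_neg (by simp only; omega)
    rw [h1, onFactors, h2, h3, mul_ite, mul_zero]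
    refine if_congr ⟨fun H k k1 k2 k3 k4 => ?_, fun H k k3 k4 => ?_⟩ rfl rfl
    · have := H k k3 k4
      simpa [hc0, k1, k2] using this
    · by_cases hk : (k : ℕ) = i ∨ (k : ℕ) = i + 1
      · exact if_pos hk
      · rw [not_or] at hk
        rw [← H k hk.1 hk.2 k3 k4]
        exact if_neg (not_or.2 hk)
  · intro c _ hc
    by_cases h1 : ∀ k : Fin t, (k : ℕ) ≠ i → (k : ℕ) ≠ i + 1 → a k = c k
    · by_cases h2 : ∀ k : Fin t, (k : ℕ) ≠ j → (k : ℕ) ≠ j + 1 → c k = b k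
      · exfalso
        refine hc (funext fun k => ?_)
        simp only [hc0]
        split_ifs with hk
        · exact h2 k (by omega) (by omega)
        · rw [not_or] at hk
          exact (h1 k hk.1 hk.2).symm
      · rw [onFactors, onFactors, if_neg h2, mul_zero]
    · rw [onFactors, if_neg h1, zero_mul]
  · simp

theorem onFactors_comm {t i j : ℕ} (hi : i + 1 < t) (hj : j + 1 < t) (hij : i + 1 < j ∨ j + 1 < i)
    (M N : EndVV n) :
    onFactors M t i hi * onFactors N t j hj = onFactors N t j hj * onFactors M t i hi := by
  ext a b
  rw [onFactors_mul_apply hi hj hij, onFactors_mul_apply hj hi hij.symm, mul_comm]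
  exact if_congr ⟨fun H k k1 k2 k3 k4 => H k k3 k4 k1 k2, fun H k k1 k2 k3 k4 => H k k3 k4 k1 k2⟩
    rfl rfl

/-! ### The representation of the Birman-Wenzl-Murakami algebra -/

/-- The action of the generators of the Birman-Wenzl-Murakami algebra on `V^{⊗t}`. -/
def freeRep (n t : ℕ) (q : ℂ) : FreeAlgebra ℂ (BWGen t) →ₐ[ℂ] EndVt n t :=
  FreeAlgebra.lift ℂ fun x => match x with
    | BWGen.g i h => onFactors (gMat q) t i h
    | BWGen.ginv i h => onFactors (gInv q) t i h

theorem freeRep_g (t i : ℕ) (h : i + 1 < t) : freeRep n t q (freeG t i h) = onFactors (gMat q) t i h := by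
  simp [freeRep, freeG]

theorem freeRep_ginv (t i : ℕ) (h : i + 1 < t) :
    freeRep n t q (freeGinv t i h) = onFactors (gInv q) t i h := by
  simp [freeRep, freeGinv]

theorem freeRep_e (hq : q - q⁻¹ ≠ 0) (t i : ℕ) (h : i + 1 < t) :
    freeRep n t q (freeE q t i h) = onFactors (cupCap q) t i h := by
  rw [freeE, map_sub, map_one, map_smul, map_sub, freeRep_g, freeRep_ginv]
  simp only [← onFactorsHom_apply]
  rw [← map_sub, ← map_one (onFactorsHom n t i h), ← map_smul, ← map_sub, gInv, sub_sub_cancel, smul_smul,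
    inv_mul_cancel₀ hq, one_smul, sub_sub_cancel]

/-- The operators on `V^{⊗t}` satisfy the relations of the Birman-Wenzl-Murakami algebra. -/
theorem freeRep_rel (hn : 1 ≤ n) (hq : q ≠ 0) (hq2 : q ^ 2 ≠ 1) (t : ℕ)
    {x y : FreeAlgebra ℂ (BWGen t)} (h : BWRel t (-q ^ (2 * n)) q x y) :
    freeRep n t q x = freeRep n t q y := by
  have hz := sub_inv_ne_zero_of_sq hq hq2
  cases h with
  | mul_inv i h =>
    rw [map_mul, map_one, freeRep_g, freeRep_ginv, ← onFactorsHom_apply, ← onFactorsHom_apply,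
      ← map_mul, gMat_mul_gInv hn hq, map_one]
  | inv_mul i h =>
    rw [map_mul, map_one, freeRep_g, freeRep_ginv, ← onFactorsHom_apply, ← onFactorsHom_apply,
      ← map_mul, gInv_mul_gMat hn hq, map_one]
  | comm i j hi hj hij =>
    rw [map_mul, map_mul, freeRep_g, freeRep_g, onFactors_comm hi hj hij]
  | braid i hi hi' =>
    simp only [map_mul, freeRep_g]
    rw [← locHom_leg12 t i hi', ← locHom_leg23 t i hi', ← map_mul, ← map_mul, gMat_braid hq, map_mul,
      map_mul]
  | e_mul_g i h =>
    rw [map_mul, map_smul, freeRep_g, freeRep_e hz, ← onFactorsHom_apply, ← onFactorsHom_apply,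
      ← map_mul, cupCap_mul_gMat hn hq, map_smul]
  | e_g_e i hi hi' =>
    simp only [map_mul, map_smul, freeRep_g, freeRep_e hz]
    rw [← locHom_leg12 t i hi', ← locHom_leg23 t i hi', ← map_mul, ← map_mul,
      cupCap_leg12_cupCap_of_ptrace (ptrace_gMat hq), map_smul]
  | e_ginv_e i hi hi' =>
    simp only [map_mul, map_smul, freeRep_ginv, freeRep_e hz]
    rw [← locHom_leg12 t i hi', ← locHom_leg23 t i hi', ← map_mul, ← map_mul,
      cupCap_leg12_cupCap_of_ptrace (ptrace_gInv hq hq2), map_smul]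

end

section
variable {n : ℕ} {q : ℂ}

/-- The inverse generator of the Birman-Wenzl-Murakami algebra. -/
def bwGinv (t : ℕ) (r q : ℂ) (i : ℕ) (h : i + 1 < t) : BW t r q :=
  RingQuot.mkAlgHom ℂ (BWRel t r q) (freeGinv t i h)

theorem bw_adjoin (t : ℕ) (r q : ℂ) : Algebra.adjoin ℂ
    {X : BW t r q | ∃ (i : ℕ) (h : i + 1 < t), X = bwG t r q i h ∨ X = bwGinv t r q i h} = ⊤ := by
  rw [eq_top_iff, ← (AlgHom.range_eq_top _).2 (RingQuot.mkAlgHom_surjective ℂ (BWRel t r q)),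
    ← Algebra.map_top, ← FreeAlgebra.adjoin_range_ι, AlgHom.map_adjoin]
  refine Algebra.adjoin_mono ?_
  rintro _ ⟨_, ⟨x, rfl⟩, rfl⟩
  cases x with
  | g i h => exact ⟨i, h, Or.inl rfl⟩
  | ginv i h => exact ⟨i, h, Or.inr rfl⟩

/-- The representation of the Birman-Wenzl-Murakami algebra on `V^{⊗t}`, `g_i ↦ -Ř_i`. -/
def bwRep (hn : 1 ≤ n) (hq : q ≠ 0) (hq2 : q ^ 2 ≠ 1) (t : ℕ) :
    BW t (-q ^ (2 * n)) q →ₐ[ℂ] EndVt n t :=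
  RingQuot.liftAlgHom ℂ ⟨freeRep n t q, fun _ _ h => freeRep_rel hn hq hq2 t h⟩

section
variable (hn : 1 ≤ n) (hq : q ≠ 0) (hq2 : q ^ 2 ≠ 1)

theorem bwRep_g (t i : ℕ) (h : i + 1 < t) :
    bwRep hn hq hq2 t (bwG t _ q i h) = onFactors (gMat q) t i h := by
  rw [bwRep, bwG, RingQuot.liftAlgHom_mkAlgHom_apply, freeRep_g]

theorem bwRep_ginv (t i : ℕ) (h : i + 1 < t) :
    bwRep hn hq hq2 t (bwGinv t _ q i h) = onFactors (gInv q) t i h := by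
  rw [bwRep, bwGinv, RingQuot.liftAlgHom_mkAlgHom_apply, freeRep_ginv]

theorem bwRep_e (t i : ℕ) (h : i + 1 < t) :
    bwRep hn hq hq2 t (bwE t _ q i h) = onFactors (cupCap q) t i h := by
  rw [bwRep, bwE, RingQuot.liftAlgHom_mkAlgHom_apply, freeRep_e (sub_inv_ne_zero_of_sq hq hq2)]

theorem bwRep_range (t : ℕ) : (bwRep hn hq hq2 t).range = Algebra.adjoin ℂ
    {X | ∃ (i : ℕ) (h : i + 1 < t), X = onFactors (gMat q) t i h ∨ X = onFactors (gInv q) t i h} := by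
  rw [← Algebra.map_top, ← bw_adjoin, AlgHom.map_adjoin]
  congr 1
  ext X
  constructor
  · rintro ⟨_, ⟨i, h, rfl | rfl⟩, rfl⟩
    · exact ⟨i, h, Or.inl (bwRep_g hn hq hq2 t i h)⟩
    · exact ⟨i, h, Or.inr (bwRep_ginv hn hq hq2 t i h)⟩
  · rintro ⟨i, h, rfl | rfl⟩
    · exact ⟨_, ⟨i, h, Or.inl rfl⟩, bwRep_g hn hq hq2 t i h⟩
    · exact ⟨_, ⟨i, h, Or.inr rfl⟩, bwRep_ginv hn hq hq2 t i h⟩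

end

theorem neg_rCheckAt (hq : q ≠ 0) (hq2 : q ^ 2 ≠ 1) {L : List (Fin n → ℤ)} (hL : IsNormalOrdering n L)
    {E F : (Fin n → ℤ) → EndV n} (hEF : IsRootVectors n q L E F) (t i : ℕ) (h : i + 1 < t) :
    -rCheckAt n q L E F t i h = onFactors (gMat q) t i h := by
  rw [rCheckAt, ← neg_rCheck_eq_gMat hq hq2 hL hEF, ← onFactorsHom_apply, ← onFactorsHom_apply, map_neg]

theorem range_bwRep_eq_algC (hn : 1 ≤ n) (hq : q ≠ 0) (hq2 : q ^ 2 ≠ 1) {L : List (Fin n → ℤ)}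
    (hL : IsNormalOrdering n L) {E F : (Fin n → ℤ) → EndV n} (hEF : IsRootVectors n q L E F) (t : ℕ) :
    (bwRep hn hq hq2 t).range = algC n q L E F t := by
  have hR : ∀ i h, rCheckAt n q L E F t i h = -onFactors (gMat q) t i h := fun i h => by
    rw [← neg_rCheckAt hq hq2 hL hEF, neg_neg]
  have h1 : ∀ i h, onFactors (gInv (n := n) q) t i h * onFactors (gMat q) t i h = 1 := fun i h => by
    rw [← onFactorsHom_apply, ← onFactorsHom_apply, ← map_mul, gInv_mul_gMat hn hq, map_one]
  have h2 : ∀ i h, onFactors (gMat (n := n) q) t i h * onFactors (gInv q) t i h = 1 := fun i h => by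
    rw [← onFactorsHom_apply, ← onFactorsHom_apply, ← map_mul, gMat_mul_gInv hn hq, map_one]
  rw [bwRep_range, algC]
  refine le_antisymm (Algebra.adjoin_le ?_) (Algebra.adjoin_le ?_)
  · rintro _ ⟨i, h, rfl | rfl⟩
    · rw [← neg_neg (onFactors (gMat q) t i h), ← hR]
      exact neg_mem (Algebra.subset_adjoin ⟨i, h, Or.inl rfl⟩)
    · rw [← neg_neg (onFactors (gInv q) t i h)]
      refine neg_mem (Algebra.subset_adjoin ⟨i, h, Or.inr ⟨?_, ?_⟩⟩)
      · rw [hR, neg_mul_neg, h1]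
      · rw [hR, neg_mul_neg, h2]
  · rintro X ⟨i, h, rfl | ⟨hX, -⟩⟩
    · rw [hR]
      exact neg_mem (Algebra.subset_adjoin ⟨i, h, Or.inl rfl⟩)
    · have h3 : X = -onFactors (gInv q) t i h := by
        have h4 : X * rCheckAt n q L E F t i h * -onFactors (gInv q) t i h = -onFactors (gInv q) t i h := by
          rw [hX, one_mul]
        rwa [mul_assoc, hR, neg_mul_neg, h2, mul_one] at h4
      rw [h3]
      exact neg_mem (Algebra.subset_adjoin ⟨i, h, Or.inr rfl⟩)

/-! ### The quantum supertrace -/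

/-- The diagonal entries of `K_{2ρ}`, with the signs of the supertrace, are the `traceWt`. -/
theorem traceWt_eq_sign_mul (hq : q ≠ 0) (a : VIdx n) :
    (-1) ^ parity a * q ^ (twoRho n ⬝ᵥ eps n a) = traceWt q a := by
  have h1 : ∀ b : VIdx n, 0 < ht b → twoRho n ⬝ᵥ eps n b = 2 * ht b - 1 := by
    intro b hb
    have hb0 := ht_pos.1 hb
    have hb1 := b.bounds
    rw [dotProduct_comm, eps_dot (twoRho n) b ⟨((b : ℤ) - 1).toNat, by omega⟩ (by simp; omega), twoRho, ht, if_pos hb0]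
    simp only
    omega
  rw [traceWt_eq hq, parity_eq]
  rcases lt_trichotomy (ht a) 0 with h | h | h
  · have h0 : a ≠ 0 := by rw [Ne, ← ht_eq_zero]; omega
    have h2 := h1 (-a) (by rw [ht_neg]; omega)
    rw [VIdx.coe_neg, eps_neg, dotProduct_neg, ht_neg] at h2
    have h3 : twoRho n ⬝ᵥ eps n a = 2 * ht a + 1 := by omega
    rw [if_neg h0, if_neg h0, if_neg (by omega), h3]
    ring
  · have h0 : a = 0 := ht_eq_zero.1 h
    rw [if_pos h0, if_pos h0, h0, VIdx.coe_zero, eps_zero, dotProduct_zero]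
    simp
  · have h0 : a ≠ 0 := by rw [Ne, ← ht_eq_zero]; omega
    rw [if_neg h0, if_neg h0, if_pos h, h1 a h]
    ring

theorem qSupertrace_apply (hq : q ≠ 0) (t : ℕ) (X : EndVt n t) :
    qSupertrace n q t X = ∑ a, (∏ j, traceWt q (a j)) * X a a := by
  rw [qSupertrace, supertrace, kVt]
  simp only [LinearMap.comp_apply, LinearMap.mulLeft_apply, Matrix.traceLinearMap_apply, Matrix.trace,
    Matrix.diag_apply, Matrix.diagonal_mul]
  refine Finset.sum_congr rfl fun a _ => ?_
  rw [← mul_assoc]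
  congr 1
  rw [← Finset.prod_pow_eq_pow_sum, ← Finset.prod_mul_distrib]
  refine Finset.prod_congr rfl fun j _ => ?_
  rw [← traceWt_eq_sign_mul hq, kV, Matrix.diagonal_apply_eq]

theorem traceWt_mul_neg (hq : q ≠ 0) (a : VIdx n) : traceWt q a * traceWt q (-a) = 1 := by
  have h1 := cupCoef_ne_zero hq a
  have h2 := cupCoef_ne_zero hq (-a)
  rw [traceWt, traceWt, neg_neg]
  field_simp

/-- The weights of the quantum supertrace commute with the braiding. -/
theorem commute_diagonal_onFactors (hq : q ≠ 0) (t i : ℕ) (h : i + 1 < t) :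
    Commute (Matrix.diagonal fun a : Fin t → VIdx n => ∏ j, traceWt q (a j)) (onFactors (gMat q) t i h) := by
  ext a b
  rw [Matrix.mul_diagonal, Matrix.diagonal_mul, onFactors]
  split_ifs with hab
  · set s : Finset (Fin t) := {⟨i, by omega⟩, ⟨i + 1, h⟩} with hs
    have hp : ∀ c : Fin t → VIdx n, ∏ j, traceWt q (c j)
        = (traceWt q (c ⟨i, by omega⟩) * traceWt q (c ⟨i + 1, h⟩)) * ∏ j ∈ sᶜ, traceWt q (c j) := by
      intro c
      rw [← Finset.prod_mul_prod_compl s, hs, Finset.prod_pair]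
      simp
    have h1 : ∏ j ∈ sᶜ, traceWt q (a j) = ∏ j ∈ sᶜ, traceWt q (b j) := by
      refine Finset.prod_congr rfl fun j hj => ?_
      rw [hs, Finset.mem_compl, Finset.mem_insert, Finset.mem_singleton, not_or, Fin.ext_iff,
        Fin.ext_iff] at hj
      rw [hab j hj.1 hj.2]
    have h2 := mul_gMat_apply (q := q) (traceWt_mul_neg hq) (a ⟨i, by omega⟩, a ⟨i + 1, h⟩)
      (b ⟨i, by omega⟩, b ⟨i + 1, h⟩)
    rw [hp a, hp b, h1]
    simp only at h2
    linear_combination (∏ j ∈ sᶜ, traceWt q (b j)) * h2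
  · rw [mul_zero, zero_mul]

/-- The quantum supertrace is a trace on the image of the Birman-Wenzl-Murakami algebra, as the image
commutes with the diagonal operator of the weights. -/
theorem qSupertrace_mul_comm (hn : 1 ≤ n) (hq : q ≠ 0) (hq2 : q ^ 2 ≠ 1) (t : ℕ)
    {X : EndVt n t} (hX : X ∈ (bwRep hn hq hq2 t).range) (Y : EndVt n t) :
    qSupertrace n q t (X * Y) = qSupertrace n q t (Y * X) := by
  set D : EndVt n t := Matrix.diagonal fun a => ∏ j, traceWt q (a j) with hD
  have h1 : ∀ Z, qSupertrace n q t Z = (D * Z).trace := by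
    intro Z
    rw [qSupertrace_apply hq, Matrix.trace]
    exact Finset.sum_congr rfl fun a _ => by rw [Matrix.diag_apply, Matrix.diagonal_mul]
  have h2 : (bwRep hn hq hq2 t).range ≤ Subalgebra.centralizer ℂ {D} := by
    rw [bwRep_range]
    refine Algebra.adjoin_le ?_
    have h3 : ∀ i h, Commute D (onFactors (gMat q) t i h) := commute_diagonal_onFactors hq t
    rintro _ ⟨i, h, rfl | rfl⟩
    · rw [SetLike.mem_coe, Subalgebra.mem_centralizer_iff]
      rintro _ rfl
      exact (h3 i h).eq
    · rw [SetLike.mem_coe, Subalgebra.mem_centralizer_iff]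
      rintro _ rfl
      have h4 : onFactors (gInv (n := n) q) t i h * onFactors (gMat q) t i h = 1 := by
        rw [← onFactorsHom_apply, ← onFactorsHom_apply, ← map_mul, gInv_mul_gMat hn hq, map_one]
      have h5 : onFactors (gMat (n := n) q) t i h * onFactors (gInv q) t i h = 1 := by
        rw [← onFactorsHom_apply, ← onFactorsHom_apply, ← map_mul, gMat_mul_gInv hn hq, map_one]
      let u : (EndVt n t)ˣ := ⟨onFactors (gMat q) t i h, onFactors (gInv q) t i h, h5, h4⟩
      exact (Commute.units_inv_right (u := u) (h3 i h)).eq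
  have h3 : D * X = X * D := (Subalgebra.mem_centralizer_iff ℂ).1 (h2 hX) D rfl
  rw [h1, h1, ← mul_assoc, h3, mul_assoc, Matrix.trace_mul_comm, mul_assoc]

/-! ### The Markov property -/

/-- Splitting off the last factor of a tensor power. -/
def lastEquiv (n t : ℕ) : (Fin (t + 1) → VIdx n) ≃ (Fin t → VIdx n) × VIdx n where
  toFun a := (Fin.init a, a (Fin.last t))
  invFun p := Fin.snoc (α := fun _ => VIdx n) p.1 p.2
  left_inv a := Fin.snoc_init_self a
  right_inv _ := Prod.ext (Fin.init_snoc (α := fun _ => VIdx n) _ _)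
    (Fin.snoc_last (α := fun _ => VIdx n) _ _)

/-- The partial quantum supertrace over the last factor. -/
def ptraceLast {n : ℕ} (q : ℂ) (t : ℕ) (Y : EndVt n (t + 1)) : EndVt n t := fun a b =>
  ∑ d, traceWt q d * Y ((lastEquiv n t).symm (a, d)) ((lastEquiv n t).symm (b, d))

theorem qSupertrace_succ (hq : q ≠ 0) (t : ℕ) (Y : EndVt n (t + 1)) :
    qSupertrace n q (t + 1) Y = qSupertrace n q t (ptraceLast q t Y) := by
  rw [qSupertrace_apply hq, qSupertrace_apply hq, ← (lastEquiv n t).symm.sum_comp, Fintype.sum_prod_type]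
  refine Finset.sum_congr rfl fun a _ => ?_
  rw [ptraceLast, Finset.mul_sum]
  refine Finset.sum_congr rfl fun d _ => ?_
  rw [← mul_assoc, Fin.prod_univ_castSucc]
  congr 2
  · refine Finset.prod_congr rfl fun j _ => ?_
    simp [lastEquiv]
  · simp [lastEquiv]

theorem ptraceLast_mul_left (t : ℕ) (X : EndVt n t) (Y : EndVt n (t + 1)) :
    ptraceLast q t (locHom (lastEquiv n t) X * Y) = X * ptraceLast q t Y := by
  ext a b
  have h1 : ∀ d, (locHom (lastEquiv n t) X * Y) ((lastEquiv n t).symm (a, d)) ((lastEquiv n t).symm (b, d))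
      = ∑ c, X a c * Y ((lastEquiv n t).symm (c, d)) ((lastEquiv n t).symm (b, d)) := by
    intro d
    rw [Matrix.mul_apply, ← (lastEquiv n t).symm.sum_comp, Fintype.sum_prod_type]
    refine Finset.sum_congr rfl fun c _ => ?_
    rw [Finset.sum_eq_single d]
    · rw [locHom_apply, Equiv.apply_symm_apply, Equiv.apply_symm_apply, if_pos rfl]
    · intro d' _ hd
      rw [locHom_apply, Equiv.apply_symm_apply, Equiv.apply_symm_apply, if_neg hd.symm, zero_mul]
    · simp
  rw [ptraceLast, Matrix.mul_apply, Finset.sum_congr rfl fun d _ => congrArg _ (h1 d)]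
  simp only [ptraceLast, Finset.mul_sum]
  rw [Finset.sum_comm]
  exact Finset.sum_congr rfl fun c _ => Finset.sum_congr rfl fun d _ => by ring

theorem ptraceLast_mul_right (t : ℕ) (X : EndVt n t) (Y : EndVt n (t + 1)) :
    ptraceLast q t (Y * locHom (lastEquiv n t) X) = ptraceLast q t Y * X := by
  ext a b
  have h1 : ∀ d, (Y * locHom (lastEquiv n t) X) ((lastEquiv n t).symm (a, d)) ((lastEquiv n t).symm (b, d))
      = ∑ c, Y ((lastEquiv n t).symm (a, d)) ((lastEquiv n t).symm (c, d)) * X c b := by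
    intro d
    rw [Matrix.mul_apply, ← (lastEquiv n t).symm.sum_comp, Fintype.sum_prod_type]
    refine Finset.sum_congr rfl fun c _ => ?_
    rw [Finset.sum_eq_single d]
    · rw [locHom_apply, Equiv.apply_symm_apply, Equiv.apply_symm_apply, if_pos rfl]
    · intro d' _ hd
      rw [locHom_apply, Equiv.apply_symm_apply, Equiv.apply_symm_apply, if_neg hd, mul_zero]
    · simp
  rw [ptraceLast, Matrix.mul_apply, Finset.sum_congr rfl fun d _ => congrArg _ (h1 d)]
  simp only [ptraceLast, Finset.mul_sum, Finset.sum_mul]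
  rw [Finset.sum_comm]
  exact Finset.sum_congr rfl fun c _ => Finset.sum_congr rfl fun d _ => by ring

theorem ptraceLast_one (t : ℕ) : ptraceLast q t (1 : EndVt n (t + 1)) = (∑ a : VIdx n, traceWt q a) • 1 := by
  ext a b
  rw [ptraceLast, Matrix.smul_apply, smul_eq_mul, Matrix.one_apply, Finset.sum_mul]
  refine Finset.sum_congr rfl fun d _ => ?_
  rw [Matrix.one_apply]
  congr 1
  exact if_congr (by rw [(lastEquiv n t).symm.injective.eq_iff, Prod.ext_iff]; simp) rfl rfl

theorem ptraceLast_locHom (t : ℕ) (X : EndVt n t) :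
    ptraceLast q t (locHom (lastEquiv n t) X) = (∑ a : VIdx n, traceWt q a) • X := by
  have h := ptraceLast_mul_left (q := q) t X 1
  rwa [mul_one, ptraceLast_one, Matrix.mul_smul, mul_one] at h

theorem locHom_onFactors (t i : ℕ) (h : i + 1 < t) (M : EndVV n) :
    locHom (lastEquiv n t) (onFactors M t i h) = onFactors M (t + 1) i (Nat.lt_succ_of_lt h) := by
  ext a b
  rw [locHom_apply, onFactors, onFactors, ← ite_and]
  refine if_congr ?_ rfl rfl
  constructor
  · rintro ⟨H1, H2⟩ j h1 h2
    induction j using Fin.lastCases with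
    | last => exact H1
    | cast j => exact H2 j h1 h2
  · intro H
    exact ⟨H (Fin.last t) (by simp; omega) (by simp; omega), fun j h1 h2 => H j.castSucc h1 h2⟩

theorem ptraceLast_onFactors {M : EndVV n} {u : ℂ}
    (hM : ∀ b b', ∑ d, traceWt q d * M (b, d) (b', d) = if b = b' then u else 0) (t : ℕ) :
    ptraceLast q (t + 1) (onFactors M (t + 2) t (by omega)) = u • 1 := by
  ext a b
  have h1 : ∀ d, onFactors M (t + 2) t (by omega) ((lastEquiv n (t + 1)).symm (a, d))
      ((lastEquiv n (t + 1)).symm (b, d)) = if Fin.init a = Fin.init b then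
        M (a (Fin.last t), d) (b (Fin.last t), d) else 0 := by
    intro d
    have e1 : ∀ c : Fin (t + 1) → VIdx n, (lastEquiv n (t + 1)).symm (c, d) ⟨t + 1, by omega⟩ = d :=
      fun c => Fin.snoc_last (α := fun _ => VIdx n) _ _
    have e2 : ∀ (c : Fin (t + 1) → VIdx n) (j : Fin (t + 1)),
        (lastEquiv n (t + 1)).symm (c, d) j.castSucc = c j :=
      fun c j => Fin.snoc_castSucc (α := fun _ => VIdx n) _ _ _
    have e3 : ∀ c : Fin (t + 1) → VIdx n, (lastEquiv n (t + 1)).symm (c, d) ⟨t, by omega⟩ = c (Fin.last t) :=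
      fun c => e2 c (Fin.last t)
    rw [onFactors, e1, e1, e3, e3]
    refine if_congr ?_ rfl rfl
    rw [funext_iff]
    constructor
    · intro H j
      have := H j.castSucc.castSucc (by simp; omega) (by simp; omega)
      rwa [e2, e2] at this
    · intro H j h1 h2
      induction j using Fin.lastCases with
      | last => exact absurd rfl h2
      | cast j =>
        rw [e2, e2]
        induction j using Fin.lastCases with
        | last => exact absurd rfl h1
        | cast j => exact H j
  rw [ptraceLast, Finset.sum_congr rfl fun d _ => congrArg _ (h1 d), Matrix.smul_apply, Matrix.one_apply,
    smul_eq_mul]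
  by_cases h2 : Fin.init a = Fin.init b
  · simp only [h2, if_true]
    rw [hM, mul_ite, mul_one, mul_zero]
    refine if_congr ⟨fun h => ?_, fun h => by rw [h]⟩ rfl rfl
    rw [← Fin.snoc_init_self a, ← Fin.snoc_init_self b, h2, h]
  · have h3 : a ≠ b := fun h => h2 (by rw [h])
    simp only [h2, h3, if_false, mul_zero, Finset.sum_const_zero]

end

/-! ### The structure of the Birman-Wenzl-Murakami algebra -/

section
variable {t : ℕ} {r q : ℂ}

theorem bwG_mul_bwGinv (i : ℕ) (h : i + 1 < t) : bwG t r q i h * bwGinv t r q i h = 1 := by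
  rw [bwG, bwGinv, ← map_mul, RingQuot.mkAlgHom_rel ℂ (BWRel.mul_inv i h), map_one]

theorem bwGinv_mul_bwG (i : ℕ) (h : i + 1 < t) : bwGinv t r q i h * bwG t r q i h = 1 := by
  rw [bwG, bwGinv, ← map_mul, RingQuot.mkAlgHom_rel ℂ (BWRel.inv_mul i h), map_one]

theorem bwE_eq (i : ℕ) (h : i + 1 < t) :
    bwE t r q i h = 1 - (q - q⁻¹)⁻¹ • (bwG t r q i h - bwGinv t r q i h) := by
  rw [bwE, freeE, map_sub, map_one, map_smul, map_sub, bwG, bwGinv]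

theorem bwGinv_eq (hz : q - q⁻¹ ≠ 0) (i : ℕ) (h : i + 1 < t) :
    bwGinv t r q i h = bwG t r q i h - (q - q⁻¹) • 1 + (q - q⁻¹) • bwE t r q i h := by
  rw [bwE_eq, smul_sub, smul_smul, mul_inv_cancel₀ hz, one_smul]
  abel

theorem bwG_comm (i j : ℕ) (hi : i + 1 < t) (hj : j + 1 < t) (hij : i + 1 < j ∨ j + 1 < i) :
    Commute (bwG t r q i hi) (bwG t r q j hj) := by
  rw [Commute, SemiconjBy, bwG, bwG, ← map_mul, ← map_mul,
    RingQuot.mkAlgHom_rel ℂ (BWRel.comm i j hi hj hij)]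

theorem bwG_braid (i : ℕ) (hi : i + 1 < t) (hi' : i + 1 + 1 < t) :
    bwG t r q i hi * bwG t r q (i + 1) hi' * bwG t r q i hi
      = bwG t r q (i + 1) hi' * bwG t r q i hi * bwG t r q (i + 1) hi' := by
  simp only [bwG, ← map_mul]
  exact RingQuot.mkAlgHom_rel ℂ (BWRel.braid i hi hi')

theorem bwE_mul_bwG (i : ℕ) (h : i + 1 < t) :
    bwE t r q i h * bwG t r q i h = r⁻¹ • bwE t r q i h := by
  rw [bwE, bwG, ← map_mul, RingQuot.mkAlgHom_rel ℂ (BWRel.e_mul_g i h), map_smul]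

theorem bwE_bwG_bwE (i : ℕ) (hi : i + 1 < t) (hi' : i + 1 + 1 < t) :
    bwE t r q (i + 1) hi' * bwG t r q i hi * bwE t r q (i + 1) hi' = r • bwE t r q (i + 1) hi' := by
  simp only [bwG, bwE, ← map_mul, ← map_smul]
  exact RingQuot.mkAlgHom_rel ℂ (BWRel.e_g_e i hi hi')

theorem bwE_bwGinv_bwE (i : ℕ) (hi : i + 1 < t) (hi' : i + 1 + 1 < t) :
    bwE t r q (i + 1) hi' * bwGinv t r q i hi * bwE t r q (i + 1) hi'
      = r⁻¹ • bwE t r q (i + 1) hi' := by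
  simp only [bwGinv, bwE, ← map_mul, ← map_smul]
  exact RingQuot.mkAlgHom_rel ℂ (BWRel.e_ginv_e i hi hi')

theorem commute_bwE_of_commute {X : BW t r q} {i : ℕ} {h : i + 1 < t} (hX : Commute X (bwG t r q i h))
    : Commute X (bwGinv t r q i h) ∧ Commute X (bwE t r q i h) := by
  let u : (BW t r q)ˣ := ⟨_, _, bwG_mul_bwGinv i h, bwGinv_mul_bwG i h⟩
  have h1 : Commute X (bwGinv t r q i h) := Commute.units_inv_right (u := u) hX
  refine ⟨h1, ?_⟩
  rw [bwE_eq]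
  exact (Commute.one_right X).sub_right ((hX.sub_right h1).smul_right _)

theorem bwG_mul_bwE (i : ℕ) (h : i + 1 < t) :
    bwG t r q i h * bwE t r q i h = r⁻¹ • bwE t r q i h := by
  rw [← bwE_mul_bwG]
  exact (commute_bwE_of_commute (Commute.refl _)).2.eq

theorem bwE_mul_bwGinv (hr : r ≠ 0) (i : ℕ) (h : i + 1 < t) :
    bwE t r q i h * bwGinv t r q i h = r • bwE t r q i h := by
  have h1 := congrArg (fun X => r • X * bwGinv t r q i h) (bwE_mul_bwG (r := r) (q := q) i h)
  simp only [smul_smul, mul_inv_cancel₀ hr, one_smul, smul_mul_assoc, mul_assoc, bwG_mul_bwGinv,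
    mul_one] at h1
  exact h1.symm

theorem bwE_mul_self (hr : r ≠ 0) (i : ℕ) (h : i + 1 < t) :
    bwE t r q i h * bwE t r q i h = bwX r q • bwE t r q i h := by
  conv_lhs => rw [bwE_eq i h]
  rw [← bwE_eq i h]
  conv_lhs => rhs; rw [bwE_eq i h]
  rw [mul_sub, mul_one, mul_smul_comm, mul_sub, bwE_mul_bwG, bwE_mul_bwGinv hr, bwX]
  module

theorem bwG_mul_self (hz : q - q⁻¹ ≠ 0) (i : ℕ) (h : i + 1 < t) :
    bwG t r q i h * bwG t r q i h
      = 1 + (q - q⁻¹) • bwG t r q i h - ((q - q⁻¹) * r⁻¹) • bwE t r q i h := by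
  have h1 := bwG_mul_bwGinv (r := r) (q := q) i h
  rw [bwGinv_eq hz, mul_add, mul_sub, mul_smul_comm, mul_smul_comm, bwG_mul_bwE, mul_one, smul_smul] at h1
  rw [← h1]
  abel

section
variable (i : ℕ) (hi : i + 1 < t) (hi' : i + 1 + 1 < t)

/-- Conjugation by `g_i g_{i+1}`. -/
theorem bwG_conj : SemiconjBy (bwG t r q i hi * bwG t r q (i + 1) hi') (bwG t r q i hi)
    (bwG t r q (i + 1) hi') := by
  rw [SemiconjBy, bwG_braid, mul_assoc]

/-- Conjugation by `g_{i+1} g_i`. -/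
theorem bwG_conj' : SemiconjBy (bwG t r q (i + 1) hi' * bwG t r q i hi) (bwG t r q (i + 1) hi')
    (bwG t r q i hi) := by
  rw [SemiconjBy, ← bwG_braid, mul_assoc]

theorem semiconjBy_bwE {X : BW t r q} {i j : ℕ} {hi : i + 1 < t} {hj : j + 1 < t}
    (hX : SemiconjBy X (bwG t r q i hi) (bwG t r q j hj)) :
    SemiconjBy X (bwE t r q i hi) (bwE t r q j hj) := by
  let u : (BW t r q)ˣ := ⟨_, _, bwG_mul_bwGinv i hi, bwGinv_mul_bwG i hi⟩
  let v : (BW t r q)ˣ := ⟨_, _, bwG_mul_bwGinv j hj, bwGinv_mul_bwG j hj⟩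
  have h1 : SemiconjBy X (bwGinv t r q i hi) (bwGinv t r q j hj) :=
    SemiconjBy.units_inv_right (x := u) (y := v) hX
  have h2 := hX.eq
  have h3 := h1.eq
  rw [SemiconjBy, bwE_eq, bwE_eq, mul_sub, sub_mul, mul_one, one_mul, mul_smul_comm, smul_mul_assoc,
    mul_sub, sub_mul, h2, h3]

theorem bwE_bwG_bwG : bwE t r q (i + 1) hi' * bwG t r q i hi * bwG t r q (i + 1) hi'
    = bwG t r q i hi * bwG t r q (i + 1) hi' * bwE t r q i hi := by
  rw [(semiconjBy_bwE (bwG_conj i hi hi')).eq, mul_assoc]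

theorem bwG_bwG_bwE : bwG t r q (i + 1) hi' * bwG t r q i hi * bwE t r q (i + 1) hi'
    = bwE t r q i hi * bwG t r q (i + 1) hi' * bwG t r q i hi := by
  rw [(semiconjBy_bwE (bwG_conj' i hi hi')).eq, mul_assoc]

theorem bwE_bwGinv_bwGinv : bwE t r q (i + 1) hi' * bwGinv t r q i hi * bwGinv t r q (i + 1) hi'
    = bwGinv t r q i hi * bwGinv t r q (i + 1) hi' * bwE t r q i hi := by
  let u : (BW t r q)ˣ := ⟨_, _, bwG_mul_bwGinv i hi, bwGinv_mul_bwG i hi⟩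
  let v : (BW t r q)ˣ := ⟨_, _, bwG_mul_bwGinv (i + 1) hi', bwGinv_mul_bwG (i + 1) hi'⟩
  have h1 : SemiconjBy ((v * u : (BW t r q)ˣ) : BW t r q) (bwE t r q (i + 1) hi') (bwE t r q i hi) :=
    semiconjBy_bwE (bwG_conj' i hi hi')
  have h2 := h1.units_inv_symm_left.eq
  rw [mul_inv_rev, Units.val_mul] at h2
  rw [mul_assoc]
  exact h2.symm

theorem bwGinv_bwGinv_bwE : bwGinv t r q (i + 1) hi' * bwGinv t r q i hi * bwE t r q (i + 1) hi'
    = bwE t r q i hi * bwGinv t r q (i + 1) hi' * bwGinv t r q i hi := by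
  let u : (BW t r q)ˣ := ⟨_, _, bwG_mul_bwGinv i hi, bwGinv_mul_bwG i hi⟩
  let v : (BW t r q)ˣ := ⟨_, _, bwG_mul_bwGinv (i + 1) hi', bwGinv_mul_bwG (i + 1) hi'⟩
  have h1 : SemiconjBy ((u * v : (BW t r q)ˣ) : BW t r q) (bwE t r q i hi) (bwE t r q (i + 1) hi') :=
    semiconjBy_bwE (bwG_conj i hi hi')
  have h2 := h1.units_inv_symm_left.eq
  rw [mul_inv_rev, Units.val_mul] at h2
  rw [mul_assoc (bwE t r q i hi)]
  exact h2

theorem bwE_bwE_bwE (hr : r ≠ 0) : bwE t r q (i + 1) hi' * bwE t r q i hi * bwE t r q (i + 1) hi'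
    = bwE t r q (i + 1) hi' := by
  rw [bwE_eq i hi, mul_sub, sub_mul, mul_one, bwE_mul_self hr, mul_smul_comm, smul_mul_assoc, mul_sub,
    sub_mul, bwE_bwG_bwE, bwE_bwGinv_bwE, bwX]
  module

end

end

section
variable (t : ℕ) {r q : ℂ}

theorem bwIncl_mkAlgHom (x : FreeAlgebra ℂ (BWGen t)) :
    bwIncl t r q (RingQuot.mkAlgHom ℂ (BWRel t r q) x)
      = RingQuot.mkAlgHom ℂ (BWRel (t + 1) r q) (freeIncl t x) :=
  RingQuot.liftAlgHom_mkAlgHom_apply ℂ ((RingQuot.mkAlgHom ℂ (BWRel (t + 1) r q)).comp (freeIncl t))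
    (fun _ _ h => RingQuot.mkAlgHom_rel ℂ (freeIncl_rel t r q h)) x

theorem bwIncl_bwG (i : ℕ) (h : i + 1 < t) :
    bwIncl t r q (bwG t r q i h) = bwG (t + 1) r q i (Nat.lt_succ_of_lt h) := by
  rw [bwG, bwIncl_mkAlgHom, freeIncl_g, bwG]

theorem bwIncl_bwGinv (i : ℕ) (h : i + 1 < t) :
    bwIncl t r q (bwGinv t r q i h) = bwGinv (t + 1) r q i (Nat.lt_succ_of_lt h) := by
  rw [bwGinv, bwIncl_mkAlgHom, freeIncl_ginv, bwGinv]

theorem bwIncl_bwE (i : ℕ) (h : i + 1 < t) :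
    bwIncl t r q (bwE t r q i h) = bwE (t + 1) r q i (Nat.lt_succ_of_lt h) := by
  rw [bwE_eq, bwE_eq, map_sub, map_one, map_smul, map_sub, bwIncl_bwG, bwIncl_bwGinv]

variable (r q)

/-- The span of `BW_{t+1}` and of `BW_{t+1} χ BW_{t+1}` in `BW_{t+2}`, where `χ` runs over the last
generators `g` and `e`. -/
def bwSpan : Submodule ℂ (BW (t + 2) r q) :=
  Submodule.span ℂ {X | (∃ a, X = bwIncl (t + 1) r q a) ∨
    ∃ χ ∈ ({bwG (t + 2) r q t (by omega), bwE (t + 2) r q t (by omega)} : Set (BW (t + 2) r q)),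
      ∃ a b, X = bwIncl (t + 1) r q a * χ * bwIncl (t + 1) r q b}

variable {t r q}

theorem incl_mem_bwSpan (a : BW (t + 1) r q) : bwIncl (t + 1) r q a ∈ bwSpan t r q :=
  Submodule.subset_span (Or.inl ⟨a, rfl⟩)

theorem incl_mul_mem_bwSpan (a : BW (t + 1) r q) {X : BW (t + 2) r q} (hX : X ∈ bwSpan t r q) :
    bwIncl (t + 1) r q a * X ∈ bwSpan t r q := by
  induction hX using Submodule.span_induction with
  | mem X hX =>
    rcases hX with ⟨b, rfl⟩ | ⟨χ, hχ, b, c, rfl⟩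
    · rw [← map_mul]; exact incl_mem_bwSpan _
    · rw [← mul_assoc, ← mul_assoc, ← map_mul]
      exact Submodule.subset_span (Or.inr ⟨χ, hχ, _, _, rfl⟩)
  | zero => rw [mul_zero]; exact zero_mem _
  | add X Y _ _ hX hY => rw [mul_add]; exact add_mem hX hY
  | smul c X _ hX => rw [mul_smul_comm]; exact Submodule.smul_mem _ _ hX

theorem mul_incl_mem_bwSpan (a : BW (t + 1) r q) {X : BW (t + 2) r q} (hX : X ∈ bwSpan t r q) :
    X * bwIncl (t + 1) r q a ∈ bwSpan t r q := by
  induction hX using Submodule.span_induction with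
  | mem X hX =>
    rcases hX with ⟨b, rfl⟩ | ⟨χ, hχ, b, c, rfl⟩
    · rw [← map_mul]; exact incl_mem_bwSpan _
    · rw [mul_assoc, ← map_mul]
      exact Submodule.subset_span (Or.inr ⟨χ, hχ, _, _, rfl⟩)
  | zero => rw [zero_mul]; exact zero_mem _
  | add X Y _ _ hX hY => rw [add_mul]; exact add_mem hX hY
  | smul c X _ hX => rw [smul_mul_assoc]; exact Submodule.smul_mem _ _ hX

theorem one_mem_bwSpan : (1 : BW (t + 2) r q) ∈ bwSpan t r q := by
  rw [← map_one (bwIncl (t + 1) r q)]; exact incl_mem_bwSpan _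

theorem top_mem_bwSpan {χ : BW (t + 2) r q}
    (hχ : χ ∈ ({bwG (t + 2) r q t (by omega), bwE (t + 2) r q t (by omega)} : Set (BW (t + 2) r q))) :
    χ ∈ bwSpan t r q :=
  Submodule.subset_span (Or.inr ⟨χ, hχ, 1, 1, by rw [map_one, one_mul, mul_one]⟩)

theorem bwG_mem_bwSpan : bwG (t + 2) r q t (by omega) ∈ bwSpan t r q := top_mem_bwSpan (Or.inl rfl)

theorem bwE_mem_bwSpan : bwE (t + 2) r q t (by omega) ∈ bwSpan t r q := top_mem_bwSpan (Or.inr rfl)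

theorem bwGinv_mem_bwSpan (hz : q - q⁻¹ ≠ 0) : bwGinv (t + 2) r q t (by omega) ∈ bwSpan t r q := by
  rw [bwGinv_eq hz]
  exact add_mem (sub_mem bwG_mem_bwSpan (Submodule.smul_mem _ _ one_mem_bwSpan))
    (Submodule.smul_mem _ _ bwE_mem_bwSpan)

theorem top_mul_top_mem_bwSpan (hr : r ≠ 0) (hz : q - q⁻¹ ≠ 0) {χ χ' : BW (t + 2) r q}
    (hχ : χ ∈ ({bwG (t + 2) r q t (by omega), bwE (t + 2) r q t (by omega)} : Set (BW (t + 2) r q)))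
    (hχ' : χ' ∈ ({bwG (t + 2) r q t (by omega), bwE (t + 2) r q t (by omega)} : Set (BW (t + 2) r q))) :
    χ * χ' ∈ bwSpan t r q := by
  rcases hχ with rfl | rfl <;> rcases hχ' with rfl | rfl
  · rw [bwG_mul_self hz]
    exact sub_mem (add_mem one_mem_bwSpan (Submodule.smul_mem _ _ bwG_mem_bwSpan))
      (Submodule.smul_mem _ _ bwE_mem_bwSpan)
  · rw [bwG_mul_bwE]; exact Submodule.smul_mem _ _ bwE_mem_bwSpan
  · rw [bwE_mul_bwG]; exact Submodule.smul_mem _ _ bwE_mem_bwSpan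
  · rw [bwE_mul_self hr]; exact Submodule.smul_mem _ _ bwE_mem_bwSpan

/-- The products of three alternating generators are reduced to products with a single generator of
the highest index. -/
theorem top_mul_mul_top_mem_bwSpan (hr : r ≠ 0) (hz : q - q⁻¹ ≠ 0) {χ χ' : BW (t + 3) r q}
    (hχ : χ ∈ ({bwG (t + 3) r q (t + 1) (by omega), bwE (t + 3) r q (t + 1) (by omega)} :
      Set (BW (t + 3) r q)))
    (hχ' : χ' ∈ ({bwG (t + 3) r q (t + 1) (by omega), bwE (t + 3) r q (t + 1) (by omega)} :
      Set (BW (t + 3) r q))) {η : BW (t + 2) r q}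
    (hη : η ∈ ({bwG (t + 2) r q t (by omega), bwE (t + 2) r q t (by omega)} : Set (BW (t + 2) r q))) :
    χ * bwIncl (t + 2) r q η * χ' ∈ bwSpan (t + 1) r q := by
  have hi : t + 1 < t + 3 := by omega
  have hi' : t + 1 + 1 < t + 3 := by omega
  have hg : bwG (t + 3) r q t hi = bwIncl (t + 2) r q (bwG (t + 2) r q t (by omega)) :=
    (bwIncl_bwG (t + 2) t (by omega)).symm
  have hgi : bwGinv (t + 3) r q t hi = bwIncl (t + 2) r q (bwGinv (t + 2) r q t (by omega)) :=
    (bwIncl_bwGinv (t + 2) t (by omega)).symm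
  have he : bwE (t + 3) r q t hi = bwIncl (t + 2) r q (bwE (t + 2) r q t (by omega)) :=
    (bwIncl_bwE (t + 2) t (by omega)).symm
  have hEgG : bwE (t + 3) r q (t + 1) hi' * bwG (t + 3) r q t hi * bwG (t + 3) r q (t + 1) hi'
      ∈ bwSpan (t + 1) r q := by
    rw [bwE_bwG_bwG, hg, he]
    exact mul_incl_mem_bwSpan _ (incl_mul_mem_bwSpan _ bwG_mem_bwSpan)
  have hGgE : bwG (t + 3) r q (t + 1) hi' * bwG (t + 3) r q t hi * bwE (t + 3) r q (t + 1) hi'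
      ∈ bwSpan (t + 1) r q := by
    rw [bwG_bwG_bwE, hg, he]
    exact mul_incl_mem_bwSpan _ (incl_mul_mem_bwSpan _ bwG_mem_bwSpan)
  have hG : bwG (t + 3) r q (t + 1) hi' = bwGinv (t + 3) r q (t + 1) hi' + (q - q⁻¹) • 1
      - (q - q⁻¹) • bwE (t + 3) r q (t + 1) hi' := by
    rw [bwGinv_eq hz]; abel
  have hEhG : bwE (t + 3) r q (t + 1) hi' * bwGinv (t + 3) r q t hi * bwG (t + 3) r q (t + 1) hi'
      ∈ bwSpan (t + 1) r q := by
    rw [hG, mul_sub, mul_add, mul_smul_comm, mul_smul_comm, mul_one, bwE_bwGinv_bwGinv, bwE_bwGinv_bwE,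
      hgi, he]
    exact sub_mem (add_mem
      (mul_incl_mem_bwSpan _ (incl_mul_mem_bwSpan _ (bwGinv_mem_bwSpan hz)))
      (Submodule.smul_mem _ _ (mul_incl_mem_bwSpan _ bwE_mem_bwSpan)))
      (Submodule.smul_mem _ _ (Submodule.smul_mem _ _ bwE_mem_bwSpan))
  have hGhE : bwG (t + 3) r q (t + 1) hi' * bwGinv (t + 3) r q t hi * bwE (t + 3) r q (t + 1) hi'
      ∈ bwSpan (t + 1) r q := by
    rw [hG, sub_mul, add_mul, sub_mul, add_mul, smul_mul_assoc, smul_mul_assoc, one_mul, smul_mul_assoc,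
      smul_mul_assoc, bwGinv_bwGinv_bwE, bwE_bwGinv_bwE, hgi, he]
    exact sub_mem (add_mem
      (mul_incl_mem_bwSpan _ (incl_mul_mem_bwSpan _ (bwGinv_mem_bwSpan hz)))
      (Submodule.smul_mem _ _ (incl_mul_mem_bwSpan _ bwE_mem_bwSpan)))
      (Submodule.smul_mem _ _ (Submodule.smul_mem _ _ bwE_mem_bwSpan))
  rcases hη with rfl | rfl
  · rw [← hg]
    rcases hχ with rfl | rfl <;> rcases hχ' with rfl | rfl
    · rw [← bwG_braid, hg]
      exact mul_incl_mem_bwSpan _ (incl_mul_mem_bwSpan _ bwG_mem_bwSpan)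
    · exact hGgE
    · exact hEgG
    · rw [bwE_bwG_bwE]; exact Submodule.smul_mem _ _ bwE_mem_bwSpan
  · rw [← he]
    rcases hχ with rfl | rfl <;> rcases hχ' with rfl | rfl
    · -- the braid relation gives `g' e g' = g⁻¹ e' g g'²`, and `g'²` is linear in `g'`, `e'`
      have h1 : bwG (t + 3) r q (t + 1) hi' * bwE (t + 3) r q t hi * bwG (t + 3) r q (t + 1) hi'
          = bwGinv (t + 3) r q t hi * (bwE (t + 3) r q (t + 1) hi' * bwG (t + 3) r q t hi
            * (bwG (t + 3) r q (t + 1) hi' * bwG (t + 3) r q (t + 1) hi')) := by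
        rw [← mul_assoc (_ * _), bwE_bwG_bwG, ← mul_assoc, ← mul_assoc, ← mul_assoc, bwGinv_mul_bwG, one_mul]
      rw [h1, hgi]
      refine incl_mul_mem_bwSpan _ ?_
      rw [bwG_mul_self hz, mul_sub, mul_add, mul_one, mul_smul_comm, mul_smul_comm, bwE_bwG_bwE]
      refine sub_mem (add_mem ?_ (Submodule.smul_mem _ _ hEgG))
        (Submodule.smul_mem _ _ (Submodule.smul_mem _ _ bwE_mem_bwSpan))
      rw [hg]
      exact mul_incl_mem_bwSpan _ bwE_mem_bwSpan
    · rw [bwE_eq t hi, mul_sub, sub_mul, mul_one, bwG_mul_bwE, mul_smul_comm, smul_mul_assoc, mul_sub, sub_mul]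
      exact sub_mem (Submodule.smul_mem _ _ bwE_mem_bwSpan)
        (Submodule.smul_mem _ _ (sub_mem hGgE hGhE))
    · rw [bwE_eq t hi, mul_sub, sub_mul, mul_one, bwE_mul_bwG, mul_smul_comm, smul_mul_assoc, mul_sub, sub_mul]
      exact sub_mem (Submodule.smul_mem _ _ bwE_mem_bwSpan)
        (Submodule.smul_mem _ _ (sub_mem hEgG hEhG))
    · rw [bwE_bwE_bwE t hi hi' hr]; exact bwE_mem_bwSpan

theorem exists_algebraMap_of_le_one (ht : t ≤ 1) (a : BW t r q) : ∃ c : ℂ, a = algebraMap ℂ _ c := by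
  have h1 : a ∈ (⊤ : Subalgebra ℂ (BW t r q)) := Algebra.mem_top
  have h2 : {X : BW t r q | ∃ (i : ℕ) (h : i + 1 < t), X = bwG t r q i h ∨ X = bwGinv t r q i h} = ∅ := by
    ext X
    simp only [Set.mem_ofPred_eq, Set.mem_empty_iff_false, iff_false]
    rintro ⟨i, h, -⟩
    omega
  rw [← bw_adjoin, h2, Algebra.adjoin_empty, Algebra.mem_bot] at h1
  obtain ⟨c, hc⟩ := h1
  exact ⟨c, hc.symm⟩

/-- The last generators of `BW_{t+3}` commute with `BW_{t+1}`. -/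
theorem commute_incl_incl {χ : BW (t + 3) r q}
    (hχ : χ ∈ ({bwG (t + 3) r q (t + 1) (by omega), bwE (t + 3) r q (t + 1) (by omega)} :
      Set (BW (t + 3) r q))) (a : BW (t + 1) r q) :
    Commute χ (bwIncl (t + 2) r q (bwIncl (t + 1) r q a)) := by
  have key : ∀ a : BW (t + 1) r q, Commute (bwG (t + 3) r q (t + 1) (by omega))
      (bwIncl (t + 2) r q (bwIncl (t + 1) r q a)) := by
    intro a
    have h1 : a ∈ (⊤ : Subalgebra ℂ (BW (t + 1) r q)) := Algebra.mem_top
    have h2 : Algebra.adjoin ℂ {X : BW (t + 1) r q | ∃ (i : ℕ) (h : i + 1 < t + 1),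
        X = bwG (t + 1) r q i h ∨ X = bwGinv (t + 1) r q i h} ≤
        (Subalgebra.centralizer ℂ {bwG (t + 3) r q (t + 1) (by omega)}).comap
          ((bwIncl (t + 2) r q).comp (bwIncl (t + 1) r q)) := by
      refine Algebra.adjoin_le ?_
      rintro _ ⟨i, h, hX⟩
      have h3 : Commute (bwG (t + 3) r q (t + 1) (by omega)) (bwG (t + 3) r q i (by omega)) :=
        bwG_comm _ _ _ _ (Or.inr (by omega))
      rw [SetLike.mem_coe, Subalgebra.mem_comap, Subalgebra.mem_centralizer_iff, AlgHom.comp_apply]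
      rintro _ rfl
      rcases hX with rfl | rfl
      · rw [bwIncl_bwG, bwIncl_bwG]
        exact h3.eq
      · rw [bwIncl_bwGinv, bwIncl_bwGinv]
        exact (commute_bwE_of_commute h3).1.eq
    rw [← bw_adjoin] at h1
    exact (Subalgebra.mem_centralizer_iff ℂ).1 (h2 h1) _ rfl
  rcases hχ with rfl | rfl
  · exact key a
  · exact (commute_bwE_of_commute (key a).symm).2.symm

/-- The span is a left ideal that contains `1` as soon as the products of two generators of highest index
with an element of `BW_{t+1}` in between lie in it. -/
theorem bwSpan_eq_top_of_top_mul (hz : q - q⁻¹ ≠ 0)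
    (h : ∀ χ ∈ ({bwG (t + 2) r q t (by omega), bwE (t + 2) r q t (by omega)} : Set (BW (t + 2) r q)),
      ∀ χ' ∈ ({bwG (t + 2) r q t (by omega), bwE (t + 2) r q t (by omega)} : Set (BW (t + 2) r q)),
        ∀ a, χ * bwIncl (t + 1) r q a * χ' ∈ bwSpan t r q) : bwSpan t r q = ⊤ := by
  have h1 : ∀ χ ∈ ({bwG (t + 2) r q t (by omega), bwE (t + 2) r q t (by omega)} : Set (BW (t + 2) r q)),
      ∀ X ∈ bwSpan t r q, χ * X ∈ bwSpan t r q := by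
    intro χ hχ X hX
    induction hX using Submodule.span_induction with
    | mem X hX =>
      rcases hX with ⟨b, rfl⟩ | ⟨χ', hχ', b, c, rfl⟩
      · exact mul_incl_mem_bwSpan _ (top_mem_bwSpan hχ)
      · rw [← mul_assoc, ← mul_assoc]
        exact mul_incl_mem_bwSpan _ (h χ hχ χ' hχ' b)
    | zero => rw [mul_zero]; exact zero_mem _
    | add X Y _ _ hX hY => rw [mul_add]; exact add_mem hX hY
    | smul c X _ hX => rw [mul_smul_comm]; exact Submodule.smul_mem _ _ hX
  rw [eq_top_iff]
  rintro Y -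
  have h2 : Y ∈ (⊤ : Subalgebra ℂ (BW (t + 2) r q)) := Algebra.mem_top
  rw [← bw_adjoin] at h2
  have h3 : ∀ X ∈ bwSpan t r q, Y * X ∈ bwSpan t r q := by
    induction h2 using Algebra.adjoin_induction with
    | mem Y hY =>
      obtain ⟨i, hi, hY⟩ := hY
      intro X hX
      by_cases hit : i = t
      · subst hit
        rcases hY with rfl | rfl
        · exact h1 _ (Or.inl rfl) X hX
        · rw [bwGinv_eq hz, add_mul, sub_mul, smul_mul_assoc, smul_mul_assoc, one_mul]
          exact add_mem (sub_mem (h1 _ (Or.inl rfl) X hX) (Submodule.smul_mem _ _ hX))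
            (Submodule.smul_mem _ _ (h1 _ (Or.inr rfl) X hX))
      · rcases hY with rfl | rfl
        · rw [← bwIncl_bwG (t + 1) i (by omega)]
          exact incl_mul_mem_bwSpan _ hX
        · rw [← bwIncl_bwGinv (t + 1) i (by omega)]
          exact incl_mul_mem_bwSpan _ hX
    | algebraMap c =>
      intro X hX
      rw [Algebra.algebraMap_eq_smul_one, smul_mul_assoc, one_mul]
      exact Submodule.smul_mem _ _ hX
    | add Y Z _ _ hY hZ =>
      intro X hX
      rw [add_mul]; exact add_mem (hY X hX) (hZ X hX)
    | mul Y Z _ _ hY hZ =>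
      intro X hX
      rw [mul_assoc]; exact hY _ (hZ X hX)
  have h4 := h3 1 one_mem_bwSpan
  rwa [mul_one] at h4

/-- Every element of `BW_{t+2}` is a combination of products that contain at most one of the generators of
highest index, and that at most once. -/
theorem bwSpan_eq_top (hr : r ≠ 0) (hz : q - q⁻¹ ≠ 0) (t : ℕ) : bwSpan t r q = ⊤ := by
  induction t with
  | zero =>
    refine bwSpan_eq_top_of_top_mul hz fun χ hχ χ' hχ' a => ?_
    obtain ⟨c, rfl⟩ := exists_algebraMap_of_le_one le_rfl a
    rw [AlgHom.commutes, Algebra.algebraMap_eq_smul_one, mul_smul_comm, mul_one, smul_mul_assoc]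
    exact Submodule.smul_mem _ _ (top_mul_top_mem_bwSpan hr hz hχ hχ')
  | succ t ih =>
    refine bwSpan_eq_top_of_top_mul hz fun χ hχ χ' hχ' a => ?_
    have ha : a ∈ bwSpan t r q := by rw [ih]; exact Submodule.mem_top
    induction ha using Submodule.span_induction with
    | mem a ha =>
      rcases ha with ⟨b, rfl⟩ | ⟨η, hη, b, c, rfl⟩
      · rw [(commute_incl_incl hχ b).eq, mul_assoc]
        exact incl_mul_mem_bwSpan _ (top_mul_top_mem_bwSpan hr hz hχ hχ')
      · rw [map_mul, map_mul, ← mul_assoc, ← mul_assoc, (commute_incl_incl hχ b).eq, mul_assoc,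
          (commute_incl_incl hχ' c).symm.eq, ← mul_assoc, mul_assoc _ χ, mul_assoc _ (χ * _)]
        exact mul_incl_mem_bwSpan _ (incl_mul_mem_bwSpan _ (top_mul_mul_top_mem_bwSpan hr hz hχ hχ' hη))
    | zero => rw [map_zero, mul_zero, zero_mul]; exact zero_mem _
    | add X Y _ _ hX hY => rw [map_add, mul_add, add_mul]; exact add_mem hX hY
    | smul c X _ hX =>
      rw [map_smul, mul_smul_comm, smul_mul_assoc]; exact Submodule.smul_mem _ _ hX

/-- The Markov property determines a Markov trace on the span in `bwSpan_eq_top`. -/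
theorem IsMarkovTrace.unique (hr : r ≠ 0) (hz : q - q⁻¹ ≠ 0) {tr tr' : ∀ t : ℕ, BW t r q →ₗ[ℂ] ℂ}
    (h : IsMarkovTrace r q tr) (h' : IsMarkovTrace r q tr') : tr' = tr := by
  have h0 : ∀ t ≤ 1, tr' t = tr t := by
    intro t ht
    ext a
    obtain ⟨c, rfl⟩ := exists_algebraMap_of_le_one ht a
    rw [Algebra.algebraMap_eq_smul_one, map_smul, map_smul, h.map_one, h'.map_one]
  funext t
  induction t with
  | zero => exact h0 0 zero_le_one
  | succ t ih =>
    cases t with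
    | zero => exact h0 1 le_rfl
    | succ t =>
      ext X
      have hX : X ∈ bwSpan t r q := by rw [bwSpan_eq_top hr hz]; exact Submodule.mem_top
      induction hX using Submodule.span_induction with
      | mem X hX =>
        rcases hX with ⟨b, rfl⟩ | ⟨χ, hχ, b, c, rfl⟩
        · rw [h.map_incl, h'.map_incl, ih]
        · rw [h.markov t b c χ hχ, h'.markov t b c χ hχ, ih]
          congr 1
          rcases hχ with rfl | rfl
          · rw [h.map_g, h'.map_g]
          · rw [h.map_e, h'.map_e]
      | zero => rw [map_zero, map_zero]
      | add X Y _ _ hX hY => rw [map_add, map_add, hX, hY]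
      | smul c X _ hX => rw [map_smul, map_smul, hX]

end

/-! ### The quantum supertrace as a Markov trace -/

section
variable {n : ℕ} {q : ℂ}

theorem qSupertrace_zero_one (hq : q ≠ 0) : qSupertrace n q 0 1 = 1 := by
  rw [qSupertrace_apply hq, Fintype.sum_unique, Matrix.one_apply_eq, mul_one, Finset.univ_eq_empty,
    Finset.prod_empty]

theorem qSdim_eq_sum (hq : q ≠ 0) : qSdim n q = ∑ a : VIdx n, traceWt q a := by
  rw [qSdim, qSupertrace_succ hq, ptraceLast_one, map_smul, qSupertrace_zero_one hq, smul_eq_mul, mul_one]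

theorem qSdim_eq_bwX (hq : q ≠ 0) (hq2 : q ^ 2 ≠ 1) : qSdim n q = bwX (-q ^ (2 * n)) q := by
  rw [qSdim_eq_sum hq, sum_traceWt_eq_bwX hq hq2]

/-- `(q - q⁻¹) sdim_q V = -q^{-2n} (q^{2n-1} - 1) (q^{2n+1} + 1)`, which does not vanish as `q` is not a
root of unity. -/
theorem qSdim_ne_zero (hn : 1 ≤ n) (hq : q ≠ 0) (hq_root : ∀ m : ℕ, 0 < m → q ^ m ≠ 1) :
    qSdim n q ≠ 0 := by
  have hq2 := hq_root 2 (by norm_num)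
  have hz := sub_inv_ne_zero_of_sq hq hq2
  rw [qSdim_eq_bwX hq hq2, bwX]
  intro h
  obtain ⟨m, rfl⟩ : ∃ m, n = m + 1 := ⟨n - 1, by omega⟩
  have h1 : (q ^ (2 * m + 1) - 1) * (q ^ (2 * m + 3) + 1) = 0 := by
    have h2 : (q - q⁻¹) + (-q ^ (2 * (m + 1)) - (-q ^ (2 * (m + 1)))⁻¹) = 0 := by
      have h3 := congrArg (fun y => (q - q⁻¹) * y) h
      simp only [mul_add, mul_one, mul_zero] at h3
      rwa [mul_div_cancel₀ _ hz] at h3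
    have hp : q ^ (2 * (m + 1)) ≠ 0 := pow_ne_zero _ hq
    rw [inv_neg] at h2
    field_simp at h2
    have h4 : q * ((q ^ (2 * m + 1) - 1) * (q ^ (2 * m + 3) + 1)) = 0 := by
      linear_combination (-1 : ℂ) * h2
    exact (mul_eq_zero.1 h4).resolve_left hq
  rcases mul_eq_zero.1 h1 with h2 | h2
  · exact hq_root _ (by omega) (sub_eq_zero.1 h2)
  · refine hq_root (2 * (2 * m + 3)) (by omega) ?_
    rw [mul_comm, pow_mul, eq_neg_of_add_eq_zero_left h2]
    norm_num

theorem qSupertrace_one (hq : q ≠ 0) (t : ℕ) : qSupertrace n q t 1 = qSdim n q ^ t := by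
  induction t with
  | zero => rw [qSupertrace_zero_one hq, pow_zero]
  | succ t ih =>
    rw [qSupertrace_succ hq, ptraceLast_one, map_smul, ih, ← qSdim_eq_sum hq, smul_eq_mul, pow_succ']

theorem qSupertrace_locHom (hq : q ≠ 0) (t : ℕ) (X : EndVt n t) :
    qSupertrace n q (t + 1) (locHom (lastEquiv n t) X) = qSdim n q * qSupertrace n q t X := by
  rw [qSupertrace_succ hq, ptraceLast_locHom, map_smul, ← qSdim_eq_sum hq, smul_eq_mul]

/-- If the partial quantum supertrace of `M` over its second factor is the scalar `u`, then the
quantum supertrace of `M` acting on two adjacent factors is `u (sdim_q V)^{t-1}`. -/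
theorem qSupertrace_onFactors (hq : q ≠ 0) {M : EndVV n} {u : ℂ}
    (hM : ∀ b b', ∑ d, traceWt q d * M (b, d) (b', d) = if b = b' then u else 0) (t i : ℕ)
    (h : i + 1 < t + 1) : qSupertrace n q (t + 1) (onFactors M (t + 1) i h) = u * qSdim n q ^ t := by
  induction t with
  | zero => omega
  | succ t ih =>
    rcases Nat.lt_or_ge (i + 1) (t + 1) with hi | hi
    · rw [← locHom_onFactors (t + 1) i hi, qSupertrace_locHom hq, ih hi, pow_succ]
      ring
    · obtain rfl : i = t := by omega
      rw [qSupertrace_succ hq, ptraceLast_onFactors hM, map_smul, qSupertrace_one hq, smul_eq_mul]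

variable (hn : 1 ≤ n) (hq : q ≠ 0) (hq2 : q ^ 2 ≠ 1)

theorem bwRep_bwIncl (t : ℕ) (a : BW t (-q ^ (2 * n)) q) :
    bwRep hn hq hq2 (t + 1) (bwIncl t _ q a) = locHom (lastEquiv n t) (bwRep hn hq hq2 t a) := by
  have h1 : a ∈ (⊤ : Subalgebra ℂ (BW t (-q ^ (2 * n)) q)) := Algebra.mem_top
  have h2 : (⊤ : Subalgebra ℂ (BW t (-q ^ (2 * n)) q)) ≤
      AlgHom.equalizer ((bwRep hn hq hq2 (t + 1)).comp (bwIncl t _ q))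
        ((locHom (lastEquiv n t)).comp (bwRep hn hq hq2 t)) := by
    rw [← bw_adjoin, Algebra.adjoin_le_iff]
    rintro _ ⟨i, h, rfl | rfl⟩
    · change bwRep hn hq hq2 (t + 1) (bwIncl t _ q _) = locHom (lastEquiv n t) (bwRep hn hq hq2 t _)
      rw [bwIncl_bwG, bwRep_g, bwRep_g, locHom_onFactors]
    · change bwRep hn hq hq2 (t + 1) (bwIncl t _ q _) = locHom (lastEquiv n t) (bwRep hn hq hq2 t _)
      rw [bwIncl_bwGinv, bwRep_ginv, bwRep_ginv, locHom_onFactors]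
  exact h2 h1

/-- The quantum supertrace of the representation of `BW_t(-q^{2n}, q)` on `V^{⊗t}`, divided by
`(sdim_q V)^t`. -/
def markovTrace (t : ℕ) : BW t (-q ^ (2 * n)) q →ₗ[ℂ] ℂ :=
  (qSdim n q ^ t)⁻¹ • qSupertrace n q t ∘ₗ (bwRep hn hq hq2 t).toLinearMap

theorem markovTrace_apply (t : ℕ) (a : BW t (-q ^ (2 * n)) q) :
    markovTrace hn hq hq2 t a = qSupertrace n q t (bwRep hn hq hq2 t a) / qSdim n q ^ t := by
  rw [div_eq_inv_mul]
  rfl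

theorem markovTrace_of_bwRep_eq (hx : qSdim n q ≠ 0) {t i : ℕ} {h : i + 1 < t}
    {χ : BW t (-q ^ (2 * n)) q} {M : EndVV n} {u : ℂ}
    (hχ : bwRep hn hq hq2 t χ = onFactors M t i h)
    (hM : ∀ b b', ∑ d, traceWt q d * M (b, d) (b', d) = if b = b' then u else 0) :
    markovTrace hn hq hq2 t χ = u / bwX (-q ^ (2 * n)) q := by
  obtain ⟨s, rfl⟩ : ∃ s, t = s + 1 := ⟨t - 1, by omega⟩
  rw [markovTrace_apply, hχ, qSupertrace_onFactors hq hM, ← qSdim_eq_bwX hq hq2, pow_succ,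
    mul_comm, mul_div_mul_left _ _ (pow_ne_zero s hx)]

/-- The Markov property, from the partial supertrace over the last factor. -/
theorem markovTrace_mul_mul (hx : qSdim n q ≠ 0) {t : ℕ} {χ : BW (t + 2) (-q ^ (2 * n)) q}
    {M : EndVV n} {u : ℂ} (hχ : bwRep hn hq hq2 (t + 2) χ = onFactors M (t + 2) t (by omega))
    (hM : ∀ b b', ∑ d, traceWt q d * M (b, d) (b', d) = if b = b' then u else 0)
    (a b : BW (t + 1) (-q ^ (2 * n)) q) :
    markovTrace hn hq hq2 (t + 2) (bwIncl (t + 1) _ q a * χ * bwIncl (t + 1) _ q b)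
      = markovTrace hn hq hq2 (t + 2) χ * markovTrace hn hq hq2 (t + 1) (a * b) := by
  rw [markovTrace_of_bwRep_eq hn hq hq2 hx hχ hM, markovTrace_apply, markovTrace_apply,
    map_mul (bwRep hn hq hq2 (t + 2)), map_mul (bwRep hn hq hq2 (t + 2)), hχ, bwRep_bwIncl,
    bwRep_bwIncl, qSupertrace_succ hq, ptraceLast_mul_right,
    ptraceLast_mul_left, ptraceLast_onFactors hM, Matrix.mul_smul, mul_one, Matrix.smul_mul, map_smul,
    ← map_mul (bwRep hn hq hq2 (t + 1)), ← qSdim_eq_bwX hq hq2, smul_eq_mul, pow_succ' _ (t + 1), mul_div_mul_comm]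

theorem isMarkovTrace_markovTrace (hx : qSdim n q ≠ 0) :
    IsMarkovTrace (-q ^ (2 * n)) q (markovTrace hn hq hq2) where
  map_one t := by
    rw [markovTrace_apply, map_one, qSupertrace_one hq, div_self (pow_ne_zero t hx)]
  map_mul_comm t a b := by
    rw [markovTrace_apply, markovTrace_apply, map_mul (bwRep hn hq hq2 t),
      map_mul (bwRep hn hq hq2 t), qSupertrace_mul_comm hn hq hq2 t (AlgHom.mem_range_self _ a)]
  map_incl t a := by
    rw [markovTrace_apply, markovTrace_apply, bwRep_bwIncl, qSupertrace_locHom hq, pow_succ',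
      mul_div_mul_left _ _ hx]
  map_g t i h := markovTrace_of_bwRep_eq hn hq hq2 hx (bwRep_g hn hq hq2 t i h) (ptrace_gMat hq)
  map_e t i h := markovTrace_of_bwRep_eq hn hq hq2 hx (bwRep_e hn hq hq2 t i h) (ptrace_cupCap hq)
  markov t a b χ hχ := by
    rcases hχ with rfl | rfl
    · exact markovTrace_mul_mul hn hq hq2 hx (bwRep_g hn hq hq2 _ _ _) (ptrace_gMat hq) a b
    · exact markovTrace_mul_mul hn hq hq2 hx (bwRep_e hn hq hq2 _ _ _) (ptrace_cupCap hq) a b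

end

/-- A surjective homomorphism that carries one functional to a non-zero multiple of another maps
annihilator ideal onto annihilator ideal. -/
theorem image_annihilatorIdeal {A B : Type*} [Ring A] [Algebra ℂ A] [Ring B] [Algebra ℂ B]
    (Υ : A →ₐ[ℂ] B) (hΥ : Function.Surjective Υ) {f : A →ₗ[ℂ] ℂ} {g : B →ₗ[ℂ] ℂ} {c : ℂ} (hc : c ≠ 0)
    (h : ∀ a, g (Υ a) / c = f a) :
    Υ '' (annihilatorIdeal f : Set A) = (annihilatorIdeal g : Set B) := by
  have key : ∀ b, b ∈ annihilatorIdeal f ↔ Υ b ∈ annihilatorIdeal g := by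
    intro b
    change (∀ a, f (a * b) = 0) ↔ ∀ a, g (a * Υ b) = 0
    rw [hΥ.forall]
    refine forall_congr' fun a => ?_
    rw [← h, map_mul, div_eq_zero_iff, or_iff_left hc]
  ext y
  constructor
  · rintro ⟨b, hb, rfl⟩
    exact (key b).1 hb
  · intro hy
    obtain ⟨b, rfl⟩ := hΥ y
    exact ⟨b, (key b).2 hy, rfl⟩

end
end OspBMW

open OspBMW
theorem mainTheorem5 (n : ℕ) (hn : 1 ≤ n) (q : ℂ) (hq : q ≠ 0)
    (hq_root : ∀ m : ℕ, 0 < m → q ^ m ≠ 1)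
    (L : List (Fin n → ℤ)) (hL : IsNormalOrdering n L)
    (E F : (Fin n → ℤ) → EndV n) (hEF : IsRootVectors n q L E F) :
    qSdim n q ≠ 0 ∧
    ∃ tr : ∀ t : ℕ, BW t (-q ^ (2 * n)) q →ₗ[ℂ] ℂ,
      IsMarkovTrace (-q ^ (2 * n)) q tr ∧
      (∀ tr', IsMarkovTrace (-q ^ (2 * n)) q tr' → tr' = tr) ∧
      ∀ t : ℕ, ∃ Υ : BW t (-q ^ (2 * n)) q →ₐ[ℂ] algC n q L E F t,
        (∀ (i : ℕ) (h : i + 1 < t),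
          (Υ (bwG t (-q ^ (2 * n)) q i h) : EndVt n t) = -rCheckAt n q L E F t i h) ∧
        (∀ a, psi n q L E F t (Υ a) = tr t a) ∧
        Υ '' (annihilatorIdeal (tr t) : Set (BW t (-q ^ (2 * n)) q))
          = (annihilatorIdeal (strC n q L E F t) : Set (algC n q L E F t)) := by
  have hq2 : q ^ 2 ≠ 1 := hq_root 2 (by norm_num)
  have hx := qSdim_ne_zero hn hq hq_root
  have hM := isMarkovTrace_markovTrace hn hq hq2 hx
  refine ⟨hx, markovTrace hn hq hq2, hM, fun tr' h =>
    hM.unique (neg_ne_zero.2 (pow_ne_zero _ hq)) (sub_inv_ne_zero_of_sq hq hq2) h, fun t => ?_⟩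
  have hC := range_bwRep_eq_algC hn hq hq2 hL hEF t
  let Υ : BW t (-q ^ (2 * n)) q →ₐ[ℂ] algC n q L E F t :=
    (bwRep hn hq hq2 t).codRestrict _ fun a => hC ▸ AlgHom.mem_range_self _ a
  have hΥ : Function.Surjective Υ := by
    rintro ⟨X, hX⟩
    obtain ⟨a, rfl⟩ : X ∈ (bwRep hn hq hq2 t).range := hC ▸ hX
    exact ⟨a, rfl⟩
  have hψ : ∀ a, strC n q L E F t (Υ a) / qSdim n q ^ t = markovTrace hn hq hq2 t a := fun a =>
    (markovTrace_apply hn hq hq2 t a).symm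
  exact ⟨Υ, fun i h => (bwRep_g hn hq hq2 t i h).trans (neg_rCheckAt hq hq2 hL hEF t i h).symm, hψ,
    image_annihilatorIdeal Υ hΥ (pow_ne_zero t hx) hψ⟩
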